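/- Let $\mathbb K$ be a field. Chain complexes are unbounded complexes of $\mathbb K$-vector spaces, with $d$ of degree $-1$ and the Koszul sign rule; $[V,W]$ denotes the internal hom complex, with $[V,W]_n=\prod_l \mathrm{Hom}(V_l,W_{l+n})$ and $D(f)=d f-(-1)^{|f|}f d$. Let $\mathsf{uCocom}$ be the category of counital cocommutative (coassociative) coalgebras in chain complexes, monoidal for the tensor product over $\mathbb K$. Let $\mathscr P$ be a dg operad (symmetric and unital, with operations of every arity $n\ge 0$), and let $\mathscr P\text{-}\mathsf{alg}$ be the category of $\mathscr P$-algebras. **Theorem.** The category $\mathscr P\text{-}\mathsf{alg}$ is tensored, cotensored and enriched over $\mathsf{uCocom}$. That is, there are functors $$\{-,-\}:\mathscr P\text{-}\mathsf{alg}^{op}\times\mathscr P\text{-}\mathsf{alg}\to\mathsf{uCocom},\quad -\triangleleft-:\mathscr P\text{-}\mathsf{alg}\times\mathsf{uCocom}\to\mathscr P\text{-}\mathsf{alg},\quad [-,-]:\mathsf{uCocom}^{op}\times\mathscr P\text{-}\mathsf{alg}\to\mathscr P\text{-}\mathsf{alg}$$ and bijections, natural in all variables, $$\mathrm{Hom}_{\mathscr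 P\text{-}\mathsf{alg}}(A\triangleleft C,A')\simeq\mathrm{Hom}_{\mathsf{uCocom}}(C,\{A,A'\})\simeq\mathrm{Hom}_{\mathscr P\text{-}\mathsf{alg}}(A,[C,A']),$$ such that $\triangleleft$ is a right action of $\mathsf{uCocom}$ on $\mathscr P\text{-}\mathsf{alg}$ (with coherent isomorphisms $A\triangleleft(C\otimes D)\simeq(A\triangleleft C)\triangleleft D$ and $A\triangleleft\mathbb K\simeq A$), $[-,-]$ is a left coaction (with coherent isomorphisms $[C\otimes D,A]\simeq[C,[D,A]]$ and $[\mathbb K,A]\simeq A$), and the two families of structure isomorphisms correspond to each other under the bijections. Moreover: 1. (Cotensor.) $[C,A]$ is the convolution algebra: the complex $[C,A]$, naturally in $C$ and $A$, with the operations, for $p\in\mathscr P(n)$, $$\gamma(p;f_1,\dots,f_n)=\gamma_A(p\otimes-)\circ(f_1\otimes\dots\otimes f_n)\circ\Delta^{n-1}\quad(n\ge1),\qquad \gamma(p)=\gamma_A(p)\,\epsilon\quad(n=0),$$ where $\Delta^{n-1}:C\to C^{\otimes n}$ is the iterated coproduct and $\epsilon$ the counit. Its coaction isomorphisms are $f\mapsto(x\mapsto(y\mapsto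 f(x\otimes y)))$ and $f\mapsto f(1)$. 2. (Tensor.) $A\triangleleft C$ is the quotient of the free $\mathscr P$-algebra on the complex $A\otimes C$ by the ideal (subcomplex absorbing all operations) generated by the relations $$\gamma_A(p;y_1,\dots,y_n)\otimes x\sim\sum(-1)^{\sum_{i<j}|x_{(i)}||y_j|}\,p\big(y_1\otimes x_{(1)},\dots,y_n\otimes x_{(n)}\big)\quad(n\ge1),\qquad \gamma_A(p)\otimes x\sim\epsilon(x)\,p\quad(n=0),$$ for homogeneous $y_1,\dots,y_n\in A$, $x\in C$ and $p\in\mathscr P(n)$, with $\Delta^{n-1}(x)=\sum x_{(1)}\otimes\dots\otimes x_{(n)}$; the unit $A\to[C,A\triangleleft C]$ of the adjunction sends $y$ to $x\mapsto[y\otimes x]$. 3. (Enrichment.) The bifunctor $\{-,-\}$ carries an associative and unital composition $\{A,A'\}\otimes\{A',A''\}\to\{A,A''\}$ with units $\mathbb K\to\{A,A\}$, functorial in all variables, namely those adjoint to $$A\triangleleft(\{A,A'\}\otimes\{A',A''\})\simeq(A\triangleleft\{A,A'\})\triangleleft\{A',A''\}\to A'\triangleleft\{A',A''\}\to A''\quad\text{and}\quad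 A\triangleleft\mathbb K\simeq A.$$ 4. (Atoms.) For all $\mathscr P$-algebras $A,A'$, the dg atoms of $\{A,A'\}$ (the nonzero elements $a$ with $\Delta a=a\otimes a$ and $da=0$) are the morphisms from $A$ to $A'$: sending $a$ to the map $x\mapsto u(x)(a)$, where $u:A\to[\{A,A'\},A']$ corresponds to the identity of $\{A,A'\}$, is a bijection from the set of dg atoms of $\{A,A'\}$ onto $\mathrm{Hom}_{\mathscr P\text{-}\mathsf{alg}}(A,A')$. -/

import Mathlib

open CategoryTheory MonoidalCategory Opposite
open scoped TensorProduct

universe u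

/-- A chain complex of vector spaces over `K` (differential of degree `-1`, unbounded), presented as
a vector space `V = ⨁ Vₙ` with its decomposition into homogeneous components. -/
structure DGMod (K : Type u) [Field K] where
  carrier : Type u
  [addCommGroup : AddCommGroup carrier]
  [module : Module K carrier]
  /-- the subspace of homogeneous elements of degree `n` -/
  gr : ℤ → Submodule K carrier
  isInternal : DirectSum.IsInternal gr
  d : carrier →ₗ[K] carrier
  d_mem : ∀ {n : ℤ} {x : carrier}, x ∈ gr n → d x ∈ gr (n - 1)
  d_d : ∀ x, d (d x) = 0

namespace DGMod

variable {K : Type u} [Field K]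

instance : CoeSort (DGMod K) (Type u) := ⟨DGMod.carrier⟩

attribute [instance] DGMod.addCommGroup DGMod.module

/-- Morphisms of chain complexes: linear maps of degree `0` commuting with the differentials. -/
@[ext]
structure Hom (V W : DGMod K) where
  lin : V →ₗ[K] W
  map_mem : ∀ {n : ℤ} {x : V}, x ∈ V.gr n → lin x ∈ W.gr n
  map_d : ∀ x, lin (V.d x) = W.d (lin x)

instance : Category (DGMod K) where
  Hom := Hom
  id V := ⟨LinearMap.id, fun h => h, fun _ => rfl⟩
  comp f g := ⟨g.lin ∘ₗ f.lin, fun h => g.map_mem (f.map_mem h), fun x => by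
    simp [f.map_d, g.map_d]⟩

/-- The linear map underlying a morphism of chain complexes. -/
def lin {V W : DGMod K} (f : V ⟶ W) : V →ₗ[K] W := Hom.lin f

theorem lin_mem {V W : DGMod K} (f : V ⟶ W) {n : ℤ} {x : V} (h : x ∈ V.gr n) :
    lin f x ∈ W.gr n := Hom.map_mem f h

theorem lin_d {V W : DGMod K} (f : V ⟶ W) (x : V) : lin f (V.d x) = W.d (lin f x) :=
  Hom.map_d f x

theorem hom_ext {V W : DGMod K} {f g : V ⟶ W} (h : lin f = lin g) : f = g := Hom.ext h

@[simp] theorem lin_id (V : DGMod K) : lin (𝟙 V) = LinearMap.id := rfl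

@[simp] theorem lin_comp {V W X : DGMod K} (f : V ⟶ W) (g : W ⟶ X) :
    lin (f ≫ g) = lin g ∘ₗ lin f := rfl

/-- The decomposition of a chain complex into its homogeneous components. -/
noncomputable def split (V : DGMod K) : V ≃ₗ[K] DirectSum ℤ fun n => V.gr n :=
  (LinearEquiv.ofBijective (DirectSum.coeLinearMap V.gr)
    (show Function.Bijective (DirectSum.coeLinearMap V.gr) from V.isInternal)).symm

theorem split_of_mem (V : DGMod K) {n : ℤ} {x : V} (h : x ∈ V.gr n) :
    V.split x = DirectSum.lof K ℤ (fun n => V.gr n) n ⟨x, h⟩ := by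
  rw [split, LinearEquiv.symm_apply_eq, LinearEquiv.ofBijective_apply,
    DirectSum.coeLinearMap_lof]

/-- The linear map that is `φ n` on the homogeneous component of degree `n`. -/
noncomputable def elim (V : DGMod K) {M : Type*} [AddCommGroup M] [Module K M]
    (φ : ℤ → (V →ₗ[K] M)) : V →ₗ[K] M :=
  DirectSum.toModule K ℤ M (fun n => φ n ∘ₗ (V.gr n).subtype) ∘ₗ V.split.toLinearMap

theorem elim_of_mem (V : DGMod K) {M : Type*} [AddCommGroup M] [Module K M]
    (φ : ℤ → (V →ₗ[K] M)) {n : ℤ} {x : V} (h : x ∈ V.gr n) : V.elim φ x = φ n x := by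
  simp only [elim, LinearMap.comp_apply, LinearEquiv.coe_coe, V.split_of_mem h,
    DirectSum.toModule_lof]
  rfl

theorem homogeneous_induction (V : DGMod K) {p : V → Prop} (x : V)
    (h0 : p 0) (hadd : ∀ x y, p x → p y → p (x + y))
    (hh : ∀ n x, x ∈ V.gr n → p x) : p x := by
  have hx : x ∈ ⨆ n, V.gr n := by
    rw [V.isInternal.submodule_iSup_eq_top]; trivial
  exact Submodule.iSup_induction V.gr (motive := p) hx hh h0 hadd

theorem linearMap_ext (V : DGMod K) {M : Type*} [AddCommGroup M] [Module K M]
    {f g : V →ₗ[K] M} (h : ∀ n x, x ∈ V.gr n → f x = g x) : f = g := by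
  ext x
  exact V.homogeneous_induction (p := fun x => f x = g x) x (by simp)
    (fun x y hx hy => by simp [hx, hy]) h

/-- The operator `x ↦ (-1)^(q|x|) x` of the Koszul sign rule for moving something of degree `q`
past `x`. -/
noncomputable def koszul (V : DGMod K) (q : ℤ) : V →ₗ[K] V :=
  V.elim fun n => ((-1 : K) ^ (q * n)) • LinearMap.id

theorem koszul_of_mem (V : DGMod K) (q : ℤ) {n : ℤ} {x : V} (h : x ∈ V.gr n) :
    V.koszul q x = ((-1 : K) ^ (q * n)) • x := by
  rw [koszul, V.elim_of_mem _ h]; rfl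

theorem koszul_mem (V : DGMod K) (q : ℤ) {n : ℤ} {x : V} (h : x ∈ V.gr n) :
    V.koszul q x ∈ V.gr n := by
  rw [V.koszul_of_mem q h]; exact Submodule.smul_mem _ _ h

/-! ### The tensor product -/

/-- Homogeneous elements of degree `n` in a tensor product. -/
def tensorGr (V W : DGMod K) (n : ℤ) : Submodule K (V ⊗[K] W) :=
  Submodule.span K {t | ∃ (p q : ℤ) (v : V) (w : W),
    v ∈ V.gr p ∧ w ∈ W.gr q ∧ p + q = n ∧ t = v ⊗ₜ[K] w}

theorem tmul_mem {V W : DGMod K} {p q n : ℤ} {v : V} {w : W} (hv : v ∈ V.gr p) (hw : w ∈ W.gr q)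
    (h : p + q = n) : v ⊗ₜ[K] w ∈ tensorGr V W n :=
  Submodule.subset_span ⟨p, q, v, w, hv, hw, h, rfl⟩

theorem tensor_induction {V W : DGMod K} {p : V ⊗[K] W → Prop} (x : V ⊗[K] W)
    (h0 : p 0) (hadd : ∀ x y, p x → p y → p (x + y))
    (hh : ∀ m n v w, v ∈ V.gr m → w ∈ W.gr n → p (v ⊗ₜ w)) : p x := by
  induction x using TensorProduct.induction_on with
  | zero => exact h0
  | add x y hx hy => exact hadd x y hx hy
  | tmul v w =>
    refine V.homogeneous_induction (p := fun v => p (v ⊗ₜ w)) v (by simpa using h0)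
      (fun x y hx hy => ?_) (fun m v hv => ?_)
    · rw [TensorProduct.add_tmul]; exact hadd _ _ hx hy
    · refine W.homogeneous_induction (p := fun w => p (v ⊗ₜ w)) w (by simpa using h0)
        (fun x y hx hy => ?_)
        (fun n w hw => hh m n v w hv hw)
      rw [TensorProduct.tmul_add]; exact hadd _ _ hx hy

theorem tensor_ext {V W : DGMod K} {M : Type*} [AddCommGroup M] [Module K M]
    {f g : V ⊗[K] W →ₗ[K] M}
    (h : ∀ m n v w, v ∈ V.gr m → w ∈ W.gr n → f (v ⊗ₜ w) = g (v ⊗ₜ w)) : f = g := by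
  ext1
  refine V.linearMap_ext fun m v hv => W.linearMap_ext fun n w hw => h m n v w hv hw

theorem tensor_mem {V W : DGMod K} {M : Type*} [AddCommGroup M] [Module K M] (S : Submodule K M)
    (f : V ⊗[K] W →ₗ[K] M) {n : ℤ}
    (h : ∀ p q v w, v ∈ V.gr p → w ∈ W.gr q → p + q = n → f (v ⊗ₜ w) ∈ S) {x : V ⊗[K] W}
    (hx : x ∈ tensorGr V W n) : f x ∈ S := by
  have : tensorGr V W n ≤ S.comap f := by
    refine Submodule.span_le.2 ?_
    rintro _ ⟨p, q, v, w, hv, hw, hn, rfl⟩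
    exact h p q v w hv hw hn
  exact this hx

/-- Splitting of a tensor product into its homogeneous components. -/
noncomputable def tensorSplit (V W : DGMod K) :
    V ⊗[K] W →ₗ[K] DirectSum ℤ fun n => tensorGr V W n :=
  TensorProduct.lift
    (DirectSum.toModule K ℤ _ (fun p =>
      (LinearMap.lcomp K _ W.split.toLinearMap) ∘ₗ LinearMap.flip (DirectSum.toModule K ℤ _ (fun q =>
        LinearMap.mk₂ K (fun (w : W.gr q) (v : V.gr p) =>
          DirectSum.lof K ℤ (fun n => tensorGr V W n) (p + q)
            ⟨(v : V) ⊗ₜ[K] (w : W), tmul_mem v.2 w.2 rfl⟩)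
          (fun w w' v => by
            rw [← map_add]; congr 1; ext; simp [TensorProduct.tmul_add])
          (fun c w v => by
            rw [← map_smul]; congr 1; ext; simp)
          (fun w v v' => by
            rw [← map_add]; congr 1; ext; simp [TensorProduct.add_tmul])
          (fun c w v => by
            rw [← map_smul]; congr 1)))) ∘ₗ V.split.toLinearMap)

theorem tensorSplit_tmul (V W : DGMod K) {p q : ℤ} {v : V} {w : W} (hv : v ∈ V.gr p)
    (hw : w ∈ W.gr q) : tensorSplit V W (v ⊗ₜ w) =
      DirectSum.lof K ℤ (fun n => tensorGr V W n) (p + q) ⟨v ⊗ₜ[K] w, tmul_mem hv hw rfl⟩ := by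
  simp [tensorSplit, split_of_mem V hv, split_of_mem W hw]

theorem tensor_isInternal (V W : DGMod K) : DirectSum.IsInternal (tensorGr V W) := by
  have h1 : DirectSum.coeLinearMap (tensorGr V W) ∘ₗ tensorSplit V W = LinearMap.id := by
    refine tensor_ext fun m n v w hv hw => ?_
    simp [tensorSplit_tmul V W hv hw]
  have h2 : tensorSplit V W ∘ₗ DirectSum.coeLinearMap (tensorGr V W) = LinearMap.id := by
    refine DirectSum.linearMap_ext _ fun n => ?_
    ext1 ⟨x, hx⟩
    simp only [LinearMap.comp_apply, DirectSum.coeLinearMap_lof, LinearMap.id_apply]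
    induction hx using Submodule.span_induction with
    | mem x h =>
      obtain ⟨p, q, v, w, hv, hw, rfl, rfl⟩ := h
      exact tensorSplit_tmul V W hv hw
    | zero => rw [map_zero]; symm; exact map_zero _
    | add x y hx hy h h' => rw [map_add, h, h', ← map_add]; rfl
    | smul c x hx h => rw [map_smul, h, ← map_smul]; rfl
  refine ⟨fun x y h => ?_, fun x => ⟨tensorSplit V W x, LinearMap.congr_fun h1 x⟩⟩
  have h' : DirectSum.coeLinearMap (tensorGr V W) x = DirectSum.coeLinearMap (tensorGr V W) y := h
  have := congrArg (tensorSplit V W) h'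
  rwa [← LinearMap.comp_apply, ← LinearMap.comp_apply, h2] at this

/-- The differential `d(v ⊗ w) = dv ⊗ w + (-1)^|v| v ⊗ dw`. -/
noncomputable def tensorD (V W : DGMod K) : V ⊗[K] W →ₗ[K] V ⊗[K] W :=
  TensorProduct.map V.d LinearMap.id + TensorProduct.map (V.koszul 1) W.d

theorem tensorD_tmul (V W : DGMod K) {p : ℤ} {v : V} (w : W) (hv : v ∈ V.gr p) :
    tensorD V W (v ⊗ₜ w) = V.d v ⊗ₜ w + ((-1 : K) ^ p) • (v ⊗ₜ W.d w) := by
  simp [tensorD, V.koszul_of_mem 1 hv, TensorProduct.smul_tmul']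

theorem neg_one_zpow_sub_one (n : ℤ) : (-1 : K) ^ (n - 1) = - (-1 : K) ^ n := by
  rw [zpow_sub_one₀ (by simp)]; simp

/-- The tensor product of chain complexes. -/
noncomputable abbrev tensor (V W : DGMod K) : DGMod K where
  carrier := V ⊗[K] W
  gr := tensorGr V W
  isInternal := tensor_isInternal V W
  d := tensorD V W
  d_mem {n x} hx := by
    induction hx using Submodule.span_induction with
    | mem x h =>
      obtain ⟨p, q, v, w, hv, hw, rfl, rfl⟩ := h
      rw [tensorD_tmul V W w hv]
      exact add_mem (tmul_mem (V.d_mem hv) hw (by ring))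
        (Submodule.smul_mem _ _ (tmul_mem hv (W.d_mem hw) (by ring)))
    | zero => simp
    | add x y hx hy h h' => rw [map_add]; exact add_mem h h'
    | smul c x hx h => rw [map_smul]; exact Submodule.smul_mem _ _ h
  d_d x := by
    refine tensor_induction (p := fun x => tensorD V W (tensorD V W x) = 0) x (by simp)
      (fun x y hx hy => by rw [map_add, map_add, hx, hy, add_zero])
      (fun m n v w hv hw => ?_)
    rw [tensorD_tmul V W w hv, map_add, map_smul, tensorD_tmul V W w (V.d_mem hv),
      tensorD_tmul V W (W.d w) hv, V.d_d, W.d_d, neg_one_zpow_sub_one]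
    simp

/-- The ground field, in degree `0`. -/
abbrev unit (K : Type u) [Field K] : DGMod K where
  carrier := K
  gr n := if n = 0 then ⊤ else ⊥
  isInternal := by
    refine DirectSum.isInternal_submodule_of_iSupIndep_of_iSup_eq_top ?_ ?_
    · intro i
      by_cases hi : i = 0
      · subst hi
        simp only [if_true]
        have : (⨆ j, ⨆ (_ : j ≠ (0 : ℤ)), (if j = 0 then (⊤ : Submodule K K) else ⊥)) = ⊥ := by
          simp +contextual
        rw [this]; exact disjoint_bot_right
      · simp [hi]
    · rw [eq_top_iff]
      exact le_iSup_of_le 0 (by simp)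
  d := 0
  d_mem _ := by simp
  d_d _ := rfl

theorem mem_unit (c : K) : (show unit K from c) ∈ (unit K).gr 0 := by
  simp only [unit, if_true]; exact Submodule.mem_top

/-- Projection onto the homogeneous component of degree `n`. -/
noncomputable def proj (V : DGMod K) (n : ℤ) : V →ₗ[K] V :=
  V.elim fun m => if m = n then LinearMap.id else 0

theorem proj_mem (V : DGMod K) (n : ℤ) (x : V) : V.proj n x ∈ V.gr n := by
  refine V.homogeneous_induction (p := fun x => V.proj n x ∈ V.gr n) x (by simp)
    (fun x y hx hy => by rw [map_add]; exact add_mem hx hy) (fun m x hx => ?_)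
  rw [proj, V.elim_of_mem _ hx]
  split_ifs with h
  · subst h; exact hx
  · exact zero_mem _

theorem proj_of_mem (V : DGMod K) {n : ℤ} {x : V} (h : x ∈ V.gr n) : V.proj n x = x := by
  rw [proj, V.elim_of_mem _ h, if_pos rfl]; rfl

/-- An invertible linear map of degree `0` commuting with the differentials is an isomorphism of
chain complexes. -/
def isoOfEquiv {V W : DGMod K} (e : V ≃ₗ[K] W)
    (hm : ∀ {n : ℤ} {x : V}, x ∈ V.gr n → e x ∈ W.gr n) (hd : ∀ x, e (V.d x) = W.d (e x)) :
    V ≅ W where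
  hom := ⟨e.toLinearMap, hm, hd⟩
  inv := ⟨e.symm.toLinearMap, fun {n y} hy => by
      have h : ∀ x, e (V.proj n x) = W.proj n (e x) := fun x => by
        refine V.homogeneous_induction (p := fun x => e (V.proj n x) = W.proj n (e x)) x (by simp)
          (fun x y hx hy => by simp only [map_add, hx, hy]) (fun m x hx => ?_)
        rw [proj, proj, V.elim_of_mem _ hx, W.elim_of_mem _ (hm hx)]
        split_ifs <;> simp
      have h2 : V.proj n (e.symm y) = e.symm y := by
        apply e.injective
        rw [h, e.apply_symm_apply, W.proj_of_mem hy]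
      have := V.proj_mem n (e.symm y)
      rwa [h2] at this,
    fun y => by
      apply e.injective
      simp [hd]⟩
  hom_inv_id := by
    apply hom_ext; ext x; exact e.symm_apply_apply x
  inv_hom_id := by
    apply hom_ext; ext x; exact e.apply_symm_apply x

/-- The tensor product of morphisms of chain complexes. -/
noncomputable def tensorMap {V V' W W' : DGMod K} (f : V ⟶ V') (g : W ⟶ W') :
    tensor V W ⟶ tensor V' W' where
  lin := TensorProduct.map (lin f) (lin g)
  map_mem hx := tensor_mem _ _ (fun _ _ _ _ hv hw h => tmul_mem (lin_mem f hv) (lin_mem g hw) h) hx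
  map_d x := by
    change V ⊗[K] W at x
    change TensorProduct.map (lin f) (lin g) (tensorD V W x)
      = tensorD V' W' (TensorProduct.map (lin f) (lin g) x)
    rw [← LinearMap.comp_apply, ← LinearMap.comp_apply]
    congr 1
    refine tensor_ext fun m n v w hv hw => ?_
    simp [tensorD_tmul _ _ _ hv, tensorD_tmul _ _ _ (lin_mem f hv), lin_d]

theorem tensor_mem₃ {U V W : DGMod K} {M : Type*} [AddCommGroup M] [Module K M]
    (S : Submodule K M) (f : (U ⊗[K] V) ⊗[K] W →ₗ[K] M) {n : ℤ}
    (h : ∀ p q r u v w, u ∈ U.gr p → v ∈ V.gr q → w ∈ W.gr r → p + q + r = n →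
      f ((u ⊗ₜ v) ⊗ₜ w) ∈ S) {x : (U ⊗[K] V) ⊗[K] W}
    (hx : x ∈ tensorGr (tensor U V) W n) : f x ∈ S :=
  tensor_mem (V := tensor U V) (W := W) S f (fun m r t w ht hw hm =>
    tensor_mem S (f ∘ₗ (TensorProduct.mk K (U ⊗[K] V) W).flip w)
      (fun p q u v hu hv hpq => h p q r u v w hu hv hw (by rw [hpq, hm])) ht) hx

theorem tensor_ext₃ {U V W : DGMod K} {M : Type*} [AddCommGroup M] [Module K M]
    {f g : (U ⊗[K] V) ⊗[K] W →ₗ[K] M}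
    (h : ∀ p q r u v w, u ∈ U.gr p → v ∈ V.gr q → w ∈ W.gr r →
      f ((u ⊗ₜ v) ⊗ₜ w) = g ((u ⊗ₜ v) ⊗ₜ w)) : f = g := by
  ext1
  refine tensor_ext fun p q u v hu hv => W.linearMap_ext fun r w hw => h p q r u v w hu hv hw

theorem tensor_ext₃' {U V W : DGMod K} {M : Type*} [AddCommGroup M] [Module K M]
    {f g : U ⊗[K] (V ⊗[K] W) →ₗ[K] M}
    (h : ∀ p q r u v w, u ∈ U.gr p → v ∈ V.gr q → w ∈ W.gr r →
      f (u ⊗ₜ (v ⊗ₜ w)) = g (u ⊗ₜ (v ⊗ₜ w))) : f = g := by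
  apply TensorProduct.ext
  refine U.linearMap_ext fun p u hu => tensor_ext fun q r v w hv hw => h p q r u v w hu hv hw

/-- The associator. -/
noncomputable def assocIso (U V W : DGMod K) :
    tensor (tensor U V) W ≅ tensor U (tensor V W) :=
  isoOfEquiv (TensorProduct.assoc K U V W)
    (fun hx => tensor_mem₃ _ (TensorProduct.assoc K U V W).toLinearMap
      (fun _ _ _ _ _ _ hu hv hw h => tmul_mem (W := tensor V W) hu (tmul_mem hv hw rfl)
        (by rw [← h, add_assoc])) hx)
    (fun x => by
      have : (TensorProduct.assoc K U V W).toLinearMap ∘ₗ tensorD (tensor U V) W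
          = tensorD U (tensor V W) ∘ₗ (TensorProduct.assoc K U V W).toLinearMap := by
        refine tensor_ext₃ fun p q r u v w hu hv hw => ?_
        have h1 : u ⊗ₜ[K] v ∈ (tensor U V).gr (p + q) := tmul_mem hu hv rfl
        simp [tensorD_tmul (tensor U V) W w h1, tensorD_tmul U V v hu, tensorD_tmul V W w hv,
          tensorD_tmul U (tensor V W) (v ⊗ₜ w) hu, TensorProduct.add_tmul, TensorProduct.tmul_add,
          ← TensorProduct.smul_tmul', add_assoc, zpow_add₀ (neg_ne_zero.2 (one_ne_zero (α := K))),
          mul_smul]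
      exact LinearMap.congr_fun this x)

theorem unit_mem {n : ℤ} {c : K} (h : c ∈ (unit K).gr n) : n = 0 ∨ c = 0 := by
  by_cases hn : n = 0
  · exact Or.inl hn
  · right; simpa [hn] using h

/-- The left unitor. -/
noncomputable def leftUnitIso (V : DGMod K) : tensor (unit K) V ≅ V :=
  isoOfEquiv (TensorProduct.lid K V)
    (fun hx => tensor_mem (V := unit K) _ (TensorProduct.lid K V).toLinearMap
      (fun p q c v hc hv h => by
        rcases unit_mem hc with rfl | rfl
        · rw [zero_add] at h; subst h
          exact Submodule.smul_mem _ c hv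
        · simp) hx)
    (fun x => by
      have : (TensorProduct.lid K V).toLinearMap ∘ₗ tensorD (unit K) V
          = V.d ∘ₗ (TensorProduct.lid K V).toLinearMap := by
        refine tensor_ext (V := unit K) fun p q c v hc hv => ?_
        rcases unit_mem hc with rfl | rfl
        · simp [tensorD_tmul (unit K) V v hc]
        · simp
      exact LinearMap.congr_fun this x)

/-- The right unitor. -/
noncomputable def rightUnitIso (V : DGMod K) : tensor V (unit K) ≅ V :=
  isoOfEquiv (TensorProduct.rid K V)
    (fun hx => tensor_mem (W := unit K) _ (TensorProduct.rid K V).toLinearMap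
      (fun p q v c hv hc h => by
        rcases unit_mem hc with rfl | rfl
        · rw [add_zero] at h; subst h
          exact Submodule.smul_mem _ c hv
        · simp) hx)
    (fun x => by
      have : (TensorProduct.rid K V).toLinearMap ∘ₗ tensorD V (unit K)
          = V.d ∘ₗ (TensorProduct.rid K V).toLinearMap := by
        refine tensor_ext (W := unit K) fun p q v c hv hc => ?_
        simp [tensorD_tmul V (unit K) c hv]
      exact LinearMap.congr_fun this x)

noncomputable instance : MonoidalCategoryStruct (DGMod K) where
  tensorObj := tensor
  tensorHom := tensorMap
  whiskerLeft V _ _ f := tensorMap (𝟙 V) f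
  whiskerRight f W := tensorMap f (𝟙 W)
  tensorUnit := unit K
  associator := assocIso
  leftUnitor := leftUnitIso
  rightUnitor := rightUnitIso

noncomputable instance : MonoidalCategory (DGMod K) where
  tensorHom_def f g := hom_ext (TensorProduct.ext' fun _ _ => rfl)
  id_tensorHom_id V W := hom_ext (TensorProduct.ext' fun _ _ => rfl)
  tensorHom_comp_tensorHom f g h k := hom_ext (TensorProduct.ext' fun _ _ => rfl)
  whiskerLeft_id V W := hom_ext (TensorProduct.ext' fun _ _ => rfl)
  id_whiskerRight V W := hom_ext (TensorProduct.ext' fun _ _ => rfl)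
  associator_naturality f g h := hom_ext (TensorProduct.ext_threefold fun _ _ _ => rfl)
  leftUnitor_naturality f := hom_ext (TensorProduct.ext' fun c v => by
    change c • lin f v = lin f (c • v)
    simp)
  rightUnitor_naturality f := hom_ext (TensorProduct.ext' fun v c => by
    change c • lin f v = lin f (c • v)
    simp)
  pentagon V W X Y := hom_ext (TensorProduct.ext_fourfold fun _ _ _ _ => rfl)
  triangle V W := hom_ext (TensorProduct.ext_threefold fun v c w =>
    (TensorProduct.smul_tmul c v w).symm)

/-- The braiding `v ⊗ w ↦ (-1)^(|v||w|) w ⊗ v`, as a linear map. -/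
noncomputable def swap (V W : DGMod K) : V ⊗[K] W →ₗ[K] W ⊗[K] V :=
  TensorProduct.lift
    (V.elim fun p => (LinearMap.lcomp K _ (W.koszul p)) ∘ₗ (TensorProduct.mk K W V).flip)

theorem swap_tmul {V W : DGMod K} {p q : ℤ} {v : V} {w : W} (hv : v ∈ V.gr p) (hw : w ∈ W.gr q) :
    swap V W (v ⊗ₜ w) = ((-1 : K) ^ (p * q)) • (w ⊗ₜ v) := by
  simp [swap, V.elim_of_mem _ hv, W.koszul_of_mem p hw, TensorProduct.smul_tmul']

theorem neg_one_zpow_mul_self (n : ℤ) : (-1 : K) ^ n * (-1 : K) ^ n = 1 := by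
  rw [← mul_zpow]; simp

theorem swap_swap (V W : DGMod K) : swap W V ∘ₗ swap V W = LinearMap.id := by
  refine tensor_ext fun p q v w hv hw => ?_
  simp [swap_tmul hv hw, swap_tmul hw hv, smul_smul, mul_comm q p, neg_one_zpow_mul_self]

/-- The braiding. -/
noncomputable def braidIso (V W : DGMod K) : tensor V W ≅ tensor W V :=
  isoOfEquiv (LinearEquiv.ofLinearMap (swap V W) (swap W V) (swap_swap W V) (swap_swap V W))
    (fun hx => tensor_mem _ (swap V W) (fun p q v w hv hw h => by
      rw [swap_tmul hv hw]
      exact Submodule.smul_mem _ _ (tmul_mem hw hv (by rw [add_comm, h]))) hx)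
    (fun x => by
      have : swap V W ∘ₗ tensorD V W = tensorD W V ∘ₗ swap V W := by
        refine tensor_ext fun p q v w hv hw => ?_
        have h1 : (-1 : K) ^ ((p - 1) * q) = (-1 : K) ^ (p * q) * (-1 : K) ^ q := by
          rw [sub_mul, one_mul, zpow_sub₀ (by simp), div_eq_mul_inv, ← inv_zpow]; simp
        have h2 : (-1 : K) ^ p * (-1 : K) ^ (p * (q - 1)) = (-1 : K) ^ (p * q) := by
          rw [mul_sub, mul_one, zpow_sub₀ (by simp)]
          field_simp
        simp [tensorD_tmul V W w hv, tensorD_tmul W V v hw, swap_tmul hv hw,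
          swap_tmul (V.d_mem hv) hw, swap_tmul hv (W.d_mem hw), smul_smul, h1, h2]
        rw [add_comm]
      exact LinearMap.congr_fun this x)

noncomputable instance : SymmetricCategory (DGMod K) where
  braiding := braidIso
  braiding_naturality_right U V W f := hom_ext (tensor_ext fun p q u v hu hv => by
    change swap U W (u ⊗ₜ lin f v) = TensorProduct.map (lin f) LinearMap.id (swap U V (u ⊗ₜ v))
    simp [swap_tmul hu hv, swap_tmul hu (lin_mem f hv)])
  braiding_naturality_left f W := hom_ext (tensor_ext fun p q u v hu hv => by
    change swap _ W (lin f u ⊗ₜ v) = TensorProduct.map LinearMap.id (lin f) (swap _ W (u ⊗ₜ v))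
    simp [swap_tmul hu hv, swap_tmul (lin_mem f hu) hv])
  hexagon_forward U V W := hom_ext (tensor_ext₃ fun p q r u v w hu hv hw => by
    change TensorProduct.assoc K V W U (swap U (tensor V W) (u ⊗ₜ (v ⊗ₜ w))) =
      TensorProduct.map LinearMap.id (swap U W)
        (TensorProduct.assoc K V U W ((swap U V (u ⊗ₜ v)) ⊗ₜ w))
    have h1 : v ⊗ₜ[K] w ∈ (tensor V W).gr (q + r) := tmul_mem hv hw rfl
    simp [swap_tmul hu h1, swap_tmul hu hv, swap_tmul hu hw, ← TensorProduct.smul_tmul',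
      smul_smul, mul_add, zpow_add₀ (neg_ne_zero.2 (one_ne_zero (α := K)))])
  hexagon_reverse U V W := hom_ext (tensor_ext₃' fun p q r u v w hu hv hw => by
    change (TensorProduct.assoc K W U V).symm (swap (tensor U V) W ((u ⊗ₜ v) ⊗ₜ w)) =
      TensorProduct.map (swap U W) LinearMap.id
        ((TensorProduct.assoc K U W V).symm (u ⊗ₜ (swap V W (v ⊗ₜ w))))
    have h1 : u ⊗ₜ[K] v ∈ (tensor U V).gr (p + q) := tmul_mem hu hv rfl
    simp [swap_tmul h1 hw, swap_tmul hv hw, swap_tmul hu hw, ← TensorProduct.smul_tmul',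
      smul_smul, add_mul, zpow_add₀ (neg_ne_zero.2 (one_ne_zero (α := K)))]
    rw [mul_comm])
  symmetry V W := hom_ext (swap_swap V W)

/-! ### The internal hom -/

/-- Linear maps of degree `n`. -/
def homGr (V W : DGMod K) (n : ℤ) : Submodule K (V →ₗ[K] W) where
  carrier := {f | ∀ p x, x ∈ V.gr p → f x ∈ W.gr (p + n)}
  add_mem' hf hg p x hx := add_mem (hf p x hx) (hg p x hx)
  zero_mem' _ _ _ := zero_mem _
  smul_mem' c _ hf p x hx := Submodule.smul_mem _ c (hf p x hx)

/-- The space `⨁ₙ Hom(V, W)ₙ` of finite sums of homogeneous linear maps. -/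
def homTotal (V W : DGMod K) : Submodule K (V →ₗ[K] W) := ⨆ n, homGr V W n

theorem hom_isInternal (V W : DGMod K) :
    DirectSum.IsInternal fun n => (homGr V W n).comap (homTotal V W).subtype := by
  refine DirectSum.isInternal_submodule_of_iSupIndep_of_iSup_eq_top ?_ ?_
  · refine iSupIndep_def.2 fun i => Submodule.disjoint_def.2 fun f hf hf' => ?_
    have key : ∀ p x, x ∈ V.gr p → W.proj (p + i) (f.1 x) = 0 := by
      refine Submodule.iSup_induction _
        (motive := fun f => ∀ p x, x ∈ V.gr p → W.proj (p + i) (f.1 x) = 0) hf' ?_ ?_ ?_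
      · intro j f hf p x hx
        by_cases hj : j = i
        · simp only [hj, ne_eq, not_true_eq_false, iSup_false, Submodule.mem_bot] at hf
          rw [hf]; simp
        · simp only [ne_eq, hj, not_false_eq_true, iSup_pos] at hf
          have h : f.1 x ∈ W.gr (p + j) := hf p x hx
          rw [proj, W.elim_of_mem _ h, if_neg (by omega)]
          rfl
      · intro p x _; simp
      · intro f g hf hg p x hx
        have := congrArg₂ (· + ·) (hf p x hx) (hg p x hx)
        simpa using this
    apply Subtype.ext
    refine V.linearMap_ext fun p x hx => ?_
    have h : f.1 x ∈ W.gr (p + i) := hf p x hx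
    rw [← W.proj_of_mem h]
    exact key p x hx
  · apply Submodule.map_injective_of_injective (homTotal V W).injective_subtype
    rw [Submodule.map_iSup, Submodule.map_subtype_top]
    simp only [Submodule.map_comap_subtype]
    exact iSup_congr fun n => inf_eq_right.2 (le_iSup (homGr V W) n)

/-- The operator `f ↦ d ∘ f - (-1)^|f| f ∘ d` -/
noncomputable def homD (V W : DGMod K) : (V →ₗ[K] W) →ₗ[K] (V →ₗ[K] W) where
  toFun f := W.d ∘ₗ f - W.koszul 1 ∘ₗ f ∘ₗ V.koszul 1 ∘ₗ V.d
  map_add' f g := by ext; simp; abel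
  map_smul' c f := by ext; simp [smul_sub]

theorem homD_of_mem {V W : DGMod K} {n : ℤ} {f : V →ₗ[K] W} (hf : f ∈ homGr V W n) :
    homD V W f = W.d ∘ₗ f - ((-1 : K) ^ n) • (f ∘ₗ V.d) := by
  refine V.linearMap_ext fun p x hx => ?_
  have h1 := V.d_mem hx
  have h2 := hf _ _ h1
  simp [homD, V.koszul_of_mem 1 h1, W.koszul_of_mem 1 h2, smul_smul,
    zpow_add₀ (neg_ne_zero.2 (one_ne_zero (α := K))), ← mul_assoc, neg_one_zpow_mul_self]

theorem homD_mem {V W : DGMod K} {n : ℤ} {f : V →ₗ[K] W} (hf : f ∈ homGr V W n) :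
    homD V W f ∈ homGr V W (n - 1) := by
  rw [homD_of_mem hf]
  refine sub_mem (fun p x hx => ?_) (Submodule.smul_mem _ _ fun p x hx => ?_)
  · have := W.d_mem (hf p x hx)
    rwa [add_sub_assoc] at this
  · have := hf _ _ (V.d_mem hx)
    rwa [show p - 1 + n = p + (n - 1) by ring] at this

theorem homD_total {V W : DGMod K} {f : V →ₗ[K] W} (hf : f ∈ homTotal V W) :
    homD V W f ∈ homTotal V W :=
  Submodule.iSup_induction _ (motive := fun f => homD V W f ∈ homTotal V W) hf
    (fun n _ h => Submodule.mem_iSup_of_mem (n - 1) (homD_mem h))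
    (by rw [map_zero]; exact zero_mem _)
    (fun f g hf hg => by rw [map_add]; exact add_mem hf hg)

/-- The internal hom `[V, W]`: in degree `n` it consists of the linear maps of degree `n`, that is
`∏ₚ Hom(Vₚ, Wₚ₊ₙ)`; its differential is `f ↦ d ∘ f - (-1)^|f| f ∘ d`. -/
noncomputable def ihom (V W : DGMod K) : DGMod K where
  carrier := homTotal V W
  gr n := (homGr V W n).comap (homTotal V W).subtype
  isInternal := hom_isInternal V W
  d := (homD V W).restrict fun _ h => homD_total h
  d_mem hf := homD_mem hf
  d_d f := by
    apply Subtype.ext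
    change homD V W (homD V W (f : V →ₗ[K] W)) = 0
    refine Submodule.iSup_induction _ (motive := fun f => homD V W (homD V W f) = 0) f.2
      (fun n f h => ?_) (by simp) (fun f g hf hg => by simp [hf, hg])
    rw [homD_of_mem (homD_mem h), homD_of_mem h, neg_one_zpow_sub_one]
    ext x
    simp [V.d_d, W.d_d]

/-- An element of the internal hom, as a linear map. -/
noncomputable def ihomCoe (V W : DGMod K) : ihom V W →ₗ[K] (V →ₗ[K] W) := (homTotal V W).subtype

end DGMod

/-! ### Counital cocommutative coalgebras -/

section CommComonMonoidal

/-! The monoidal structure on commutative comonoids, inherited from the one on comonoids. -/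

variable {D : Type*} [Category* D] [MonoidalCategory D] [SymmetricCategory D]

noncomputable instance : MonoidalCategoryStruct (CommComon D) where
  tensorObj A B := ⟨A.X ⊗ B.X⟩
  whiskerLeft A _ _ f := ⟨A.toComon ◁ f.hom⟩
  whiskerRight f B := ⟨f.hom ▷ B.toComon⟩
  tensorHom f g := ⟨f.hom ⊗ₘ g.hom⟩
  tensorUnit := CommComon.trivial D
  associator A B C := InducedCategory.isoMk (α_ A.toComon B.toComon C.toComon)
  leftUnitor A := InducedCategory.isoMk (λ_ A.toComon)
  rightUnitor A := InducedCategory.isoMk (ρ_ A.toComon)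

noncomputable instance : MonoidalCategory (CommComon D) where
  tensorHom_def f g := InducedCategory.hom_ext (tensorHom_def f.hom g.hom)
  id_tensorHom_id A B := InducedCategory.hom_ext (id_tensorHom_id A.toComon B.toComon)
  tensorHom_comp_tensorHom f g h k :=
    InducedCategory.hom_ext (tensorHom_comp_tensorHom f.hom g.hom h.hom k.hom)
  whiskerLeft_id A B := InducedCategory.hom_ext (whiskerLeft_id A.toComon B.toComon)
  id_whiskerRight A B := InducedCategory.hom_ext (id_whiskerRight A.toComon B.toComon)
  associator_naturality f g h := InducedCategory.hom_ext (associator_naturality f.hom g.hom h.hom)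
  leftUnitor_naturality f := InducedCategory.hom_ext (leftUnitor_naturality f.hom)
  rightUnitor_naturality f := InducedCategory.hom_ext (rightUnitor_naturality f.hom)
  pentagon A B C E :=
    InducedCategory.hom_ext (pentagon A.toComon B.toComon C.toComon E.toComon)
  triangle A B := InducedCategory.hom_ext (triangle A.toComon B.toComon)

end CommComonMonoidal

/-- The category of counital cocommutative coalgebras in chain complexes. -/
abbrev UCocom (K : Type u) [Field K] := CommComon (DGMod K)

namespace UCocom

variable {K : Type u} [Field K]

/-- The linear map underlying a morphism of coalgebras. -/
def lin {C D : UCocom K} (f : C ⟶ D) : C.X →ₗ[K] D.X := DGMod.lin f.hom.hom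

/-- The counit `ε`, as a linear form. -/
noncomputable def counit (C : UCocom K) : C.X →ₗ[K] K := DGMod.lin (ComonObj.counit (X := C.X))

/-- The coproduct `Δ`, as a linear map. -/
noncomputable def comul (C : UCocom K) : C.X →ₗ[K] C.X ⊗[K] C.X := DGMod.lin (ComonObj.comul (X := C.X))

/-- The iterated coproduct `C → C^{⊗ n}`; it is `ε` for `n = 0` and the identity for `n = 1`. -/
noncomputable def iterComul (C : UCocom K) : ∀ n : ℕ, C.X →ₗ[K] ⨂[K]^n C.X
  | 0 => LinearMap.toSpanSingleton K _ (PiTensorProduct.tprod K Fin.elim0) ∘ₗ C.counit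
  | n + 1 => TensorPower.mulEquiv.toLinearMap ∘ₗ
      TensorProduct.map (iterComul C n)
        (PiTensorProduct.subsingletonEquiv (0 : Fin 1)).symm.toLinearMap ∘ₗ C.comul

/-- A dg atom: a nonzero element `a` with `Δ a = a ⊗ a` and `d a = 0`. -/
structure IsDGAtom (C : UCocom K) (a : C.X) : Prop where
  ne_zero : a ≠ 0
  comul_eq : C.comul a = a ⊗ₜ[K] a
  d_eq : C.X.d a = 0

end UCocom

/-! ### Operads -/

section Insertion

variable {m n l : ℕ}

/-- When the input `i` of an operation with `m` inputs is replaced by an operation with `n` inputs,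
the resulting operation has `l = m + n - 1` inputs. This is the new position of the input `b` of
the inserted operation. -/
def innerPos (h : l + 1 = m + n) (i : Fin m) (b : Fin n) : Fin l :=
  ⟨i + b, by omega⟩

/-- The new position of the input `a ≠ i` of the outer operation. -/
def outerPos (h : l + 1 = m + n) (i a : Fin m) (ha : a ≠ i) : Fin l :=
  ⟨if a < i then a else a + n - 1, by
    have := i.2; have := a.2
    have : (a : ℕ) ≠ i := fun h => ha (Fin.ext h)
    split_ifs with h1
    · have : (a : ℕ) < i := h1
      omega
    · have : ¬ (a : ℕ) < i := h1
      omega⟩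

end Insertion

/-- A dg operad over `K`: symmetric, with unit, and given by its partial compositions `μ ∘ᵢ ν`.
The symmetric groups act on the left (the right action of the usual convention is
`μ · σ = σ⁻¹ • μ`), so that the input `i` of `μ` is the input `σ i` of `σ • μ`. -/
structure DGOperad (K : Type u) [Field K] where
  /-- operations with `n` inputs -/
  obj : ℕ → DGMod K
  /-- action of the symmetric groups -/
  perm : ∀ n, Representation K (Equiv.Perm (Fin n)) (obj n)
  perm_mem : ∀ {n : ℕ} (σ : Equiv.Perm (Fin n)) {p : ℤ} {μ : obj n},
    μ ∈ (obj n).gr p → perm n σ μ ∈ (obj n).gr p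
  perm_d : ∀ {n : ℕ} (σ : Equiv.Perm (Fin n)) (μ : obj n),
    perm n σ ((obj n).d μ) = (obj n).d (perm n σ μ)
  one : obj 1
  one_mem : one ∈ (obj 1).gr 0
  one_d : (obj 1).d one = 0
  /-- partial composition `μ ∘ᵢ ν` -/
  circ : ∀ {m n l : ℕ}, l + 1 = m + n → Fin m → (obj m →ₗ[K] obj n →ₗ[K] obj l)
  circ_mem : ∀ {m n l : ℕ} (h : l + 1 = m + n) (i : Fin m) {p q : ℤ} {μ : obj m} {ν : obj n},
    μ ∈ (obj m).gr p → ν ∈ (obj n).gr q → circ h i μ ν ∈ (obj l).gr (p + q)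
  circ_d : ∀ {m n l : ℕ} (h : l + 1 = m + n) (i : Fin m) {p : ℤ} {μ : obj m} (ν : obj n),
    μ ∈ (obj m).gr p →
      (obj l).d (circ h i μ ν) =
        circ h i ((obj m).d μ) ν + ((-1 : K) ^ p) • circ h i μ ((obj n).d ν)
  one_circ : ∀ {n : ℕ} (h : n + 1 = 1 + n) (ν : obj n), circ h 0 one ν = ν
  circ_one : ∀ {m : ℕ} (h : m + 1 = m + 1) (i : Fin m) (μ : obj m), circ h i μ one = μ
  /-- `(μ₁ ∘ᵢ μ₂) ∘ μ₃ = μ₁ ∘ᵢ (μ₂ ∘ⱼ μ₃)` at the input `j` of `μ₂` -/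
  circ_sequential : ∀ {a b c x y l : ℕ} (h₁ : x + 1 = a + b) (h₂ : l + 1 = x + c)
    (h₃ : y + 1 = b + c) (h₄ : l + 1 = a + y) (i : Fin a) (j : Fin b)
    (μ₁ : obj a) (μ₂ : obj b) (μ₃ : obj c),
    circ h₂ (innerPos h₁ i j) (circ h₁ i μ₁ μ₂) μ₃ = circ h₄ i μ₁ (circ h₃ j μ₂ μ₃)
  /-- insertions at two different inputs `i`, `k` of `μ₁` commute, up to the Koszul sign -/
  circ_parallel : ∀ {a b c x y l : ℕ} (h₁ : x + 1 = a + b) (h₂ : l + 1 = x + c)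
    (h₃ : y + 1 = a + c) (h₄ : l + 1 = y + b) (i k : Fin a) (hik : i ≠ k) {p q : ℤ}
    (μ₁ : obj a) (μ₂ : obj b) (μ₃ : obj c), μ₂ ∈ (obj b).gr p → μ₃ ∈ (obj c).gr q →
    circ h₂ (outerPos h₁ i k hik.symm) (circ h₁ i μ₁ μ₂) μ₃ =
      ((-1 : K) ^ (p * q)) • circ h₄ (outerPos h₃ k i hik) (circ h₃ k μ₁ μ₃) μ₂
  /-- equivariance: `ρ` is the permutation of the inputs of `μ ∘ᵢ ν` induced by `σ` and `τ` -/
  circ_perm : ∀ {m n l : ℕ} (h : l + 1 = m + n) (i : Fin m) (μ : obj m) (ν : obj n)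
    (σ : Equiv.Perm (Fin m)) (τ : Equiv.Perm (Fin n)) (ρ : Equiv.Perm (Fin l)),
    (∀ b, ρ (innerPos h i b) = innerPos h (σ i) (τ b)) →
    (∀ (a : Fin m) (ha : a ≠ i),
      ρ (outerPos h i a ha) = outerPos h (σ i) (σ a) (fun e => ha (σ.injective e))) →
    circ h (σ i) (perm m σ μ) (perm n τ ν) = perm l ρ (circ h i μ ν)

/-! ### Algebras over an operad -/

/-- The Koszul sign of the rearrangement of `a₀ ⋯ aₙ₋₁` into `a_{σ 0} ⋯ a_{σ (n-1)}`, for `aᵢ`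
homogeneous of degree `e i`: the product of `(-1)^(|x||y|)` over the pairs that change their
order. -/
def koszulSign (K : Type u) [Field K] {n : ℕ} (σ : Equiv.Perm (Fin n)) (e : Fin n → ℤ) : K :=
  ∏ i : Fin n, ∏ j : Fin n, if i < j ∧ σ j < σ i then (-1 : K) ^ (e (σ i) * e (σ j)) else 1

/-- An algebra over the dg operad `P`: a chain complex `A` with operations
`P(n) ⊗ A^{⊗ n} → A`. -/
structure PAlg {K : Type u} [Field K] (P : DGOperad K) where
  /-- the underlying chain complex -/
  U : DGMod K
  act : ∀ {n : ℕ}, P.obj n →ₗ[K] MultilinearMap K (fun _ : Fin n => (U : Type u)) U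
  act_mem : ∀ {n : ℕ} {q : ℤ} {p : P.obj n} {e : Fin n → ℤ} {a : Fin n → U},
    p ∈ (P.obj n).gr q → (∀ i, a i ∈ U.gr (e i)) → act p a ∈ U.gr (q + ∑ i, e i)
  act_d : ∀ {n : ℕ} {q : ℤ} {p : P.obj n} {e : Fin n → ℤ} {a : Fin n → U},
    p ∈ (P.obj n).gr q → (∀ i, a i ∈ U.gr (e i)) →
      U.d (act p a) = act ((P.obj n).d p) a +
        ∑ i, ((-1 : K) ^ (q + ∑ j with j < i, e j)) • act p (Function.update a i (U.d (a i)))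
  act_one : ∀ a : Fin 1 → U, act P.one a = a 0
  act_perm : ∀ {n : ℕ} (σ : Equiv.Perm (Fin n)) (p : P.obj n) {e : Fin n → ℤ} {a : Fin n → U},
    (∀ i, a i ∈ U.gr (e i)) →
      act (P.perm n σ p) a = koszulSign K σ e • act p (fun i => a (σ i))
  /-- the operation `μ ∘ᵢ ν` acts by inserting the value of `ν` in the input `i` of `μ` -/
  act_circ : ∀ {m n l : ℕ} (h : l + 1 = m + n) (i : Fin m) (μ : P.obj m) {ν : P.obj n} {q : ℤ}
    {e : Fin l → ℤ} {a : Fin l → U}, ν ∈ (P.obj n).gr q → (∀ s, a s ∈ U.gr (e s)) →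
      act (P.circ h i μ ν) a =
        ((-1 : K) ^ (q * ∑ s with Fin.val s < Fin.val i, e s)) •
          act μ (fun j => if hj : j = i then act ν (fun b => a (innerPos h i b))
            else a (outerPos h i j hj))

namespace PAlg

variable {K : Type u} [Field K] {P : DGOperad K}

/-- Morphisms of `P`-algebras: morphisms of chain complexes commuting with the operations. -/
@[ext]
structure Hom (A B : PAlg P) where
  hom : A.U ⟶ B.U
  map_act : ∀ {n : ℕ} (p : P.obj n) (a : Fin n → A.U),
    DGMod.lin hom (A.act p a) = B.act p (fun i => DGMod.lin hom (a i))

instance : Category (PAlg P) where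
  Hom := Hom
  id A := ⟨𝟙 A.U, fun _ _ => rfl⟩
  comp f g := ⟨f.hom ≫ g.hom, fun p a => by simp [f.map_act, g.map_act]⟩

/-- The linear map underlying a morphism of `P`-algebras. -/
def lin {A B : PAlg P} (f : A ⟶ B) : A.U →ₗ[K] B.U := DGMod.lin (Hom.hom f)

/-- An ideal of a `P`-algebra: a subcomplex that contains the value of every operation one of whose
arguments lies in it. -/
structure IsIdeal (A : PAlg P) (I : Submodule K A.U) : Prop where
  homogeneous : ∀ (n : ℤ) (x : A.U), x ∈ I → A.U.proj n x ∈ I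
  d_mem : ∀ x : A.U, x ∈ I → A.U.d x ∈ I
  act_mem : ∀ {n : ℕ} (p : P.obj n) (a : Fin n → A.U) (i : Fin n), a i ∈ I → A.act p a ∈ I

/-- The ideal generated by a set. -/
def idealSpan (A : PAlg P) (R : Set A.U) : Submodule K A.U :=
  sInf {I | A.IsIdeal I ∧ R ⊆ I}

/-- `η : V ⟶ F` exhibits `F` as the free `P`-algebra on the chain complex `V`. -/
def IsFreeOn (F : PAlg P) {V : DGMod K} (η : V ⟶ F.U) : Prop :=
  ∀ (B : PAlg P) (g : V ⟶ B.U), ∃! f : F ⟶ B, η ≫ Hom.hom f = g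

/-- For `f i : C → A` homogeneous of degree `q i`, the composite
`γ_A(p ⊗ -) ∘ (f₀ ⊗ ⋯ ⊗ fₙ₋₁) ∘ Δⁿ⁻¹ : C → C^{⊗ n} → A^{⊗ n} → A`. By the Koszul rule,
`(f₀ ⊗ ⋯ ⊗ fₙ₋₁)(x₀ ⊗ ⋯ ⊗ xₙ₋₁)` is `f₀ x₀ ⊗ ⋯ ⊗ fₙ₋₁ xₙ₋₁` with the sign
`(-1)^(∑_{i<j} |xᵢ| q j)`. -/
noncomputable def convAct (C : UCocom K) (A : PAlg P) {n : ℕ} (p : P.obj n)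
    (f : Fin n → (C.X →ₗ[K] A.U)) (q : Fin n → ℤ) : C.X →ₗ[K] A.U :=
  PiTensorProduct.lift ((A.act p).compLinearMap
    (fun i => f i ∘ₗ C.X.koszul (∑ j with i < j, q j))) ∘ₗ C.iterComul n

/-- For a linear map `η : A ⊗ C → F` to a `P`-algebra, the elements
`η(γ_A(p; y₀, …, yₙ₋₁) ⊗ x) - ∑ ± γ_F(p; η(y₀ ⊗ x₍₀₎), …, η(yₙ₋₁ ⊗ x₍ₙ₋₁₎))`, where the sign is
`(-1)^(∑_{i<j} |x₍ᵢ₎||yⱼ|)`; for `n = 0` this is `η(γ_A(p) ⊗ x) - ε(x) γ_F(p)`. -/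
def tensorRelations (A : PAlg P) (C : UCocom K) (F : PAlg P) (η : A.U ⊗ C.X ⟶ F.U) : Set F.U :=
  {t | ∃ (n : ℕ) (p : P.obj n) (y : Fin n → A.U) (e : Fin n → ℤ) (x : C.X),
    (∀ i, y i ∈ A.U.gr (e i)) ∧
    t = DGMod.lin η (A.act p y ⊗ₜ[K] x) -
      convAct C F p (fun i => DGMod.lin η ∘ₗ TensorProduct.mk K A.U C.X (y i)) e x}

end PAlg

/-! ### Tensored, cotensored and enriched categories -/

/-- The structure of a category tensored, cotensored and enriched over a monoidal category `E`:
functors `{X, Y}`, `X ◁ A` and `⟨A, Y⟩` with natural bijections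
`Hom(X ◁ A, Y) ≃ Hom(A, {X, Y}) ≃ Hom(X, ⟨A, Y⟩)` such that `◁` is a right action of `E`.
The functor `⟨-, -⟩` is then a left coaction of `E`, that is a left action of `Eᵒᵖ`; its
structure isomorphisms, which correspond to those of `◁`, are made part of the data. -/
structure TensoredCotensoredEnriched (E C : Type*) [Category* E] [MonoidalCategory E]
    [Category* C] where
  /-- the bifunctor `{X, Y}` -/
  enr : Cᵒᵖ ⥤ C ⥤ E
  /-- the right action `X ◁ A` -/
  tensor : MonoidalRightAction E C
  /-- the left coaction `⟨A, Y⟩` -/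
  cotensor : MonoidalLeftAction Eᵒᵖ C
  tensorEquiv : ∀ (X : C) (A : E) (Y : C),
    (tensor.actionObj X A ⟶ Y) ≃ (A ⟶ (enr.obj (op X)).obj Y)
  cotensorEquiv : ∀ (X : C) (A : E) (Y : C),
    (A ⟶ (enr.obj (op X)).obj Y) ≃ (X ⟶ cotensor.actionObj (op A) Y)
  tensorEquiv_natural : ∀ {X X' : C} {A A' : E} {Y Y' : C} (f : X' ⟶ X) (g : A' ⟶ A) (h : Y ⟶ Y')
    (φ : tensor.actionObj X A ⟶ Y),
    tensorEquiv X' A' Y' (tensor.actionHom f g ≫ φ ≫ h) =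
      g ≫ tensorEquiv X A Y φ ≫ (enr.map f.op).app Y ≫ (enr.obj (op X')).map h
  cotensorEquiv_natural : ∀ {X X' : C} {A A' : E} {Y Y' : C} (f : X' ⟶ X) (g : A' ⟶ A)
    (h : Y ⟶ Y') (ψ : A ⟶ (enr.obj (op X)).obj Y),
    cotensorEquiv X' A' Y' (g ≫ ψ ≫ (enr.map f.op).app Y ≫ (enr.obj (op X')).map h) =
      f ≫ cotensorEquiv X A Y ψ ≫ cotensor.actionHom g.op h
  /-- `⟨A ⊗ B, Y⟩ ≅ ⟨A, ⟨B, Y⟩⟩` corresponds to `X ◁ (A ⊗ B) ≅ (X ◁ A) ◁ B` -/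
  assoc_compat : ∀ (X : C) (A B : E) (Y : C) (φ : tensor.actionObj X (A ⊗ B) ⟶ Y),
    cotensorEquiv X (A ⊗ B) Y (tensorEquiv X (A ⊗ B) Y φ) ≫
        (cotensor.actionAssocIso (op A) (op B) Y).hom =
      cotensorEquiv X A _ (tensorEquiv X A _
        (cotensorEquiv _ B Y (tensorEquiv _ B Y ((tensor.actionAssocIso X A B).inv ≫ φ))))
  /-- `⟨𝟙, Y⟩ ≅ Y` corresponds to `X ◁ 𝟙 ≅ X` -/
  unit_compat : ∀ (X Y : C) (φ : tensor.actionObj X (𝟙_ E) ⟶ Y),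
    cotensorEquiv X (𝟙_ E) Y (tensorEquiv X (𝟙_ E) Y φ) ≫ (cotensor.actionUnitIso Y).hom =
      (tensor.actionUnitIso X).inv ≫ φ

/-- The structure of an enrichment on a bifunctor `H : Cᵒᵖ × C → E`: associative and unital
compositions `H(X, Y) ⊗ H(Y, Z) ⟶ H(X, Z)` and units `𝟙 ⟶ H(X, X)`, functorial in all
variables. -/
structure Enrichment {E C : Type*} [Category* E] [MonoidalCategory E] [Category* C]
    (H : Cᵒᵖ ⥤ C ⥤ E) where
  comp : ∀ X Y Z : C,
    (H.obj (op X)).obj Y ⊗ (H.obj (op Y)).obj Z ⟶ (H.obj (op X)).obj Z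
  unit : ∀ X : C, 𝟙_ E ⟶ (H.obj (op X)).obj X
  assoc : ∀ W X Y Z : C,
    (comp W X Y ▷ (H.obj (op Y)).obj Z) ≫ comp W Y Z =
      (α_ _ _ _).hom ≫ ((H.obj (op W)).obj X ◁ comp X Y Z) ≫ comp W X Z
  unit_comp : ∀ X Y : C, (unit X ▷ (H.obj (op X)).obj Y) ≫ comp X X Y = (λ_ _).hom
  comp_unit : ∀ X Y : C, ((H.obj (op X)).obj Y ◁ unit Y) ≫ comp X Y Y = (ρ_ _).hom
  comp_natural_left : ∀ {X X' : C} (f : X' ⟶ X) (Y Z : C),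
    ((H.map f.op).app Y ▷ (H.obj (op Y)).obj Z) ≫ comp X' Y Z = comp X Y Z ≫ (H.map f.op).app Z
  comp_natural_right : ∀ (X Y : C) {Z Z' : C} (h : Z ⟶ Z'),
    ((H.obj (op X)).obj Y ◁ (H.obj (op Y)).map h) ≫ comp X Y Z' =
      comp X Y Z ≫ (H.obj (op X)).map h
  comp_natural_middle : ∀ (X : C) {Y Y' : C} (g : Y ⟶ Y') (Z : C),
    ((H.obj (op X)).map g ▷ (H.obj (op Y')).obj Z) ≫ comp X Y' Z =
      ((H.obj (op X)).obj Y ◁ (H.map g.op).app Z) ≫ comp X Y Z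
  unit_natural : ∀ {X Y : C} (f : X ⟶ Y),
    unit X ≫ (H.obj (op X)).map f = unit Y ≫ (H.map f.op).app Y

namespace TensoredCotensoredEnriched

section General

variable {E C : Type*} [Category* E] [MonoidalCategory E] [Category* C]
  (S : TensoredCotensoredEnriched E C)

/-- The evaluation `X ◁ {X, Y} ⟶ Y`. -/
def eval (X Y : C) : S.tensor.actionObj X ((S.enr.obj (op X)).obj Y) ⟶ Y :=
  (S.tensorEquiv X _ Y).symm (𝟙 _)

/-- The coevaluation `X ⟶ ⟨{X, Y}, Y⟩`. -/
def coeval (X Y : C) : X ⟶ S.cotensor.actionObj (op ((S.enr.obj (op X)).obj Y)) Y :=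
  S.cotensorEquiv X _ Y (𝟙 _)

/-- The unit `X ⟶ ⟨A, X ◁ A⟩` of the adjunction between `- ◁ A` and `⟨A, -⟩`. -/
def adjUnit (X : C) (A : E) : X ⟶ S.cotensor.actionObj (op A) (S.tensor.actionObj X A) :=
  S.cotensorEquiv X A _ (S.tensorEquiv X A _ (𝟙 _))

/-- The composition and the units of the enrichment `G` are those determined by the right action:
`X ◁ ({X, Y} ⊗ {Y, Z}) ≅ (X ◁ {X, Y}) ◁ {Y, Z} ⟶ Y ◁ {Y, Z} ⟶ Z` and `X ◁ 𝟙 ≅ X`. -/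
structure IsInduced (G : Enrichment S.enr) : Prop where
  comp_eq : ∀ X Y Z : C, (S.tensorEquiv X _ Z).symm (G.comp X Y Z) =
    (S.tensor.actionAssocIso X _ _).hom ≫
      S.tensor.actionHomLeft (S.eval X Y) ((S.enr.obj (op Y)).obj Z) ≫ S.eval Y Z
  unit_eq : ∀ X : C, (S.tensorEquiv X _ X).symm (G.unit X) = (S.tensor.actionUnitIso X).hom

end General

variable {K : Type u} [Field K] {P : DGOperad K}
  (S : TensoredCotensoredEnriched (UCocom K) (PAlg P))

/-- The elements of `⟨C, A⟩` as linear maps `C → A`, for an identification `ev` of the complex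
underlying `⟨C, A⟩` with `[C, A]`. -/
noncomputable def toLinearMap
    (ev : ∀ (C : UCocom K) (A : PAlg P),
      (S.cotensor.actionObj (op C) A).U ≅ DGMod.ihom C.X A.U)
    (C : UCocom K) (A : PAlg P) :
    (S.cotensor.actionObj (op C) A).U →ₗ[K] (C.X →ₗ[K] A.U) :=
  DGMod.ihomCoe C.X A.U ∘ₗ DGMod.lin (ev C A).hom

/-- The identifications `ev` of chain complexes make the left coaction `⟨C, A⟩` into the convolution
algebra `[C, A]`: they are natural, the operations are
`γ(p; f₀, …, fₙ₋₁) = γ_A(p ⊗ -) ∘ (f₀ ⊗ ⋯ ⊗ fₙ₋₁) ∘ Δⁿ⁻¹`, and the structure isomorphisms are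
`[C ⊗ D, A] ≅ [C, [D, A]]`, `f ↦ (x ↦ (y ↦ f (x ⊗ y)))`, and `[K, A] ≅ A`, `f ↦ f 1`. -/
structure IsConvolution
    (ev : ∀ (C : UCocom K) (A : PAlg P),
      (S.cotensor.actionObj (op C) A).U ≅ DGMod.ihom C.X A.U) : Prop where
  natural : ∀ {C C' : UCocom K} {A A' : PAlg P} (g : C' ⟶ C) (h : A ⟶ A')
    (f : (S.cotensor.actionObj (op C) A).U),
    S.toLinearMap ev C' A' (PAlg.lin (S.cotensor.actionHom g.op h) f) =
      PAlg.lin h ∘ₗ S.toLinearMap ev C A f ∘ₗ UCocom.lin g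
  act_eq : ∀ (C : UCocom K) (A : PAlg P) {n : ℕ} (p : P.obj n)
    (f : Fin n → (S.cotensor.actionObj (op C) A).U) (q : Fin n → ℤ),
    (∀ i, f i ∈ (S.cotensor.actionObj (op C) A).U.gr (q i)) →
    S.toLinearMap ev C A ((S.cotensor.actionObj (op C) A).act p f) =
      PAlg.convAct C A p (fun i => S.toLinearMap ev C A (f i)) q
  assoc_eq : ∀ (C D : UCocom K) (A : PAlg P) (f : (S.cotensor.actionObj (op (C ⊗ D)) A).U)
    (x : C.X) (y : D.X),
    S.toLinearMap ev D A
        (S.toLinearMap ev C _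
          (PAlg.lin (S.cotensor.actionAssocIso (op C) (op D) A).hom f) x) y =
      S.toLinearMap ev (C ⊗ D) A f (x ⊗ₜ[K] y)
  unit_eq : ∀ (A : PAlg P) (f : (S.cotensor.actionObj (op (𝟙_ (UCocom K))) A).U),
    PAlg.lin (S.cotensor.actionUnitIso A).hom f =
      S.toLinearMap ev (𝟙_ (UCocom K)) A f (1 : K)

/-- The `P`-algebra `A ◁ C` is the quotient of the free `P`-algebra `F` on `A ⊗ C` by the ideal
generated by the relations `γ_A(p; y₀, …) ⊗ x ∼ ∑ ± γ_F(p; y₀ ⊗ x₍₀₎, …)`, and the unit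
`A ⟶ [C, A ◁ C]` of the adjunction sends `y` to `x ↦ [y ⊗ x]`. -/
def IsTensorQuotient
    (ev : ∀ (C : UCocom K) (A : PAlg P),
      (S.cotensor.actionObj (op C) A).U ≅ DGMod.ihom C.X A.U)
    (A : PAlg P) (C : UCocom K) : Prop :=
  ∃ (F : PAlg P) (η : A.U ⊗ C.X ⟶ F.U) (π : F ⟶ S.tensor.actionObj A C),
    F.IsFreeOn η ∧ Function.Surjective (PAlg.lin π) ∧
    LinearMap.ker (PAlg.lin π) = F.idealSpan (A.tensorRelations C F η) ∧
    ∀ (y : A.U) (x : C.X),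
      S.toLinearMap ev C _ (PAlg.lin (S.adjUnit A C) y) x = PAlg.lin π (DGMod.lin η (y ⊗ₜ[K] x))

end TensoredCotensoredEnriched

/-!
The functors and the bijections are obtained from the convolution algebras alone. The operations of
`[C, A]` are evaluations of multilinear maps at iterated coproducts (`UCocom.pull`); the axioms of
an algebra over `P` hold because iterated coproducts can be inserted into each other
(`UCocom.pull_insert`), are invariant under permutations (`UCocom.pull_perm`) and commute with the
differential (`UCocom.pull_d`), once the Koszul signs are compared. By `UCocom.pull_tensor`, currying
is an isomorphism `[C ⊗ D, A] ≅ [C, [D, A]]` of algebras, and `[-, -]` is a left coaction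
(`PAlg.convAction`).

Given a left coaction `⟨A, Y⟩` of a monoidal category for which `Y ↦ Hom(X, ⟨A, Y⟩)` and
`A ↦ Hom(X, ⟨A, Y⟩)` are representable, by `X ◁ A` and `{X, Y}`, the Yoneda lemma transports the
coherence isomorphisms to a right action `◁` and yields the composition on `{-, -}`; this is the
purely categorical construction on `RepresentableCoaction`. Two representability statements remain.

* `Hom(A, [C, B])` is represented as a functor of `B` by the quotient `PAlg.tens A C` of the free
  algebra on `A ⊗ C` (`PAlg.tensCurryEquiv`): a chain map `A ⟶ [C, B]` is a chain map `A ⊗ C ⟶ B`,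
  and it commutes with the operations precisely when its extension to the free algebra kills the
  relations. The free algebra is the set of formal expressions modulo having the same value in all
  algebras.

* `Hom(A, [C, A'])` is represented as a functor of `C` by a coalgebra `PAlg.homObj A A'`. A morphism
  `φ : A ⟶ [C, A']` gives linear forms on `C`, namely `ε`, the maps `x ↦ l (φ y x)`, and all those
  obtained from them by convolution, by the differential and by the projections onto homogeneous
  components. They are indexed by formal expressions (`PAlg.DualTerm`) and hence assign to each
  element of `C` a family of scalars indexed by a fixed set. Their common kernel is a dg coideal
  (`PAlg.DualTerm.exists_separating_quot`), because forms that separate the points of `V` separate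
  those of `V ⊗ V`. Dividing it out of a direct sum that realises all the families of scalars that
  ever occur, one finds a coalgebra in which each of these families belongs to exactly one element.
  Every `(C, φ)` then maps to it in a unique way, and that map is a morphism of coalgebras since the
  expressions detect the whole structure (`PAlg.DualTerm.exists_hom_of_val`).

Finally, a dg atom has counit `1` and degree `0`, so that it is the same as a morphism from the unit
coalgebra, and `Hom(𝟙, {A, A'}) ≃ Hom(A, [𝟙, A']) ≃ Hom(A, A')`.
-/

/-! ### Left coactions with representability -/

/-- A left coaction `⟨A, Y⟩` of a monoidal category `E` on a category `C`, such that for all objects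
the functors `Y ↦ Hom(X, ⟨A, Y⟩)` and `A ↦ Hom(X, ⟨A, Y⟩)` are representable, by `tens X A` and
`hom X Y`. -/
structure RepresentableCoaction (E C : Type*) [Category* E] [MonoidalCategory E]
    [Category* C] [MonoidalLeftAction Eᵒᵖ C] where
  tens : C → E → C
  tensEquiv : ∀ {X : C} {A : E} {Y : C},
    (tens X A ⟶ Y) ≃ (X ⟶ MonoidalLeftActionStruct.actionObj (op A) Y)
  tensEquiv_comp : ∀ {X : C} {A : E} {Y Y' : C} (φ : tens X A ⟶ Y) (h : Y ⟶ Y'),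
    tensEquiv (φ ≫ h) = tensEquiv φ ≫ MonoidalLeftActionStruct.actionHomRight (op A) h
  hom : C → C → E
  homEquiv : ∀ {X : C} {A : E} {Y : C},
    (A ⟶ hom X Y) ≃ (X ⟶ MonoidalLeftActionStruct.actionObj (op A) Y)
  homEquiv_comp : ∀ {X : C} {A A' : E} {Y : C} (g : A' ⟶ A) (ψ : A ⟶ hom X Y),
    homEquiv (g ≫ ψ) = homEquiv ψ ≫ MonoidalLeftActionStruct.actionHomLeft g.op Y

namespace RepresentableCoaction

open scoped MonoidalLeftAction

section Action

variable {M C : Type*} [Category* M] [MonoidalCategory M] [Category* C] [MonoidalLeftAction M C]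

theorem associator_action_inv (a b c : M) (y : C) :
    a ⊴ₗ (αₗ b c y).inv ≫ (αₗ a (b ⊗ c) y).inv ≫ (α_ a b c).inv ⊵ₗ y =
      (αₗ a b (c ⊙ₗ y)).inv ≫ (αₗ (a ⊗ b) c y).inv := by
  rw [← cancel_epi ((αₗ (a ⊗ b : M) c y).hom ≫ (αₗ a b (c ⊙ₗ y)).hom)]
  conv_lhs => rw [← MonoidalLeftAction.associator_actionHom]
  simp only [Category.assoc, Iso.hom_inv_id_assoc, MonoidalLeftAction.actionHomRight_hom_inv_assoc,
    MonoidalLeftAction.hom_inv_actionHomLeft, Iso.hom_inv_id]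

theorem leftUnitor_action_inv (a : M) (y : C) :
    (λₗ[M] (a ⊙ₗ y)).inv ≫ (αₗ (𝟙_ M) a y).inv = (λ_ a).inv ⊵ₗ y := by
  rw [← cancel_mono ((λ_ a).hom ⊵ₗ y), MonoidalLeftAction.inv_hom_actionHomLeft]
  simp

theorem rightUnitor_action_inv (a : M) (y : C) :
    a ⊴ₗ (λₗ[M] y).inv ≫ (αₗ a (𝟙_ M) y).inv = (ρ_ a).inv ⊵ₗ y := by
  rw [← cancel_mono ((ρ_ a).hom ⊵ₗ y), MonoidalLeftAction.inv_hom_actionHomLeft]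
  simp

theorem assoc_inv_actionHomRight (a b : M) {y y' : C} (f : y ⟶ y') :
    (αₗ a b y).inv ≫ (a ⊗ b) ⊴ₗ f = a ⊴ₗ b ⊴ₗ f ≫ (αₗ a b y').inv := by
  simp

end Action

variable {E C : Type*} [Category* E] [MonoidalCategory E] [Category* C]
  [MonoidalLeftAction Eᵒᵖ C] (R : RepresentableCoaction E C)

/-- Morphisms out of `X ◁ A` are detected after passing to the coaction; the coherence laws of the
right action are all deduced in this way from those of the coaction. -/
theorem tens_hom_ext {X : C} {A : E} {Z : C} {f g : R.tens X A ⟶ Z}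
    (h : ∀ (Y : C) (φ : Z ⟶ Y), R.tensEquiv (f ≫ φ) = R.tensEquiv (g ≫ φ)) :
    f = g := by
  have := h Z (𝟙 Z)
  simpa using this

/-- The map `X' ◁ A' ⟶ X ◁ A` induced by `f : X' ⟶ X` and `g : A' ⟶ A`. -/
def tensMap {X X' : C} {A A' : E} (f : X' ⟶ X) (g : A' ⟶ A) : R.tens X' A' ⟶ R.tens X A :=
  R.tensEquiv.symm (f ≫ R.tensEquiv (𝟙 _) ≫ g.op ⊵ₗ R.tens X A)

theorem tensEquiv_tensMap {X X' : C} {A A' : E} {Y : C} (f : X' ⟶ X) (g : A' ⟶ A)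
    (φ : R.tens X A ⟶ Y) : R.tensEquiv (R.tensMap f g ≫ φ) =
      f ≫ R.tensEquiv φ ≫ g.op ⊵ₗ Y := by
  conv_rhs => rw [← Category.id_comp φ, R.tensEquiv_comp]
  rw [tensEquiv_comp, tensMap, Equiv.apply_symm_apply]
  simp [MonoidalLeftAction.action_exchange]

/-- The map `X ◁ (A ⊗ B) ⟶ (X ◁ A) ◁ B` that corresponds to `⟨A, ⟨B, Y⟩⟩ ⟶ ⟨A ⊗ B, Y⟩`. -/
def assocHom (X : C) (A B : E) : R.tens X (A ⊗ B) ⟶ R.tens (R.tens X A) B :=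
  R.tensEquiv.symm (R.tensEquiv (R.tensEquiv (𝟙 _)) ≫ (αₗ (op A) (op B) _).inv)

/-- The map `(X ◁ A) ◁ B ⟶ X ◁ (A ⊗ B)` that corresponds to `⟨A ⊗ B, Y⟩ ⟶ ⟨A, ⟨B, Y⟩⟩`. -/
def assocInv (X : C) (A B : E) : R.tens (R.tens X A) B ⟶ R.tens X (A ⊗ B) :=
  R.tensEquiv.symm (R.tensEquiv.symm (R.tensEquiv (𝟙 _) ≫ (αₗ (op A) (op B) _).hom))

theorem tensEquiv_assocHom {X Y : C} {A B : E} (φ : R.tens (R.tens X A) B ⟶ Y) :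
    R.tensEquiv (R.assocHom X A B ≫ φ) =
      R.tensEquiv (R.tensEquiv φ) ≫ (αₗ (op A) (op B) Y).inv := by
  conv_rhs => rw [← Category.id_comp φ, R.tensEquiv_comp, R.tensEquiv_comp]
  rw [tensEquiv_comp, assocHom, Equiv.apply_symm_apply]
  simp

theorem tensEquiv_assocInv {X Y : C} {A B : E} (ψ : R.tens X (A ⊗ B) ⟶ Y) :
    R.tensEquiv (R.tensEquiv (R.assocInv X A B ≫ ψ)) =
      R.tensEquiv ψ ≫ (αₗ (op A) (op B) Y).hom := by
  conv_rhs => rw [← Category.id_comp ψ, R.tensEquiv_comp]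
  rw [tensEquiv_comp, tensEquiv_comp, assocInv, Equiv.apply_symm_apply, Equiv.apply_symm_apply]
  simp

/-- The map `X ◁ 𝟙 ⟶ X` that corresponds to `Y ⟶ ⟨𝟙, Y⟩`. -/
def unitHom (X : C) : R.tens X (𝟙_ E) ⟶ X := R.tensEquiv.symm (λₗ[Eᵒᵖ] X).inv

/-- The map `X ⟶ X ◁ 𝟙` that corresponds to `⟨𝟙, Y⟩ ⟶ Y`. -/
def unitInv (X : C) : X ⟶ R.tens X (𝟙_ E) := R.tensEquiv (𝟙 _) ≫ (λₗ[Eᵒᵖ] _).hom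

theorem tensEquiv_unitHom {X Y : C} (φ : X ⟶ Y) :
    R.tensEquiv (R.unitHom X ≫ φ) = φ ≫ (λₗ[Eᵒᵖ] Y).inv := by
  rw [tensEquiv_comp, unitHom, Equiv.apply_symm_apply]
  exact MonoidalLeftAction.actionUnitIso_inv_naturality φ

theorem unitInv_comp {X Y : C} (ψ : R.tens X (𝟙_ E) ⟶ Y) :
    R.unitInv X ≫ ψ = R.tensEquiv ψ ≫ (λₗ[Eᵒᵖ] Y).hom := by
  conv_rhs => rw [← Category.id_comp ψ, R.tensEquiv_comp]
  rw [unitInv]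
  simp

/-! ### The adjoint right action -/

/-- The isomorphism `X ◁ (A ⊗ B) ≅ (X ◁ A) ◁ B` that corresponds to
`⟨A ⊗ B, Y⟩ ≅ ⟨A, ⟨B, Y⟩⟩`. -/
@[simps]
def assocIso (X : C) (A B : E) : R.tens X (A ⊗ B) ≅ R.tens (R.tens X A) B where
  hom := R.assocHom X A B
  inv := R.assocInv X A B
  hom_inv_id := R.tens_hom_ext fun Y φ => by
    simp only [Category.assoc, Category.id_comp, tensEquiv_assocHom, tensEquiv_assocInv,
      Iso.hom_inv_id, Category.comp_id]
  inv_hom_id := R.tens_hom_ext fun Y φ => R.tensEquiv.injective <| by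
    simp only [Category.assoc, Category.id_comp, tensEquiv_assocHom, tensEquiv_assocInv,
      Iso.inv_hom_id, Category.comp_id]

/-- The isomorphism `X ◁ 𝟙 ≅ X` that corresponds to `⟨𝟙, Y⟩ ≅ Y`. -/
@[simps hom]
def unitIso (X : C) : R.tens X (𝟙_ E) ≅ X where
  hom := R.unitHom X
  inv := R.unitInv X
  hom_inv_id := R.tens_hom_ext fun Y φ => by
    simp only [Category.assoc, Category.id_comp, tensEquiv_unitHom, unitInv_comp,
      Iso.hom_inv_id, Category.comp_id]
  inv_hom_id := by
    rw [unitInv_comp, unitHom, Equiv.apply_symm_apply]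
    simp

/-- The right action `X ◁ A` of `E` that is adjoint to the left coaction. -/
@[reducible]
def tensorAction : MonoidalRightAction E C where
  actionObj := R.tens
  actionHomRight X _ _ g := R.tensMap (𝟙 X) g
  actionHomLeft f A := R.tensMap f (𝟙 A)
  actionHom f g := R.tensMap f g
  actionAssocIso := R.assocIso
  actionUnitIso := R.unitIso
  actionHom_def f g := R.tens_hom_ext fun Y φ => by
    simp only [Category.assoc, tensEquiv_tensMap, Category.id_comp, op_id,
      MonoidalLeftAction.id_actionHomLeft, Category.comp_id]
  actionHomRight_id A X := R.tens_hom_ext fun Y φ => by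
    simp only [tensEquiv_tensMap, Category.id_comp, op_id,
      MonoidalLeftAction.id_actionHomLeft, Category.comp_id]
  id_actionHomLeft A X := R.tens_hom_ext fun Y φ => by
    simp only [tensEquiv_tensMap, Category.id_comp, op_id,
      MonoidalLeftAction.id_actionHomLeft, Category.comp_id]
  actionHom_comp f₁ f₂ g₁ g₂ := R.tens_hom_ext fun Y φ => by
    simp only [tensEquiv_tensMap, Category.assoc, op_comp,
      MonoidalLeftAction.comp_actionHomLeft]
  actionAssocIso_hom_naturality f g h := R.tens_hom_ext fun Y φ => by
    simp only [Category.assoc, tensEquiv_tensMap, assocIso_hom, tensEquiv_assocHom]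
    rw [tensEquiv_comp]
    have := MonoidalLeftAction.actionAssocIso_inv_naturality g.op h.op (𝟙 Y)
    simp only [MonoidalLeftAction.actionHom_id] at this
    rw [← op_tensor_op, ← this, MonoidalLeftAction.actionHom_def']
    simp only [Category.assoc]
  actionUnitIso_hom_naturality f := R.tens_hom_ext fun Y φ => by
    simp only [Category.assoc, tensEquiv_tensMap, unitIso_hom, tensEquiv_unitHom, op_id,
      MonoidalLeftAction.id_actionHomLeft, Category.comp_id]
  actionHomRight_whiskerRight f A X := R.tens_hom_ext fun Y φ => by
    simp only [Category.assoc, tensEquiv_tensMap, assocIso_hom, assocIso_inv, tensEquiv_assocHom,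
      op_id, MonoidalLeftAction.id_actionHomLeft, Category.comp_id,
      Category.id_comp, tensEquiv_assocInv]
    rw [op_whiskerRight, MonoidalLeftAction.whiskerRight_actionHomLeft]
  whiskerRight_actionHomLeft A _ _ f X := R.tens_hom_ext fun Y φ => by
    simp only [Category.assoc, tensEquiv_tensMap, assocIso_hom, assocIso_inv, tensEquiv_assocHom,
      Category.id_comp]
    rw [tensEquiv_comp, tensEquiv_assocInv, op_whiskerLeft,
      MonoidalLeftAction.whiskerLeft_actionHomLeft]
    simp only [Category.assoc]
  actionHom_associator A B D X := R.tens_hom_ext fun Y φ => by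
    simp only [Category.assoc, tensEquiv_tensMap, assocIso_hom, tensEquiv_assocHom, op_id,
      MonoidalLeftAction.id_actionHomLeft, Category.comp_id, Category.id_comp]
    rw [tensEquiv_comp]
    simp only [Category.assoc]
    exact congrArg _ (associator_action_inv (op A) (op B) (op D) Y)
  actionHom_leftUnitor A X := R.tens_hom_ext fun Y φ => by
    simp only [Category.assoc, tensEquiv_tensMap, assocIso_hom, tensEquiv_assocHom, op_id,
      MonoidalLeftAction.id_actionHomLeft, Category.comp_id,
      Category.id_comp, unitIso_hom, tensEquiv_unitHom]
    exact congrArg _ (leftUnitor_action_inv (op A) Y).symm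
  actionHom_rightUnitor A X := R.tens_hom_ext fun Y φ => by
    simp only [Category.assoc, tensEquiv_tensMap, assocIso_hom, tensEquiv_assocHom,
      Category.id_comp, unitIso_hom, tensEquiv_unitHom]
    rw [tensEquiv_comp, Category.assoc]
    exact congrArg _ (rightUnitor_action_inv (op A) Y).symm

/-! ### The bifunctor of maps -/

/-- The coevaluation `X ⟶ ⟨{X, Y}, Y⟩`. -/
def coeval (X Y : C) : X ⟶ op (R.hom X Y) ⊙ₗ Y := R.homEquiv (𝟙 _)

theorem homEquiv_eq {X : C} {A : E} {Y : C} (g : A ⟶ R.hom X Y) :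
    R.homEquiv g = R.coeval X Y ≫ g.op ⊵ₗ Y := by
  rw [coeval, ← homEquiv_comp, Category.comp_id]

/-- The map `{X, Y} ⟶ {X', Y'}` induced by `f : X' ⟶ X` and `h : Y ⟶ Y'`. -/
def homMap {X X' Y Y' : C} (f : X' ⟶ X) (h : Y ⟶ Y') : R.hom X Y ⟶ R.hom X' Y' :=
  R.homEquiv.symm (f ≫ R.coeval X Y ≫ op (R.hom X Y) ⊴ₗ h)

theorem homEquiv_homMap {X X' Y Y' : C} {A : E} (f : X' ⟶ X) (h : Y ⟶ Y')
    (g : A ⟶ R.hom X Y) : R.homEquiv (g ≫ R.homMap f h) = f ≫ R.homEquiv g ≫ op A ⊴ₗ h := by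
  rw [homEquiv_comp, homMap, Equiv.apply_symm_apply, R.homEquiv_eq g]
  simp only [Category.assoc, MonoidalLeftAction.action_exchange]

theorem homMap_id (X Y : C) : R.homMap (𝟙 X) (𝟙 Y) = 𝟙 _ := R.homEquiv.injective <| by
  rw [← Category.id_comp (R.homMap _ _), homEquiv_homMap]
  simp only [MonoidalLeftAction.actionHomRight_id, Category.comp_id, Category.id_comp]

theorem homMap_comp {X X' X'' Y Y' Y'' : C} (f : X' ⟶ X) (f' : X'' ⟶ X') (h : Y ⟶ Y')
    (h' : Y' ⟶ Y'') : R.homMap f h ≫ R.homMap f' h' = R.homMap (f' ≫ f) (h ≫ h') :=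
  R.homEquiv.injective <| by
    rw [homEquiv_homMap, ← Category.id_comp (R.homMap _ _), homEquiv_homMap,
      ← Category.id_comp (R.homMap _ _), homEquiv_homMap]
    simp only [MonoidalLeftAction.actionHomRight_comp, Category.assoc]

/-- The bifunctor `{X, Y}`. -/
def homFunctor : Cᵒᵖ ⥤ C ⥤ E where
  obj X :=
    { obj Y := R.hom X.unop Y
      map h := R.homMap (𝟙 X.unop) h
      map_id Y := R.homMap_id _ _
      map_comp h h' := by rw [homMap_comp, Category.comp_id] }
  map f :=
    { app Y := R.homMap f.unop (𝟙 Y)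
      naturality Y Y' h := by simp [homMap_comp] }
  map_id X := by
    ext Y
    exact R.homMap_id _ _
  map_comp f f' := by
    ext Y
    simp [homMap_comp]

/-- The tensored, cotensored and enriched structure determined by a coaction with
representability. -/
def toTensoredCotensoredEnriched : TensoredCotensoredEnriched E C where
  enr := R.homFunctor
  tensor := R.tensorAction
  cotensor := inferInstance
  tensorEquiv X A Y := R.tensEquiv.trans R.homEquiv.symm
  cotensorEquiv X A Y := R.homEquiv
  tensorEquiv_natural f g h φ := R.homEquiv.injective <| by
    change R.homEquiv (R.homEquiv.symm (R.tensEquiv (R.tensMap f g ≫ φ ≫ h))) =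
      R.homEquiv (g ≫ (R.homEquiv.symm (R.tensEquiv φ)) ≫ R.homMap f (𝟙 _) ≫ R.homMap (𝟙 _) h)
    rw [homMap_comp, Equiv.apply_symm_apply, tensEquiv_tensMap, tensEquiv_comp, homEquiv_comp,
      homEquiv_homMap, Equiv.apply_symm_apply]
    simp only [Category.id_comp, Category.assoc,
      MonoidalLeftAction.action_exchange]
  cotensorEquiv_natural {X X' A A' Y Y'} f g h ψ := by
    change A ⟶ R.hom X Y at ψ
    change R.homEquiv (g ≫ ψ ≫ R.homMap f (𝟙 _) ≫ R.homMap (𝟙 _) h) =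
      f ≫ R.homEquiv ψ ≫ (g.op ⊙ₗₘ h)
    rw [homMap_comp, homEquiv_comp, homEquiv_homMap, MonoidalLeftAction.actionHom_def']
    simp only [Category.id_comp, Category.assoc]
  assoc_compat X A B Y φ := by
    change R.homEquiv (R.homEquiv.symm (R.tensEquiv φ)) ≫ (αₗ (op A) (op B) Y).hom =
      R.homEquiv (R.homEquiv.symm (R.tensEquiv (R.homEquiv (R.homEquiv.symm
        (R.tensEquiv (R.assocInv X A B ≫ φ))))))
    simp only [Equiv.apply_symm_apply, tensEquiv_assocInv]
  unit_compat X Y φ := by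
    change R.homEquiv (R.homEquiv.symm (R.tensEquiv φ)) ≫ (λₗ Y).hom = R.unitInv X ≫ φ
    rw [Equiv.apply_symm_apply, unitInv_comp]

/-! ### The induced enrichment -/

/-- The composition `{X, Y} ⊗ {Y, Z} ⟶ {X, Z}`, which corresponds to
`X ⟶ ⟨{X, Y}, Y⟩ ⟶ ⟨{X, Y}, ⟨{Y, Z}, Z⟩⟩ ≅ ⟨{X, Y} ⊗ {Y, Z}, Z⟩`. -/
def homComp (X Y Z : C) : R.hom X Y ⊗ R.hom Y Z ⟶ R.hom X Z :=
  R.homEquiv.symm (R.coeval X Y ≫ op (R.hom X Y) ⊴ₗ R.coeval Y Z ≫ (αₗ (op _) (op _) Z).inv)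

/-- The composite of two generalized elements `a : A ⟶ {X, Y}` and `b : B ⟶ {Y, Z}`, in terms of the
morphisms `X ⟶ ⟨A, Y⟩` and `Y ⟶ ⟨B, Z⟩` that they represent. -/
theorem homEquiv_tensor_homComp {X Y Z : C} {A B : E} (a : A ⟶ R.hom X Y) (b : B ⟶ R.hom Y Z) :
    R.homEquiv ((a ⊗ₘ b) ≫ R.homComp X Y Z) =
      R.homEquiv a ≫ op A ⊴ₗ R.homEquiv b ≫ (αₗ (op A) (op B) Z).inv := by
  rw [homEquiv_comp, homComp, Equiv.apply_symm_apply, homEquiv_eq, homEquiv_eq]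
  have := MonoidalLeftAction.actionAssocIso_inv_naturality a.op b.op (𝟙 Z)
  simp only [MonoidalLeftAction.actionHom_id] at this
  rw [← op_tensor_op]
  simp only [Category.assoc]
  rw [← this, MonoidalLeftAction.actionHom_def']
  simp only [Category.assoc, MonoidalLeftAction.actionHomRight_comp]
  rw [MonoidalLeftAction.action_exchange_assoc, MonoidalLeftAction.action_exchange_assoc]

theorem homEquiv_homComp_left {X Y Z : C} {A : E} (a : A ⟶ R.hom X Y) :
    R.homEquiv ((a ▷ R.hom Y Z) ≫ R.homComp X Y Z) =
      R.homEquiv a ≫ op A ⊴ₗ R.coeval Y Z ≫ (αₗ (op A) (op (R.hom Y Z)) Z).inv := by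
  rw [← tensorHom_id, homEquiv_tensor_homComp, coeval]

theorem homEquiv_homComp_right {X Y Z : C} {B : E} (b : B ⟶ R.hom Y Z) :
    R.homEquiv ((R.hom X Y ◁ b) ≫ R.homComp X Y Z) =
      R.coeval X Y ≫ op (R.hom X Y) ⊴ₗ R.homEquiv b ≫ (αₗ (op (R.hom X Y)) (op B) Z).inv := by
  rw [← id_tensorHom, homEquiv_tensor_homComp, coeval]

/-- The unit `𝟙 ⟶ {X, X}`, which corresponds to `X ≅ ⟨𝟙, X⟩`. -/
def homUnit (X : C) : 𝟙_ E ⟶ R.hom X X := R.homEquiv.symm (λₗ[Eᵒᵖ] X).inv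

theorem coeval_homMap {X X' Y Y' : C} (f : X' ⟶ X) (h : Y ⟶ Y') :
    R.homEquiv (R.homMap f h) = f ≫ R.coeval X Y ≫ op (R.hom X Y) ⊴ₗ h := by
  rw [homMap, Equiv.apply_symm_apply]

theorem homEquiv_homComp (X Y Z : C) : R.homEquiv (R.homComp X Y Z) =
    R.coeval X Y ≫ op (R.hom X Y) ⊴ₗ R.coeval Y Z ≫ (αₗ (op _) (op _) Z).inv := by
  rw [homComp, Equiv.apply_symm_apply]

theorem homComp_assoc (W X Y Z : C) :
    (R.homComp W X Y ▷ R.hom Y Z) ≫ R.homComp W Y Z =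
      (α_ _ _ _).hom ≫ (R.hom W X ◁ R.homComp X Y Z) ≫ R.homComp W X Z :=
  R.homEquiv.injective <| by
    rw [homEquiv_homComp_left, homEquiv_comp, homEquiv_homComp_right, homEquiv_homComp,
      homEquiv_homComp]
    simp only [Category.assoc, MonoidalLeftAction.actionHomRight_comp]
    have h1 := associator_action_inv (op (R.hom W X)) (op (R.hom X Y)) (op (R.hom Y Z)) Z
    have h2 := assoc_inv_actionHomRight (op (R.hom W X)) (op (R.hom X Y)) (R.coeval Y Z)
    refine congrArg _ (congrArg _ ?_)
    refine (Category.assoc _ _ _).symm.trans ((congrArg (fun t => t ≫ _) h2).trans ?_)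
    exact (Category.assoc _ _ _).trans (congrArg _ h1.symm)

theorem homUnit_comp (X Y : C) :
    (R.homUnit X ▷ R.hom X Y) ≫ R.homComp X X Y = (λ_ _).hom :=
  R.homEquiv.injective <| by
    rw [homEquiv_homComp_left, homUnit, Equiv.apply_symm_apply, R.homEquiv_eq]
    have h1 := leftUnitor_action_inv (op (R.hom X Y)) Y
    have h2 := MonoidalLeftAction.actionUnitIso_inv_naturality (C := Eᵒᵖ) (R.coeval X Y)
    refine (Category.assoc _ _ _).symm.trans ((congrArg (· ≫ _) h2).trans ?_)
    exact (Category.assoc _ _ _).trans (congrArg _ h1)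

theorem homComp_unit (X Y : C) :
    (R.hom X Y ◁ R.homUnit Y) ≫ R.homComp X Y Y = (ρ_ _).hom :=
  R.homEquiv.injective <| by
    rw [homEquiv_homComp_right, homUnit, Equiv.apply_symm_apply, R.homEquiv_eq]
    exact congrArg _ (rightUnitor_action_inv (op _) Y)

theorem homComp_natural_left {X X' : C} (f : X' ⟶ X) (Y Z : C) :
    (R.homMap f (𝟙 Y) ▷ R.hom Y Z) ≫ R.homComp X' Y Z =
      R.homComp X Y Z ≫ R.homMap f (𝟙 Z) := R.homEquiv.injective <| by
  rw [homEquiv_homComp_left, homEquiv_homMap, coeval_homMap, homEquiv_homComp]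
  simp only [MonoidalLeftAction.actionHomRight_id, Category.comp_id, Category.assoc]

theorem homComp_natural_right (X Y : C) {Z Z' : C} (h : Z ⟶ Z') :
    (R.hom X Y ◁ R.homMap (𝟙 Y) h) ≫ R.homComp X Y Z' =
      R.homComp X Y Z ≫ R.homMap (𝟙 X) h := R.homEquiv.injective <| by
  rw [homEquiv_homComp_right, homEquiv_homMap, coeval_homMap, homEquiv_homComp]
  simp only [MonoidalLeftAction.actionHomRight_comp, Category.assoc, Category.id_comp]
  exact congrArg _ (congrArg _ (assoc_inv_actionHomRight _ _ h).symm)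

theorem homComp_natural_middle (X : C) {Y Y' : C} (g : Y ⟶ Y') (Z : C) :
    (R.homMap (𝟙 X) g ▷ R.hom Y' Z) ≫ R.homComp X Y' Z =
      (R.hom X Y ◁ R.homMap g (𝟙 Z)) ≫ R.homComp X Y Z := R.homEquiv.injective <| by
  rw [homEquiv_homComp_right, homEquiv_homComp_left, coeval_homMap, coeval_homMap]
  simp only [MonoidalLeftAction.actionHomRight_id, MonoidalLeftAction.actionHomRight_comp,
    Category.comp_id, Category.id_comp, Category.assoc]

theorem homUnit_natural {X Y : C} (f : X ⟶ Y) :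
    R.homUnit X ≫ R.homMap (𝟙 X) f = R.homUnit Y ≫ R.homMap f (𝟙 Y) :=
  R.homEquiv.injective <| by
    rw [homEquiv_homMap, homEquiv_homMap, homUnit, homUnit, Equiv.apply_symm_apply,
      Equiv.apply_symm_apply]
    simp only [MonoidalLeftAction.actionHomRight_id, Category.comp_id, Category.id_comp]
    exact MonoidalLeftAction.actionUnitIso_inv_naturality (C := Eᵒᵖ) f

/-- The enrichment induced by the right action. -/
def enrichment : Enrichment R.homFunctor where
  comp := R.homComp
  unit := R.homUnit
  assoc := R.homComp_assoc
  unit_comp := R.homUnit_comp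
  comp_unit := R.homComp_unit
  comp_natural_left := R.homComp_natural_left
  comp_natural_right := R.homComp_natural_right
  comp_natural_middle := R.homComp_natural_middle
  unit_natural := R.homUnit_natural

theorem tensEquiv_eval (X Y : C) : R.tensEquiv (R.tensEquiv.symm (R.homEquiv (𝟙 (R.hom X Y)))) =
    R.coeval X Y := Equiv.apply_symm_apply _ _

theorem isInduced : R.toTensoredCotensoredEnriched.IsInduced R.enrichment where
  comp_eq X Y Z := R.tensEquiv.injective <| by
    change R.tensEquiv (R.tensEquiv.symm (R.homEquiv (R.homComp X Y Z))) =
      R.tensEquiv (R.assocHom _ _ _ ≫ R.tensMap (R.tensEquiv.symm (R.homEquiv (𝟙 (R.hom X Y))))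
        (𝟙 (R.hom Y Z)) ≫ R.tensEquiv.symm (R.homEquiv (𝟙 (R.hom Y Z))))
    rw [Equiv.apply_symm_apply, tensEquiv_assocHom, tensEquiv_tensMap, tensEquiv_eval,
      tensEquiv_comp, tensEquiv_eval, homEquiv_homComp]
    simp only [op_id, MonoidalLeftAction.id_actionHomLeft, Category.comp_id, Category.assoc]
  unit_eq X := R.tensEquiv.injective <| by
    change R.tensEquiv (R.tensEquiv.symm (R.homEquiv (R.homUnit X))) =
      R.tensEquiv (R.unitHom X)
    rw [Equiv.apply_symm_apply, homUnit, unitHom, Equiv.apply_symm_apply, Equiv.apply_symm_apply]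

end RepresentableCoaction

section

variable {K : Type u} [Field K]

/-! ### Evaluating multilinear maps at iterated coproducts -/

namespace UCocom

variable {K : Type u} [Field K] (C : UCocom K)

theorem comul_mem {n : ℤ} {x : C.X} (h : x ∈ C.X.gr n) : C.comul x ∈ DGMod.tensorGr C.X C.X n :=
  DGMod.lin_mem (ComonObj.comul (X := C.X)) h

theorem comul_d (x : C.X) : C.comul (C.X.d x) = DGMod.tensorD C.X C.X (C.comul x) :=
  DGMod.lin_d (ComonObj.comul (X := C.X)) x

theorem counit_d (x : C.X) : C.counit (C.X.d x) = 0 :=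
  DGMod.lin_d (ComonObj.counit (X := C.X)) x

theorem counit_of_mem {n : ℤ} {x : C.X} (h : x ∈ C.X.gr n) (hn : n ≠ 0) : C.counit x = 0 :=
  (DGMod.unit_mem (DGMod.lin_mem (ComonObj.counit (X := C.X)) h)).resolve_left hn

theorem counit_tmul_comul (x : C.X) :
    TensorProduct.map C.counit LinearMap.id (C.comul x) = (1 : K) ⊗ₜ[K] x :=
  LinearMap.congr_fun (congrArg DGMod.lin (ComonObj.counit_comul C.X)) x

theorem tmul_counit_comul (x : C.X) :
    TensorProduct.map LinearMap.id C.counit (C.comul x) = x ⊗ₜ[K] (1 : K) :=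
  LinearMap.congr_fun (congrArg DGMod.lin (ComonObj.comul_counit C.X)) x

theorem comul_assoc (x : C.X) :
    TensorProduct.map LinearMap.id C.comul (C.comul x) =
      TensorProduct.assoc K C.X C.X C.X (TensorProduct.map C.comul LinearMap.id (C.comul x)) :=
  LinearMap.congr_fun (congrArg DGMod.lin (ComonObj.comul_assoc C.X)) x

theorem swap_comul (x : C.X) : DGMod.swap C.X C.X (C.comul x) = C.comul x :=
  LinearMap.congr_fun (congrArg DGMod.lin (IsCommComonObj.comul_comm C.X)) x

variable {C} in
theorem lin_comul {D : UCocom K} (f : C ⟶ D) (x : C.X) :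
    D.comul (lin f x) = TensorProduct.map (lin f) (lin f) (C.comul x) :=
  LinearMap.congr_fun (congrArg DGMod.lin (IsComonHom.hom_comul f.hom.hom)) x

variable {C} in
theorem lin_counit {D : UCocom K} (f : C ⟶ D) (x : C.X) : D.counit (lin f x) = C.counit x :=
  LinearMap.congr_fun (congrArg DGMod.lin (IsComonHom.hom_counit f.hom.hom)) x

variable {N N' : Type u} [AddCommGroup N] [Module K N] [AddCommGroup N'] [Module K N']

/-- The bilinear map `b` evaluated at the coproduct: `x ↦ ∑ b x₍₁₎ x₍₂₎`. -/
noncomputable def conv₂ : (C.X →ₗ[K] C.X →ₗ[K] N) →ₗ[K] (C.X →ₗ[K] N) :=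
  LinearMap.lcomp K N C.comul ∘ₗ (TensorProduct.lift.equiv (RingHom.id K) C.X C.X N).toLinearMap

theorem conv₂_apply (b : C.X →ₗ[K] C.X →ₗ[K] N) (x : C.X) :
    C.conv₂ b x = TensorProduct.lift b (C.comul x) := rfl

/-- The multilinear map `M` evaluated at the iterated coproduct: `x ↦ ∑ M(x₍₁₎, …, x₍ₙ₎)`, and
`x ↦ ε(x) M()` for `n = 0`. -/
noncomputable def pull : ∀ (n : ℕ) {N : Type u} [AddCommGroup N] [Module K N],
    MultilinearMap K (fun _ : Fin n => (C.X : Type u)) N →ₗ[K] (C.X →ₗ[K] N)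
  | 0, _, _, _ =>
    { toFun M := C.counit.smulRight (M Fin.elim0)
      map_add' M M' := by ext; simp
      map_smul' c M := by ext; exact smul_comm _ _ _ }
  | n + 1, N, _, _ => C.conv₂ ∘ₗ pull n ∘ₗ
      (multilinearCurryRightEquiv K (fun _ : Fin (n + 1) => (C.X : Type u)) N).toLinearMap

theorem pull_zero (M : MultilinearMap K (fun _ : Fin 0 => (C.X : Type u)) N) (x : C.X) :
    C.pull 0 M x = C.counit x • M Fin.elim0 := rfl

theorem pull_succ {n : ℕ} (M : MultilinearMap K (fun _ : Fin (n + 1) => (C.X : Type u)) N) :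
    C.pull (n + 1) M = C.conv₂ (C.pull n M.curryRight) := rfl

/-- `pull` is composition with the iterated coproduct `C → C^{⊗ n}`. Its recursive description
avoids tensor powers. -/
theorem lift_iterComul {n : ℕ} (M : MultilinearMap K (fun _ : Fin n => (C.X : Type u)) N) :
    PiTensorProduct.lift M ∘ₗ C.iterComul n = C.pull n M := by
  induction n generalizing N with
  | zero =>
    ext x
    simp [iterComul, pull_zero]
  | succ n ih =>
    ext x
    rw [pull_succ, ← ih, conv₂_apply]
    simp only [iterComul, LinearMap.comp_apply]
    induction C.comul x using TensorProduct.induction_on with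
    | zero => simp
    | add s t hs ht => simp only [map_add, hs, ht]
    | tmul v w =>
      simp only [TensorProduct.map_tmul, LinearEquiv.coe_coe, TensorProduct.lift.tmul,
        LinearMap.comp_apply]
      induction C.iterComul n v using PiTensorProduct.induction_on with
      | smul_tprod r u =>
        rw [← TensorProduct.smul_tmul', map_smul, map_smul, map_smul,
          LinearMap.smul_apply, PiTensorProduct.subsingletonEquiv_symm_apply']
        congr 1
        rw [PiTensorProduct.lift.tprod, MultilinearMap.curryRight_apply]
        refine (congrArg (PiTensorProduct.lift M)
          (TensorPower.tprod_mul_tprod K u (fun _ : Fin 1 => w))).trans ?_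
        rw [PiTensorProduct.lift.tprod, Fin.append_right_eq_snoc]
      | add s t hs ht => simp only [map_add, TensorProduct.add_tmul, hs, ht, LinearMap.add_apply]

theorem conv₂_comp (g : N →ₗ[K] N') (b : C.X →ₗ[K] C.X →ₗ[K] N) :
    C.conv₂ (b.compr₂ g) = g ∘ₗ C.conv₂ b := by
  ext x
  simp only [conv₂_apply, LinearMap.comp_apply, TensorProduct.lift_compr₂]

theorem pull_compMultilinearMap {n : ℕ} (g : N →ₗ[K] N')
    (M : MultilinearMap K (fun _ : Fin n => (C.X : Type u)) N) :
    C.pull n (g.compMultilinearMap M) = g ∘ₗ C.pull n M := by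
  induction n generalizing N N' with
  | zero => ext x; simp [pull_zero]
  | succ n ih =>
    rw [pull_succ, pull_succ, ← conv₂_comp]
    have : (g.compMultilinearMap M).curryRight =
      (LinearMap.llcomp K C.X N N' g).compMultilinearMap M.curryRight := rfl
    rw [this, ih]
    rfl

theorem pull_curry_apply {Y : Type u} [AddCommGroup Y] [Module K Y] {n : ℕ}
    (M : MultilinearMap K (fun _ : Fin n => (C.X : Type u)) (Y →ₗ[K] N)) (x : C.X) (y : Y) :
    C.pull n M x y = C.pull n ((LinearMap.applyₗ y).compMultilinearMap M) x := by
  rw [pull_compMultilinearMap]; rfl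

variable {C} in
theorem pull_lin {D : UCocom K} (f : C ⟶ D) {n : ℕ}
    (M : MultilinearMap K (fun _ : Fin n => (D.X : Type u)) N) (x : C.X) :
    D.pull n M (lin f x) = C.pull n (M.compLinearMap fun _ => lin f) x := by
  induction n generalizing N x with
  | zero =>
    rw [pull_zero, pull_zero, lin_counit]
    rw [MultilinearMap.compLinearMap_apply]
    congr 2
    funext i
    exact i.elim0
  | succ n ih =>
    rw [pull_succ, pull_succ, conv₂_apply, conv₂_apply, lin_comul]
    rw [← LinearMap.comp_apply]
    congr 1
    ext v w
    simp only [TensorProduct.AlgebraTensorModule.curry_apply, TensorProduct.curry_apply,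
      LinearMap.coe_restrictScalars, LinearMap.comp_apply, TensorProduct.map_tmul,
      TensorProduct.lift.tmul]
    rw [ih, pull_curry_apply, pull_curry_apply]
    congr 2
    ext u
    simp only [LinearMap.compMultilinearMap_apply, LinearMap.applyₗ_apply_apply,
      MultilinearMap.compLinearMap_apply, MultilinearMap.curryRight_apply]
    congr 1
    funext i
    refine Fin.lastCases ?_ (fun i => ?_) i <;> simp

/-- The value of `pull` is controlled by the values of `M` on homogeneous elements of total degree
`e`, since the coproduct preserves degrees. -/
theorem pull_mem {n : ℕ} (M : MultilinearMap K (fun _ : Fin n => (C.X : Type u)) N)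
    (S : Submodule K N) {e : ℤ} {x : C.X} (hx : x ∈ C.X.gr e)
    (h : ∀ (d : Fin n → ℤ) (v : Fin n → C.X), (∀ i, v i ∈ C.X.gr (d i)) → ∑ i, d i = e → M v ∈ S) :
    C.pull n M x ∈ S := by
  induction n generalizing N x e with
  | zero =>
    rw [pull_zero]
    by_cases he : e = 0
    · exact S.smul_mem _ (h Fin.elim0 _ (fun i => i.elim0) (by simp [he]))
    · rw [C.counit_of_mem hx he, zero_smul]; exact S.zero_mem
  | succ n ih =>
    rw [pull_succ, conv₂_apply]
    refine DGMod.tensor_mem S _ (fun p q v w hv hw hpq => ?_) (C.comul_mem hx)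
    refine ih M.curryRight (S.comap (LinearMap.applyₗ w)) hv fun d t ht hd => ?_
    refine h (Fin.snoc d q) (Fin.snoc t w) (fun i => ?_) ?_
    · refine Fin.lastCases ?_ (fun i => ?_) i <;> simp [hw, ht]
    · rw [Fin.sum_univ_castSucc]; simp [hd, hpq]

theorem pull_congr {n : ℕ} {M M' : MultilinearMap K (fun _ : Fin n => (C.X : Type u)) N}
    {e : ℤ} {x : C.X} (hx : x ∈ C.X.gr e)
    (h : ∀ (d : Fin n → ℤ) (v : Fin n → C.X), (∀ i, v i ∈ C.X.gr (d i)) → ∑ i, d i = e →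
      M v = M' v) : C.pull n M x = C.pull n M' x := by
  rw [← sub_eq_zero, ← LinearMap.sub_apply, ← map_sub, ← Submodule.mem_bot K]
  refine C.pull_mem _ _ hx fun d v hv hd => ?_
  simp [h d v hv hd]

end UCocom

theorem DGMod.multilinearMap_ext (V : DGMod K) {N : Type u} [AddCommGroup N] [Module K N] {n : ℕ}
    {M M' : MultilinearMap K (fun _ : Fin n => (V : Type u)) N}
    (h : ∀ (e : Fin n → ℤ) (v : Fin n → V), (∀ i, v i ∈ V.gr (e i)) → M v = M' v) : M = M' := by
  induction n generalizing N with
  | zero =>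
    ext v
    exact h Fin.elim0 v fun i => i.elim0
  | succ n ih =>
    have : M.curryRight = M'.curryRight := ih fun e v hv => V.linearMap_ext fun q w hw =>
      h (Fin.snoc e q) (Fin.snoc v w) fun i => by
        refine Fin.lastCases ?_ (fun i => ?_) i <;> simp [hw, hv]
    rw [← M.uncurry_curryRight, this, M'.uncurry_curryRight]

theorem prod_neg_one_zpow {ι : Type*} (s : Finset ι) (f : ι → ℤ) :
    ∏ i ∈ s, (-1 : K) ^ f i = (-1 : K) ^ ∑ i ∈ s, f i := by
  classical
  induction s using Finset.induction_on with
  | empty => simp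
  | insert a s ha ih =>
    rw [Finset.prod_insert ha, Finset.sum_insert ha, ih, zpow_add₀ (by simp)]

/-! ### The inputs of a partial composition -/

section Insertion

variable {m n l : ℕ}

theorem outerPos_injective (h : l + 1 = m + n) (i : Fin m) {a b : Fin m} (ha : a ≠ i) (hb : b ≠ i)
    (hab : outerPos h i a ha = outerPos h i b hb) : a = b := by
  have h1 : (a : ℕ) ≠ i := fun h => ha (Fin.ext h)
  have h2 : (b : ℕ) ≠ i := fun h => hb (Fin.ext h)
  simp only [outerPos, Fin.mk.injEq, Fin.lt_def] at hab
  ext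
  split_ifs at hab <;> omega

theorem outerPos_ne_innerPos (h : l + 1 = m + n) (i : Fin m) {a : Fin m} (ha : a ≠ i) (b : Fin n) :
    outerPos h i a ha ≠ innerPos h i b := by
  have h1 : (a : ℕ) ≠ i := fun h => ha (Fin.ext h)
  intro hab
  simp only [outerPos, innerPos, Fin.mk.injEq, Fin.lt_def] at hab
  split_ifs at hab <;> omega

/-- The inputs of `μ ∘ᵢ ν` are those of `μ` other than `i`, and those of `ν`. -/
noncomputable def insertEquiv (h : l + 1 = m + n) (i : Fin m) :
    {j : Fin m // j ≠ i} ⊕ Fin n ≃ Fin l :=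
  Equiv.ofBijective (Sum.elim (fun j => outerPos h i j.1 j.2) (innerPos h i)) <| by
    rw [Fintype.bijective_iff_injective_and_card]
    refine ⟨?_, ?_⟩
    · rintro (⟨a, ha⟩ | b) (⟨a', ha'⟩ | b') hab
      · exact congrArg Sum.inl (Subtype.ext (outerPos_injective h i ha ha' hab))
      · exact absurd hab (outerPos_ne_innerPos h i ha b')
      · exact absurd hab.symm (outerPos_ne_innerPos h i ha' b)
      · simp only [Sum.elim_inr, innerPos, Fin.mk.injEq, add_right_inj] at hab
        exact congrArg Sum.inr (Fin.ext hab)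
    · simp [Fintype.card_subtype_compl]
      have := i.2
      omega

@[simp] theorem insertEquiv_inl (h : l + 1 = m + n) (i : Fin m) (j : {j : Fin m // j ≠ i}) :
    insertEquiv h i (Sum.inl j) = outerPos h i j.1 j.2 := rfl

@[simp] theorem insertEquiv_inr (h : l + 1 = m + n) (i : Fin m) (b : Fin n) :
    insertEquiv h i (Sum.inr b) = innerPos h i b := rfl

@[simp] theorem insertEquiv_symm_outerPos (h : l + 1 = m + n) (i j : Fin m) (hj : j ≠ i) :
    (insertEquiv h i).symm (outerPos h i j hj) = Sum.inl ⟨j, hj⟩ :=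
  (insertEquiv h i).symm_apply_apply (Sum.inl ⟨j, hj⟩)

@[simp] theorem insertEquiv_symm_innerPos (h : l + 1 = m + n) (i : Fin m) (b : Fin n) :
    (insertEquiv h i).symm (innerPos h i b) = Sum.inr b :=
  (insertEquiv h i).symm_apply_apply (Sum.inr b)

/-- A multilinear map in the inputs of `μ ∘ᵢ ν`, as a function of the inputs of `ν`, the inputs
of `μ` other than `i` being fixed. -/
noncomputable def insertCurry {V N : Type u} [AddCommGroup V] [Module K V] [AddCommGroup N]
    [Module K N] (h : l + 1 = m + n) (i : Fin m) (L : MultilinearMap K (fun _ : Fin l => V) N)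
    (z : Fin m → V) : MultilinearMap K (fun _ : Fin n => V) N :=
  (MultilinearMap.currySum (L.domDomCongr (insertEquiv h i).symm)) fun j => z j.1

theorem insertCurry_apply {V N : Type u} [AddCommGroup V] [Module K V] [AddCommGroup N]
    [Module K N] (h : l + 1 = m + n) (i : Fin m) (L : MultilinearMap K (fun _ : Fin l => V) N)
    (z : Fin m → V) (w : Fin l → V) (hw : ∀ j hj, w (outerPos h i j hj) = z j) :
    insertCurry h i L z (fun b => w (innerPos h i b)) = L w := by
  rw [insertCurry, MultilinearMap.currySum_apply, MultilinearMap.domDomCongr_apply]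
  congr 1
  funext s
  obtain ⟨j | b, rfl⟩ := (insertEquiv h i).surjective s
  · simp [hw]
  · simp

theorem exists_insert {V : Type u} (h : l + 1 = m + n) (i : Fin m) (z : Fin m → V)
    (v : Fin n → V) : ∃ w : Fin l → V, (∀ j hj, w (outerPos h i j hj) = z j) ∧
      (fun b => w (innerPos h i b)) = v := by
  refine ⟨fun s => Sum.elim (fun j => z j.1) v ((insertEquiv h i).symm s), fun j hj => ?_, ?_⟩
  · simp
  · funext b
    simp

theorem sum_insert {A : Type*} [AddCommMonoid A] (h : l + 1 = m + n) (i : Fin m) (F : Fin l → A) :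
    ∑ s, F s = ∑ j : {j : Fin m // j ≠ i}, F (outerPos h i j.1 j.2) +
      ∑ b, F (innerPos h i b) := by
  rw [← (insertEquiv h i).sum_comp, Fintype.sum_sum_type]
  rfl

end Insertion

/-! ### Associativity, symmetry and the differential of iterated coproducts -/

namespace UCocom

variable (C : UCocom K)
variable {N N' : Type u} [AddCommGroup N] [Module K N] [AddCommGroup N'] [Module K N']

theorem conv₂_assoc (G : C.X →ₗ[K] C.X →ₗ[K] C.X →ₗ[K] N) :
    C.conv₂ (C.conv₂ G) = C.conv₂ (C.conv₂ ∘ₗ G) := by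
  ext x
  rw [conv₂_apply, conv₂_apply]
  have h1 : TensorProduct.lift (C.conv₂ G) =
      TensorProduct.lift (TensorProduct.lift G) ∘ₗ TensorProduct.map C.comul LinearMap.id := by
    ext; rfl
  have h2 : TensorProduct.lift (C.conv₂ ∘ₗ G) =
      TensorProduct.lift ((TensorProduct.lift.equiv (RingHom.id K) C.X C.X N).toLinearMap ∘ₗ G) ∘ₗ
        TensorProduct.map LinearMap.id C.comul := by
    ext; rfl
  have h3 : TensorProduct.lift (TensorProduct.lift G) =
      TensorProduct.lift ((TensorProduct.lift.equiv (RingHom.id K) C.X C.X N).toLinearMap ∘ₗ G) ∘ₗ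
        (TensorProduct.assoc K C.X C.X C.X).toLinearMap := by
    ext; rfl
  rw [h1, h2, h3, LinearMap.comp_apply, LinearMap.comp_apply, LinearMap.comp_apply, C.comul_assoc]
  rfl

theorem conv₂_comm {b b' : C.X →ₗ[K] C.X →ₗ[K] N}
    (h : ∀ p q v w, v ∈ C.X.gr p → w ∈ C.X.gr q → b v w = ((-1 : K) ^ (p * q)) • b' w v) :
    C.conv₂ b = C.conv₂ b' := by
  have : TensorProduct.lift b = TensorProduct.lift b' ∘ₗ DGMod.swap C.X C.X := by
    refine DGMod.tensor_ext fun p q v w hv hw => ?_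
    rw [LinearMap.comp_apply, DGMod.swap_tmul hv hw, map_smul, TensorProduct.lift.tmul,
      TensorProduct.lift.tmul, h p q v w hv hw]
  ext x
  rw [conv₂_apply, conv₂_apply, this, LinearMap.comp_apply, C.swap_comul]

theorem conv₂_counit_right {b : C.X →ₗ[K] C.X →ₗ[K] N} {g : C.X →ₗ[K] N}
    (h : ∀ v w, b v w = C.counit w • g v) : C.conv₂ b = g := by
  have : TensorProduct.lift b = g ∘ₗ (TensorProduct.rid K C.X).toLinearMap ∘ₗ
      TensorProduct.map LinearMap.id C.counit := by
    ext v w; simp [h]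
  ext x
  rw [conv₂_apply, this, LinearMap.comp_apply, LinearMap.comp_apply, C.tmul_counit_comul]
  simp

theorem conv₂_d {b b' : C.X →ₗ[K] C.X →ₗ[K] N}
    (h : ∀ p q v w, v ∈ C.X.gr p → w ∈ C.X.gr q →
      b' v w = b (C.X.d v) w + ((-1 : K) ^ p) • b v (C.X.d w)) (x : C.X) :
    C.conv₂ b' x = C.conv₂ b (C.X.d x) := by
  have : TensorProduct.lift b' = TensorProduct.lift b ∘ₗ DGMod.tensorD C.X C.X := by
    refine DGMod.tensor_ext fun p q v w hv hw => ?_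
    rw [LinearMap.comp_apply, DGMod.tensorD_tmul _ _ _ hv, map_add, map_smul,
      TensorProduct.lift.tmul, TensorProduct.lift.tmul, TensorProduct.lift.tmul, h p q v w hv hw]
  rw [conv₂_apply, conv₂_apply, this, LinearMap.comp_apply, C.comul_d]

/-- A multilinear map in `a + b` variables, as a function of the last `b` variables, the first `a`
variables being fixed. -/
noncomputable def curryAppend {V : Type u} [AddCommGroup V] [Module K V] {a b : ℕ}
    (M : MultilinearMap K (fun _ : Fin (a + b) => V) N) :
    MultilinearMap K (fun _ : Fin a => V) (MultilinearMap K (fun _ : Fin b => V) N) :=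
  MultilinearMap.currySum (M.domDomCongr finSumFinEquiv.symm)

theorem curryAppend_apply {V : Type u} [AddCommGroup V] [Module K V] {a b : ℕ}
    (M : MultilinearMap K (fun _ : Fin (a + b) => V) N) (u : Fin a → V) (v : Fin b → V) :
    curryAppend M u v = M (Fin.append u v) := by
  rw [curryAppend, MultilinearMap.currySum_apply, MultilinearMap.domDomCongr_apply]
  congr 1
  funext s
  refine Fin.addCases (fun i => ?_) (fun i => ?_) s <;> simp

/-- The iterated coproduct into `C^{⊗ (a + b)}` is the coproduct followed by the iterated coproducts
into `C^{⊗ a}` and `C^{⊗ b}`. -/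
theorem pull_add {a b : ℕ} (M : MultilinearMap K (fun _ : Fin (a + b) => (C.X : Type u)) N) :
    C.pull (a + b) M =
      C.conv₂ (C.pull a ((C.pull b).compMultilinearMap (curryAppend M))) := by
  induction b generalizing N with
  | zero =>
    refine (C.conv₂_counit_right fun v w => ?_).symm
    rw [pull_curry_apply, ← LinearMap.smul_apply, ← map_smul]
    congr 2
    ext u
    simp only [LinearMap.compMultilinearMap_apply, LinearMap.applyₗ_apply_apply, pull_zero,
      curryAppend_apply, _root_.smul_apply]
    congr 2
    exact Fin.append_elim0 u
  | succ b ih =>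
    have h1 : (C.pull (b + 1)).compMultilinearMap (curryAppend M) =
        C.conv₂.compMultilinearMap ((C.pull b).compMultilinearMap
          (curryAppend (a := a) (b := b) M.curryRight)) := by
      ext u
      simp only [LinearMap.compMultilinearMap_apply, pull_succ]
      congr 3
      ext v w
      rw [MultilinearMap.curryRight_apply, curryAppend_apply, curryAppend_apply,
        MultilinearMap.curryRight_apply, Fin.append_snoc]
    rw [h1, pull_compMultilinearMap, ← conv₂_assoc, ← ih, ← pull_succ]
    rfl

/-- Insertion of the iterated coproduct of arity `n` in the input `i` of that of arity `m` is the
iterated coproduct of arity `m + n - 1`. By induction on the number of inputs after `i`, this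
reduces to `pull_add`. -/
theorem pull_insert {m n l : ℕ} (h : l + 1 = m + n) (i : Fin m)
    (L : MultilinearMap K (fun _ : Fin l => (C.X : Type u)) N)
    (T : MultilinearMap K (fun _ : Fin m => (C.X : Type u)) N)
    (H : ∀ (e : Fin m → ℤ) (z : Fin m → C.X), (∀ j, z j ∈ C.X.gr (e j)) →
      T z = C.pull n (insertCurry h i L z) (z i)) : C.pull l L = C.pull m T := by
  induction m generalizing l N with
  | zero => exact i.elim0
  | succ m ih =>
    refine Fin.lastCases (motive := fun i => (∀ (e : Fin (m + 1) → ℤ) (z : Fin (m + 1) → C.X),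
      (∀ j, z j ∈ C.X.gr (e j)) → T z = C.pull n (insertCurry h i L z) (z i)) → _) ?_ ?_ i H
    · intro H
      obtain rfl : l = m + n := by omega
      rw [pull_add, pull_succ]
      congr 2
      refine (DGMod.multilinearMap_ext _ fun e z hz => DGMod.linearMap_ext _ fun q y hy => ?_).symm
      rw [MultilinearMap.curryRight_apply, H (Fin.snoc e q) (Fin.snoc z y) (fun j => by
        refine Fin.lastCases ?_ (fun j => ?_) j <;> simp [hy, hz])]
      rw [LinearMap.compMultilinearMap_apply, Fin.snoc_last]
      congr 2
      ext v
      rw [curryAppend_apply, ← insertCurry_apply h (Fin.last m) L (Fin.snoc z y) (Fin.append z v)]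
      · congr 1
        funext b
        exact (Fin.append_right z v b).symm
      · intro j
        refine Fin.lastCases (fun hj => absurd rfl hj) (fun j hj => ?_) j
        rw [Fin.snoc_castSucc]
        convert Fin.append_left z v j
        ext
        simp [outerPos, Fin.lt_def]
    · intro i H
      obtain ⟨l, rfl⟩ : ∃ l', l = l' + 1 := ⟨l - 1, by have := i.2; omega⟩
      have h' : l + 1 = m + n := by omega
      rw [pull_succ, pull_succ]
      congr 1
      refine ih h' i _ _ fun e z hz => DGMod.linearMap_ext _ fun q y hy => ?_
      rw [MultilinearMap.curryRight_apply, H (Fin.snoc e q) (Fin.snoc z y) (fun j => by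
        refine Fin.lastCases ?_ (fun j => ?_) j <;> simp [hy, hz]), pull_curry_apply,
        Fin.snoc_castSucc]
      congr 2
      ext v
      obtain ⟨w, hw, rfl⟩ := exists_insert h' i z v
      rw [LinearMap.compMultilinearMap_apply, insertCurry_apply h' i _ z w hw,
        LinearMap.applyₗ_apply_apply, MultilinearMap.curryRight_apply,
        ← insertCurry_apply h i.castSucc L (Fin.snoc z y) (Fin.snoc w y)]
      · congr 1
        funext b
        exact (Fin.snoc_castSucc (α := fun _ => (C.X : Type u)) y w (innerPos h' i b)).symm
      · intro j
        refine Fin.lastCases (fun hj => ?_) (fun j hj => ?_) j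
        · rw [Fin.snoc_last]
          convert Fin.snoc_last (α := fun _ => (C.X : Type u)) y w
          ext
          have := i.2
          simp only [outerPos, Fin.lt_def, Fin.val_last, Fin.val_castSucc]
          rw [if_neg (by omega)]
          omega
        · have hj' : j ≠ i := fun hji => hj (by rw [hji])
          rw [Fin.snoc_castSucc, ← hw j hj']
          exact Fin.snoc_castSucc (α := fun _ => (C.X : Type u)) y w (outerPos h' i j hj')

/-- The iterated coproduct is invariant, up to the Koszul sign, under the exchange of two adjacent
factors: by coassociativity this comes down to cocommutativity. -/
theorem pull_swap {n : ℕ} (i : Fin n)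
    {M M' : MultilinearMap K (fun _ : Fin (n + 1) => (C.X : Type u)) N}
    (h : ∀ (e : Fin (n + 1) → ℤ) (v : Fin (n + 1) → C.X), (∀ j, v j ∈ C.X.gr (e j)) →
      M' v = ((-1 : K) ^ (e i.castSucc * e i.succ)) •
        M fun j => v (Equiv.swap i.castSucc i.succ j)) :
    C.pull (n + 1) M' = C.pull (n + 1) M := by
  induction n generalizing N with
  | zero => exact i.elim0
  | succ n ih =>
    revert h
    refine Fin.lastCases ?_ (fun i => ?_) i <;> intro h
    · rw [pull_succ, pull_succ, pull_succ, pull_succ, conv₂_assoc, conv₂_assoc]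
      congr 1
      refine LinearMap.ext fun v => C.conv₂_comm fun p q x y hx hy => ?_
      rw [pull_curry_apply, pull_curry_apply, pull_curry_apply, pull_curry_apply,
        ← LinearMap.smul_apply, ← map_smul]
      congr 2
      refine DGMod.multilinearMap_ext _ fun e u hu => ?_
      have := h (Fin.snoc (Fin.snoc e p) q) (Fin.snoc (Fin.snoc u x) y) (fun j => by
        refine Fin.lastCases ?_ (fun j => ?_) j
        · simpa using hy
        · refine Fin.lastCases ?_ (fun j => ?_) j
          · simpa using hx
          · simpa using hu j)
      simp only [LinearMap.compMultilinearMap_apply, LinearMap.applyₗ_apply_apply,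
        MultilinearMap.curryRight_apply, _root_.smul_apply]
      rw [this]
      congr 1
      · simp [Fin.snoc, Fin.last]
      · congr 1
        funext j
        refine Fin.lastCases ?_ (fun j => ?_) j
        · rw [← Fin.succ_last, Equiv.swap_apply_right]
          simp
        · refine Fin.lastCases ?_ (fun j => ?_) j
          · rw [Equiv.swap_apply_left, Fin.succ_last]; simp
          · rw [Equiv.swap_apply_of_ne_of_ne]
            · simp
            · exact fun hj => absurd (Fin.castSucc_injective _ hj) (Fin.castSucc_lt_last j).ne
            · rw [Fin.succ_last]; exact (Fin.castSucc_lt_last _).ne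
    · rw [pull_succ, pull_succ]
      refine congrArg C.conv₂ ?_
      refine ih (M := M.curryRight) (M' := M'.curryRight) i fun e u hu =>
        DGMod.linearMap_ext _ fun q y hy => ?_
      rw [LinearMap.smul_apply, MultilinearMap.curryRight_apply, MultilinearMap.curryRight_apply,
        h (Fin.snoc e q) (Fin.snoc u y) (fun j => by
          refine Fin.lastCases ?_ (fun j => ?_) j <;> simp [hy, hu])]
      congr 1
      · rw [Fin.snoc_castSucc, Fin.succ_castSucc, Fin.snoc_castSucc]
      · congr 1
        funext j
        refine Fin.lastCases ?_ (fun j => ?_) j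
        · rw [Equiv.swap_apply_of_ne_of_ne]
          · simp
          · exact (Fin.castSucc_lt_last _).ne'
          · rw [Fin.succ_castSucc]; exact (Fin.castSucc_lt_last _).ne'
        · rw [Fin.succ_castSucc, Fin.snoc_castSucc, (Fin.castSucc_injective _).swap_apply
            i.castSucc i.succ j, Fin.snoc_castSucc]

/-- The differential of `C^{⊗ n}`, on multilinear maps. -/
noncomputable def dMulti {n : ℕ} (M : MultilinearMap K (fun _ : Fin n => (C.X : Type u)) N) :
    MultilinearMap K (fun _ : Fin n => (C.X : Type u)) N :=
  ∑ i, M.compLinearMap fun j => if j < i then C.X.koszul 1 else if j = i then C.X.d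
    else LinearMap.id

theorem dMulti_apply {n : ℕ} (M : MultilinearMap K (fun _ : Fin n => (C.X : Type u)) N)
    {e : Fin n → ℤ} {v : Fin n → C.X} (hv : ∀ i, v i ∈ C.X.gr (e i)) :
    C.dMulti M v = ∑ i, ((-1 : K) ^ (∑ j with j < i, e j)) •
      M (Function.update v i (C.X.d (v i))) := by
  rw [dMulti, _root_.sum_apply]
  refine Finset.sum_congr rfl fun i _ => ?_
  have h1 : ∀ j, (if j < i then C.X.koszul 1 else if j = i then C.X.d
      else LinearMap.id : C.X →ₗ[K] C.X) (v j) =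
      (if j < i then (-1 : K) ^ (e j) else 1) • Function.update v i (C.X.d (v i)) j := by
    intro j
    split_ifs with h1 h2
    · rw [C.X.koszul_of_mem 1 (hv j), Function.update_of_ne h1.ne, one_mul]
    · subst h2; simp
    · rw [Function.update_of_ne h2]; simp
  rw [MultilinearMap.compLinearMap_apply, funext h1, MultilinearMap.map_smul_univ,
    Finset.prod_ite, Finset.prod_const_one, mul_one, prod_neg_one_zpow]

/-- The iterated coproduct commutes with the differentials. -/
theorem pull_d {n : ℕ} (M : MultilinearMap K (fun _ : Fin n => (C.X : Type u)) N) (x : C.X) :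
    C.pull n (C.dMulti M) x = C.pull n M (C.X.d x) := by
  induction n generalizing N x with
  | zero => simp [pull_zero, counit_d, dMulti]
  | succ n ih =>
    rw [pull_succ, pull_succ]
    refine C.conv₂_d (fun p q v w hv hw => ?_) x
    rw [← ih, pull_curry_apply, pull_curry_apply, pull_curry_apply, ← LinearMap.smul_apply,
      ← map_smul, ← LinearMap.add_apply, ← map_add]
    refine C.pull_congr hv fun e u hu he => ?_
    rw [_root_.add_apply, _root_.smul_apply]
    simp only [LinearMap.compMultilinearMap_apply, LinearMap.applyₗ_apply_apply,
      MultilinearMap.curryRight_apply]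
    rw [C.dMulti_apply _ hu, C.dMulti_apply (e := Fin.snoc e q) _ (fun j => by
      refine Fin.lastCases ?_ (fun j => ?_) j <;> simp [hw, hu]), Fin.sum_univ_castSucc,
      LinearMap.sum_apply]
    congr 1
    · refine Finset.sum_congr rfl fun i _ => ?_
      rw [LinearMap.smul_apply, MultilinearMap.curryRight_apply, Fin.snoc_castSucc,
        Fin.snoc_update]
      congr 2
      rw [Finset.sum_filter, Finset.sum_filter, Fin.sum_univ_castSucc]
      simp [(Fin.castSucc_lt_last i).not_gt]
    · rw [Fin.snoc_last, Fin.update_snoc_last]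
      congr 2
      rw [Finset.sum_filter, Fin.sum_univ_castSucc, ← he]
      simp [Fin.castSucc_lt_last]

theorem pull_grouplike {g : C.X} (h0 : C.counit g = 1) (h2 : C.comul g = g ⊗ₜ[K] g) {n : ℕ}
    (M : MultilinearMap K (fun _ : Fin n => (C.X : Type u)) N) :
    C.pull n M g = M fun _ => g := by
  induction n generalizing N with
  | zero =>
    rw [pull_zero, h0, one_smul]
    congr 1
    funext i
    exact i.elim0
  | succ n ih =>
    rw [pull_succ, conv₂_apply, h2, TensorProduct.lift.tmul, ih, MultilinearMap.curryRight_apply]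
    congr 1
    funext j
    refine Fin.lastCases ?_ (fun j => ?_) j <;> simp

/-! ### Iterated coproducts of a tensor product -/

variable {C} in
theorem comul_tmul {D : UCocom K} (x : C.X) (y : D.X) : (C ⊗ D).comul (x ⊗ₜ[K] y) =
    DGMod.lin (MonoidalCategory.tensorμ C.X C.X D.X D.X) (C.comul x ⊗ₜ[K] D.comul y) := by
  have := Comon.tensorObj_comul C.X D.X
  exact LinearMap.congr_fun (congrArg DGMod.lin this) (x ⊗ₜ y)

theorem lin_tensorμ {V V' W W' : DGMod K} {q r : ℤ} {v : V} {v' : V'} {w : W} {w' : W'}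
    (hv' : v' ∈ V'.gr q) (hw : w ∈ W.gr r) :
    DGMod.lin (MonoidalCategory.tensorμ V V' W W') ((v ⊗ₜ[K] v') ⊗ₜ[K] (w ⊗ₜ[K] w')) =
      ((-1 : K) ^ (q * r)) • ((v ⊗ₜ[K] w) ⊗ₜ[K] (v' ⊗ₜ[K] w')) := by
  have : DGMod.lin (MonoidalCategory.tensorμ V V' W W') ((v ⊗ₜ[K] v') ⊗ₜ[K] (w ⊗ₜ[K] w')) =
    (TensorProduct.assoc K V W (V' ⊗[K] W')).symm (v ⊗ₜ[K]
      (TensorProduct.assoc K W V' W' ((DGMod.swap V' W (v' ⊗ₜ[K] w)) ⊗ₜ[K] w'))) := rfl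
  rw [this, DGMod.swap_tmul hv' hw]
  simp [← TensorProduct.smul_tmul']

variable {C} in
/-- The inductive step of `pull_tensor`: the coproduct of `C ⊗ D` is that of `C` followed by that of
`D`, up to the sign for moving `x₍₂₎` past `y₍₁₎`. -/
theorem conv₂_tensor {D : UCocom K} (β : (C ⊗ D).X →ₗ[K] (C ⊗ D).X →ₗ[K] N)
    (G : C.X →ₗ[K] C.X →ₗ[K] D.X →ₗ[K] N)
    (hG : ∀ p q x x', x ∈ C.X.gr p → x' ∈ C.X.gr q → ∃ b : D.X →ₗ[K] D.X →ₗ[K] N,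
      G x x' = D.conv₂ b ∧ ∀ r s y y', y ∈ D.X.gr r → y' ∈ D.X.gr s →
        b y y' = ((-1 : K) ^ (q * r)) • β (x ⊗ₜ[K] y) (x' ⊗ₜ[K] y'))
    (x : C.X) (y : D.X) : (C ⊗ D).conv₂ β (x ⊗ₜ[K] y) = C.conv₂ G x y := by
  rw [conv₂_apply, conv₂_apply, comul_tmul]
  refine DGMod.tensor_induction (V := C.X) (W := C.X) (p := fun t => TensorProduct.lift β
    (DGMod.lin (MonoidalCategory.tensorμ C.X C.X D.X D.X) (t ⊗ₜ[K] D.comul y)) =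
      TensorProduct.lift G t y) (C.comul x) ?_ (fun s t hs ht => ?_) fun p q x x' hx hx' => ?_
  · simp
  · rw [TensorProduct.add_tmul, map_add, map_add, hs, ht, map_add]; rfl
  · obtain ⟨b, hb, hb'⟩ := hG p q x x' hx hx'
    rw [TensorProduct.lift.tmul, hb, conv₂_apply]
    refine DGMod.tensor_induction (V := D.X) (W := D.X) (p := fun t => TensorProduct.lift β
      (DGMod.lin (MonoidalCategory.tensorμ C.X C.X D.X D.X) ((x ⊗ₜ[K] x') ⊗ₜ[K] t)) =
        TensorProduct.lift b t) (D.comul y) ?_ (fun s t hs ht => ?_) fun r s y y' hy hy' => ?_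
    · simp
    · rw [TensorProduct.tmul_add, map_add, map_add, hs, ht, map_add]
    · rw [lin_tensorμ hx' hy, TensorProduct.lift.tmul, hb' r s y y' hy hy', map_smul]
      rfl

/-- The Koszul sign `∏_{i < j} (-1)^(e i * f j)` for moving `f j` past `e i`. -/
def pairSign (K : Type u) [Field K] {n : ℕ} (e f : Fin n → ℤ) : K :=
  ∏ i, ∏ j, if i < j then (-1 : K) ^ (e i * f j) else 1

theorem pairSign_eq {n : ℕ} (e f : Fin n → ℤ) :
    pairSign K e f = ∏ i, (-1 : K) ^ (e i * ∑ j with i < j, f j) := by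
  refine Finset.prod_congr rfl fun i _ => ?_
  rw [Finset.mul_sum, ← prod_neg_one_zpow, Finset.prod_filter]

theorem pairSign_snoc {n : ℕ} (e f : Fin n → ℤ) (p q : ℤ) :
    pairSign K (Fin.snoc e p : Fin (n + 1) → ℤ) (Fin.snoc f q : Fin (n + 1) → ℤ) =
      pairSign K e f * ∏ i, (-1 : K) ^ (e i * q) := by
  rw [pairSign, Fin.prod_univ_castSucc]
  simp only [Fin.prod_univ_castSucc, Fin.snoc_castSucc, Fin.snoc_last, Fin.castSucc_lt_castSucc_iff,
    Fin.castSucc_lt_last, if_true, lt_self_iff_false, if_false, mul_one, Finset.prod_mul_distrib,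
    (Fin.castSucc_lt_last _).not_gt, Finset.prod_const_one]
  rfl

theorem counit_tmul {C D : UCocom K} (x : C.X) (y : D.X) :
    (C ⊗ D).counit (x ⊗ₜ[K] y) = C.counit x * D.counit y := rfl

theorem pull_compKoszul {n : ℕ} (M : MultilinearMap K (fun _ : Fin n => (C.X : Type u)) N) (q : ℤ)
    {r : ℤ} {x : C.X} (hx : x ∈ C.X.gr r) :
    C.pull n (M.compLinearMap fun _ => C.X.koszul q) x = ((-1 : K) ^ (q * r)) • C.pull n M x := by
  rw [← LinearMap.smul_apply, ← map_smul]
  refine C.pull_congr hx fun e u hu he => ?_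
  rw [MultilinearMap.compLinearMap_apply, funext fun i => C.X.koszul_of_mem q (hu i),
    MultilinearMap.map_smul_univ, _root_.smul_apply, prod_neg_one_zpow, ← Finset.mul_sum, he]

variable {C} in
/-- The iterated coproduct of `C ⊗ D` is that of `C` followed by that of `D`, up to the sign for
moving all `xᵢ` to the left of all `yⱼ`. -/
theorem pull_tensor {D : UCocom K} {n : ℕ}
    (L : MultilinearMap K (fun _ : Fin n => ((C ⊗ D).X : Type u)) N)
    (B : MultilinearMap K (fun _ : Fin n => (C.X : Type u))
      (MultilinearMap K (fun _ : Fin n => (D.X : Type u)) N))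
    (h : ∀ (e f : Fin n → ℤ) (u : Fin n → C.X) (v : Fin n → D.X), (∀ i, u i ∈ C.X.gr (e i)) →
      (∀ i, v i ∈ D.X.gr (f i)) → B u v = pairSign K f e • L fun i => u i ⊗ₜ[K] v i)
    (x : C.X) (y : D.X) :
    (C ⊗ D).pull n L (x ⊗ₜ[K] y) = C.pull n ((D.pull n).compMultilinearMap B) x y := by
  induction n generalizing N x y with
  | zero =>
    rw [pull_zero, pull_zero, LinearMap.smul_apply, LinearMap.compMultilinearMap_apply, pull_zero,
      counit_tmul, h Fin.elim0 Fin.elim0 _ _ (fun i => i.elim0) (fun i => i.elim0), smul_smul]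
    simp only [pairSign, Finset.univ_eq_empty, Finset.prod_empty, one_smul]
    congr 2
    funext i
    exact i.elim0
  | succ n ih =>
    rw [pull_succ, pull_succ]
    refine conv₂_tensor _ _ (fun p q x x' hx hx' => ?_) x y
    set B' := (LinearMap.applyₗ x').compMultilinearMap B.curryRight with hB'
    set cur : MultilinearMap K (fun _ : Fin (n + 1) => (D.X : Type u)) N →ₗ[K] _ :=
      (multilinearCurryRightEquiv K (fun _ : Fin (n + 1) => (D.X : Type u)) N).toLinearMap
    refine ⟨C.pull n ((D.pull n ∘ₗ cur).compMultilinearMap B') x, ?_, fun r s y y' hy hy' => ?_⟩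
    · rw [pull_curry_apply, ← LinearMap.comp_apply D.conv₂, ← pull_compMultilinearMap]
      rfl
    · let Ψ : MultilinearMap K (fun _ : Fin (n + 1) => (D.X : Type u)) N →ₗ[K]
          MultilinearMap K (fun _ : Fin n => (D.X : Type u)) N :=
        { toFun Q := ((LinearMap.applyₗ y').compMultilinearMap Q.curryRight).compLinearMap
            fun _ => D.X.koszul q
          map_add' _ _ := by ext; rfl
          map_smul' _ _ := by ext; rfl }
      have hΨ : LinearMap.applyₗ y ∘ₗ D.pull n ∘ₗ Ψ = ((-1 : K) ^ (q * r)) •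
          (LinearMap.applyₗ y' ∘ₗ LinearMap.applyₗ y ∘ₗ D.pull n ∘ₗ cur) := by
        refine LinearMap.ext fun Q => ?_
        refine (D.pull_compKoszul _ q hy).trans ?_
        rw [pull_compMultilinearMap]
        rfl
      have key := ih ((LinearMap.applyₗ (x' ⊗ₜ[K] y')).compMultilinearMap L.curryRight)
        (Ψ.compMultilinearMap B') (fun e f u v hu hv => by
          have hKv : (fun i => D.X.koszul q (v i)) = fun i => ((-1 : K) ^ (q * f i)) • v i :=
            funext fun i => D.X.koszul_of_mem q (hv i)
          have h1 : Ψ (B' u) v = B (Fin.snoc u x') (Fin.snoc (fun i => D.X.koszul q (v i)) y') :=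
            rfl
          have h2 : B (Fin.snoc u x') (Fin.snoc (fun i => ((-1 : K) ^ (q * f i)) • v i) y') =
              (∏ i, ((-1 : K) ^ (q * f i))) • B (Fin.snoc u x') (Fin.snoc v y') := by
            have := MultilinearMap.map_smul_univ ((LinearMap.applyₗ y').compMultilinearMap
              (B (Fin.snoc u x')).curryRight) (fun i => (-1 : K) ^ (q * f i)) v
            exact this
          have hh : ∀ i, (Fin.snoc u x' : Fin (n + 1) → C.X) i ∈
              C.X.gr ((Fin.snoc e q : Fin (n + 1) → ℤ) i) := fun i => by
            refine Fin.lastCases ?_ (fun i => ?_) i <;> simp [hx', hu]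
          have hh' : ∀ i, (Fin.snoc v y' : Fin (n + 1) → D.X) i ∈
              D.X.gr ((Fin.snoc f s : Fin (n + 1) → ℤ) i) := fun i => by
            refine Fin.lastCases ?_ (fun i => ?_) i <;> simp [hy', hv]
          have hs : (∏ i, (-1 : K) ^ (q * f i)) * (pairSign K f e * ∏ i, (-1 : K) ^ (f i * q)) =
              pairSign K f e := by
            rw [mul_left_comm, ← Finset.prod_mul_distrib,
              Finset.prod_congr rfl (g := fun _ => (1 : K)) fun i _ => by
                rw [mul_comm (f i), DGMod.neg_one_zpow_mul_self], Finset.prod_const_one, mul_one]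
          have ht : (fun i => (Fin.snoc u x' : Fin (n + 1) → C.X) i ⊗ₜ[K]
              (Fin.snoc v y' : Fin (n + 1) → D.X) i) =
              (Fin.snoc (fun i => u i ⊗ₜ[K] v i) (x' ⊗ₜ[K] y') : Fin (n + 1) → C.X ⊗[K] D.X) :=
            funext fun i => by refine Fin.lastCases ?_ (fun i => ?_) i <;> simp
          rw [LinearMap.compMultilinearMap_apply, h1, hKv, h2,
            h (Fin.snoc e q) (Fin.snoc f s) _ _ hh hh', pairSign_snoc, smul_smul, hs, ht]
          rfl) x y
      have e1 : (C.pull n ((D.pull n ∘ₗ cur).compMultilinearMap B') x) y y' =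
          (LinearMap.applyₗ y' ∘ₗ LinearMap.applyₗ y ∘ₗ D.pull n ∘ₗ cur) (C.pull n B' x) := by
        rw [pull_compMultilinearMap]; rfl
      have e2 : (C.pull n ((D.pull n).compMultilinearMap (Ψ.compMultilinearMap B')) x) y =
          (LinearMap.applyₗ y ∘ₗ D.pull n ∘ₗ Ψ) (C.pull n B' x) := by
        rw [pull_compMultilinearMap, pull_compMultilinearMap]; rfl
      have e3 := (C ⊗ D).pull_curry_apply L.curryRight (x ⊗ₜ[K] y) (x' ⊗ₜ[K] y')
      refine e1.trans (Eq.trans ?_ (congrArg (fun t => ((-1 : K) ^ (q * r)) • t) e3.symm))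
      rw [key, e2, hΨ, LinearMap.smul_apply, smul_smul, DGMod.neg_one_zpow_mul_self, one_smul]

end UCocom

/-! ### Signs -/

/-- Reindexing a product over pairs `i < j` along a permutation. -/
theorem prod_lt_reindex {n : ℕ} (σ : Equiv.Perm (Fin n)) (F : Fin n → Fin n → K) :
    (∏ i, ∏ j, if i < j then F i j else 1) =
      ∏ i, ∏ j, if i < j then (if σ i < σ j then F (σ i) (σ j) else F (σ j) (σ i)) else 1 := by
  have h1 : (∏ i, ∏ j, if i < j then F i j else 1) =
      ∏ i, ∏ j, if σ i < σ j then F (σ i) (σ j) else 1 := by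
    rw [← Equiv.prod_comp σ]
    exact Finset.prod_congr rfl fun i _ => (Equiv.prod_comp σ _).symm
  have h2 : ∀ i j, (if σ i < σ j then F (σ i) (σ j) else 1) =
      (if i < j ∧ σ i < σ j then F (σ i) (σ j) else 1) *
        if j < i ∧ σ i < σ j then F (σ i) (σ j) else 1 := fun i j => by
    rcases lt_trichotomy i j with h | rfl | h
    · simp [h, h.not_gt]
    · simp
    · simp [h, h.not_gt]
  have h3 : ∀ i j, (if i < j then (if σ i < σ j then F (σ i) (σ j) else F (σ j) (σ i)) else 1) =
      (if i < j ∧ σ i < σ j then F (σ i) (σ j) else 1) *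
        if i < j ∧ σ j < σ i then F (σ j) (σ i) else 1 := fun i j => by
    by_cases h : i < j
    · rcases lt_trichotomy (σ i) (σ j) with h' | h' | h'
      · simp [h, h', h'.not_gt]
      · exact absurd (σ.injective h') h.ne
      · simp [h, h', h'.not_gt]
    · simp [h]
  rw [h1]
  simp only [h2, h3, Finset.prod_mul_distrib]
  congr 1
  exact Finset.prod_comm

/-- The Koszul sign is a cocycle, so that equivariance has to be checked for generators only. -/
theorem koszulSign_mul {n : ℕ} (σ τ : Equiv.Perm (Fin n)) (e : Fin n → ℤ) :
    koszulSign K (σ * τ) e = koszulSign K σ e * koszulSign K τ (fun i => e (σ i)) := by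
  have h : koszulSign K σ e = ∏ i, ∏ j, if i < j then
      (if σ j < σ i then (-1 : K) ^ (e (σ i) * e (σ j)) else 1) else 1 := by
    simp only [koszulSign, ite_and]
  rw [h, prod_lt_reindex τ]
  simp only [koszulSign, ← Finset.prod_mul_distrib]
  refine Finset.prod_congr rfl fun i _ => Finset.prod_congr rfl fun j _ => ?_
  by_cases hij : i < j
  · have h1 : τ i ≠ τ j := fun h => hij.ne (τ.injective h)
    have h2 : σ (τ i) ≠ σ (τ j) := fun h => h1 (σ.injective h)
    simp only [hij, true_and, if_true, Equiv.Perm.mul_apply]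
    rcases lt_or_gt_of_ne h1 with h1 | h1 <;> rcases lt_or_gt_of_ne h2 with h2 | h2
    · simp [h1, h1.not_gt, h2.not_gt]
    · simp [h1, h2, h1.not_gt]
    · simp [h1, h2, h1.not_gt, h2.not_gt]
      rw [mul_comm (e (σ (τ j))), DGMod.neg_one_zpow_mul_self]
    · simp [h1, h2, h1.not_gt, h2.not_gt]
  · simp [hij]

theorem koszulSign_one {n : ℕ} (e : Fin n → ℤ) : koszulSign K 1 e = 1 := by
  refine Finset.prod_eq_one fun i _ => Finset.prod_eq_one fun j _ => if_neg ?_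
  rintro ⟨h1, h2⟩
  exact h1.not_gt h2

theorem koszulSign_swap {n : ℕ} (i : Fin n) (e : Fin (n + 1) → ℤ) :
    koszulSign K (Equiv.swap i.castSucc i.succ) e = (-1 : K) ^ (e i.castSucc * e i.succ) := by
  have hi : ∀ a b : Fin (n + 1), a < b ∧ Equiv.swap i.castSucc i.succ b <
      Equiv.swap i.castSucc i.succ a → a = i.castSucc ∧ b = i.succ := by
    rintro a b ⟨h1, h2⟩
    rw [Equiv.swap_apply_def, Equiv.swap_apply_def] at h2
    simp only [Fin.ext_iff] at h2 ⊢
    rw [Fin.lt_def] at h1 h2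
    split_ifs at h2 <;> simp at * <;> omega
  rw [koszulSign, Finset.prod_eq_single i.castSucc, Finset.prod_eq_single i.succ]
  · rw [if_pos]
    · rw [Equiv.swap_apply_left, Equiv.swap_apply_right, mul_comm]
    · rw [Equiv.swap_apply_left, Equiv.swap_apply_right]
      exact ⟨Fin.castSucc_lt_succ, Fin.castSucc_lt_succ⟩
  · exact fun b _ hb => if_neg fun h => hb (hi _ _ h).2
  · simp
  · exact fun a _ ha => Finset.prod_eq_one fun b _ => if_neg fun h => ha (hi _ _ h).1
  · simp

/-- The sign identity behind the equivariance of the operations on `[C, A]`. -/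
theorem pairSign_perm {n : ℕ} (σ : Equiv.Perm (Fin n)) (e q : Fin n → ℤ) :
    UCocom.pairSign K e q * koszulSign K σ (fun i => e i + q i) =
      koszulSign K σ q * koszulSign K σ e *
        UCocom.pairSign K (fun i => e (σ i)) (fun i => q (σ i)) := by
  rw [UCocom.pairSign, prod_lt_reindex σ]
  simp only [koszulSign, UCocom.pairSign, ← Finset.prod_mul_distrib]
  refine Finset.prod_congr rfl fun i _ => Finset.prod_congr rfl fun j _ => ?_
  by_cases hij : i < j
  · have h1 : σ i ≠ σ j := fun h => hij.ne (σ.injective h)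
    rcases lt_or_gt_of_ne h1 with h1 | h1
    · simp [hij, h1, h1.not_gt]
    · simp only [hij, h1, h1.not_gt, if_true, if_false, and_self]
      have : e (σ j) * q (σ i) + (e (σ i) + q (σ i)) * (e (σ j) + q (σ j)) =
        (e (σ j) * q (σ i) + e (σ j) * q (σ i)) +
          (q (σ i) * q (σ j) + e (σ i) * e (σ j) + e (σ i) * q (σ j)) := by ring
      have hne : (-1 : K) ≠ 0 := by simp
      rw [← zpow_add₀ hne, this, zpow_add₀ hne, zpow_add₀ hne, DGMod.neg_one_zpow_mul_self,
        zpow_add₀ hne, zpow_add₀ hne, one_mul]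
  · simp [hij]

namespace DGMod

/-! ### Multilinear maps given on homogeneous elements -/

/-- `DGMod.elim`, as a linear map. -/
noncomputable def elimₗ (V : DGMod K) {M : Type*} [AddCommGroup M] [Module K M] :
    (ℤ → (V →ₗ[K] M)) →ₗ[K] (V →ₗ[K] M) where
  toFun := V.elim
  map_add' φ ψ := V.linearMap_ext fun n x hx => by
    simp only [LinearMap.add_apply, V.elim_of_mem _ hx, Pi.add_apply]
  map_smul' c φ := V.linearMap_ext fun n x hx => by
    simp only [LinearMap.smul_apply, V.elim_of_mem _ hx, Pi.smul_apply, RingHom.id_apply]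

/-- The multilinear map that is `φ e` on homogeneous elements of degrees `e`. -/
noncomputable def multiElim (V : DGMod K) : ∀ {n : ℕ} {N : Type u} [AddCommGroup N] [Module K N],
    ((Fin n → ℤ) → MultilinearMap K (fun _ : Fin n => (V : Type u)) N) →
      MultilinearMap K (fun _ : Fin n => (V : Type u)) N
  | 0, _, _, _, φ => φ Fin.elim0
  | _ + 1, _, _, _, φ => (V.multiElim fun e => V.elimₗ.compMultilinearMap
      (MultilinearMap.pi fun q => (φ (Fin.snoc e q)).curryRight)).uncurryRight

theorem multiElim_of_mem (V : DGMod K) {n : ℕ} {N : Type u} [AddCommGroup N] [Module K N]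
    (φ : (Fin n → ℤ) → MultilinearMap K (fun _ : Fin n => (V : Type u)) N) {e : Fin n → ℤ}
    {v : Fin n → V} (hv : ∀ i, v i ∈ V.gr (e i)) : V.multiElim φ v = φ e v := by
  induction n generalizing N with
  | zero =>
    rw [Subsingleton.elim e Fin.elim0]
    rfl
  | succ n ih =>
    rw [multiElim, MultilinearMap.uncurryRight_apply, ih _ (e := Fin.init e)
      (v := Fin.init v) (fun i => hv i.castSucc)]
    refine (V.elim_of_mem _ (hv (Fin.last n))).trans ?_
    change φ _ (Fin.snoc (Fin.init v) (v (Fin.last n))) = _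
    rw [Fin.snoc_init_self, Fin.snoc_init_self]

theorem ihomCoe_injective {V W : DGMod K} : Function.Injective (ihomCoe V W) :=
  Subtype.val_injective

theorem ihomCoe_d {V W : DGMod K} (f : ihom V W) :
    ihomCoe V W ((ihom V W).d f) = homD V W (ihomCoe V W f) := rfl

theorem mem_ihom_gr {V W : DGMod K} {f : ihom V W} {n : ℤ} :
    f ∈ (ihom V W).gr n ↔ ihomCoe V W f ∈ homGr V W n := Iff.rfl

end DGMod

namespace UCocom

variable (C : UCocom K) {N : Type u} [AddCommGroup N] [Module K N]

/-- The iterated coproduct is invariant under permutations, up to the Koszul sign. -/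
theorem pull_perm {n : ℕ} (σ : Equiv.Perm (Fin n))
    {M M' : MultilinearMap K (fun _ : Fin n => (C.X : Type u)) N}
    (h : ∀ (e : Fin n → ℤ) (v : Fin n → C.X), (∀ j, v j ∈ C.X.gr (e j)) →
      M' v = koszulSign K σ e • M fun j => v (σ j)) : C.pull n M' = C.pull n M := by
  cases n with
  | zero =>
    congr 1
    refine DGMod.multilinearMap_ext _ fun e v hv => ?_
    rw [h e v hv, Subsingleton.elim σ 1, koszulSign_one, one_smul]
    rfl
  | succ n =>
    have hσ : σ ∈ Submonoid.closure (Set.range fun i : Fin n ↦ Equiv.swap i.castSucc i.succ) := by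
      rw [Equiv.Perm.mclosure_swap_castSucc_succ]; trivial
    induction hσ using Submonoid.closure_induction generalizing M M' with
    | mem σ hσ =>
      obtain ⟨i, rfl⟩ := hσ
      exact C.pull_swap i fun e v hv => by rw [h e v hv, koszulSign_swap]
    | one =>
      congr 1
      refine DGMod.multilinearMap_ext _ fun e v hv => ?_
      rw [h e v hv, koszulSign_one, one_smul]
      rfl
    | mul σ τ _ _ hσ hτ =>
      let M'' := C.X.multiElim fun e => koszulSign K τ e • M.domDomCongr τ
      have hM'' : ∀ (e : Fin (n + 1) → ℤ) (v : Fin (n + 1) → C.X), (∀ j, v j ∈ C.X.gr (e j)) →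
          M'' v = koszulSign K τ e • M fun j => v (τ j) := fun e v hv =>
        C.X.multiElim_of_mem _ hv
      rw [← hτ hM'']
      refine hσ fun e v hv => ?_
      rw [h e v hv, koszulSign_mul, hM'' (fun i => e (σ i)) _ (fun j => hv (σ j)), smul_smul]
      rfl

theorem conv₂_counit_left {b : C.X →ₗ[K] C.X →ₗ[K] N} {g : C.X →ₗ[K] N}
    (h : ∀ v w, b v w = C.counit v • g w) : C.conv₂ b = g := by
  have : TensorProduct.lift b = g ∘ₗ (TensorProduct.lid K C.X).toLinearMap ∘ₗ
      TensorProduct.map C.counit LinearMap.id := by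
    ext v w; simp [h]
  ext x
  rw [conv₂_apply, this, LinearMap.comp_apply, LinearMap.comp_apply, C.counit_tmul_comul]
  simp

theorem pull_one (M : MultilinearMap K (fun _ : Fin 1 => (C.X : Type u)) N) (g : C.X →ₗ[K] N)
    (h : ∀ v, M v = g (v 0)) : C.pull 1 M = g := by
  rw [pull_succ]
  refine C.conv₂_counit_left fun v w => ?_
  rw [pull_zero, LinearMap.smul_apply, MultilinearMap.curryRight_apply, h]
  rfl

end UCocom

/-! ### Inserting degrees -/

theorem prod_insert {m n l : ℕ} (h : l + 1 = m + n) (i : Fin m) (F : Fin l → K) :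
    ∏ s, F s = (∏ j : {j : Fin m // j ≠ i}, F (outerPos h i j.1 j.2)) *
      ∏ b, F (innerPos h i b) := by
  rw [← (insertEquiv h i).prod_comp, Fintype.prod_sum_type]
  rfl

/-- Insertion at `i` keeps the order of the other inputs. -/
theorem outerPos_lt_outerPos {m n l : ℕ} (h : l + 1 = m + n) (i : Fin m) {j k : Fin m}
    (hj : j ≠ i) (hk : k ≠ i) : outerPos h i j hj < outerPos h i k hk ↔ j < k := by
  have h1 : (j : ℕ) ≠ i := fun h => hj (Fin.ext h)
  have h2 : (k : ℕ) ≠ i := fun h => hk (Fin.ext h)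
  simp only [outerPos, Fin.lt_def]
  split_ifs <;> omega

theorem outerPos_lt_innerPos {m n l : ℕ} (h : l + 1 = m + n) (i : Fin m) {j : Fin m}
    (hj : j ≠ i) (b : Fin n) : outerPos h i j hj < innerPos h i b ↔ j < i := by
  have h1 : (j : ℕ) ≠ i := fun h => hj (Fin.ext h)
  have := b.2
  simp only [outerPos, innerPos, Fin.lt_def]
  split_ifs <;> omega

theorem innerPos_lt_outerPos {m n l : ℕ} (h : l + 1 = m + n) (i : Fin m) {j : Fin m}
    (hj : j ≠ i) (b : Fin n) : innerPos h i b < outerPos h i j hj ↔ i < j := by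
  have h1 : (j : ℕ) ≠ i := fun h => hj (Fin.ext h)
  have := b.2
  simp only [outerPos, innerPos, Fin.lt_def]
  split_ifs <;> omega

theorem innerPos_lt_innerPos {m n l : ℕ} (h : l + 1 = m + n) (i : Fin m) (b c : Fin n) :
    innerPos h i b < innerPos h i c ↔ b < c := by
  rw [Fin.lt_def, Fin.lt_def]
  exact Nat.add_lt_add_iff_left

/-- The degrees of the inputs of `μ` in `μ ∘ᵢ ν`, when `ν` raises degrees by `r`. -/
def outerDeg {m n l : ℕ} (h : l + 1 = m + n) (i : Fin m) (r : ℤ) (q : Fin l → ℤ) (j : Fin m) : ℤ :=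
  if hj : j = i then r + ∑ b, q (innerPos h i b) else q (outerPos h i j hj)

theorem outerDeg_self {m n l : ℕ} (h : l + 1 = m + n) (i : Fin m) (r : ℤ) (q : Fin l → ℤ) :
    outerDeg h i r q i = r + ∑ b, q (innerPos h i b) := dif_pos rfl

theorem outerDeg_ne {m n l : ℕ} (h : l + 1 = m + n) (i : Fin m) (r : ℤ) (q : Fin l → ℤ)
    {j : Fin m} (hj : j ≠ i) : outerDeg h i r q j = q (outerPos h i j hj) := dif_neg hj

theorem sum_lt_insert {m n l : ℕ} (h : l + 1 = m + n) (i : Fin m) (e : Fin l → ℤ) :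
    (∑ s with Fin.val s < Fin.val i, e s) =
      ∑ j : {j : Fin m // j ≠ i}, if j.1 < i then e (outerPos h i j.1 j.2) else 0 := by
  rw [Finset.sum_filter, sum_insert h i, Finset.sum_eq_zero (s := (Finset.univ : Finset (Fin n))),
    add_zero]
  · refine Finset.sum_congr rfl fun j _ => ?_
    have h1 : (j.1 : ℕ) ≠ i := fun h => j.2 (Fin.ext h)
    congr 1
    simp only [outerPos, Fin.lt_def, eq_iff_iff]
    have := j.1.2
    split_ifs <;> omega
  · intro b _
    simp [innerPos]

/-- The sign identity behind the compatibility of the operations on `[C, A]` with partial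
compositions. -/
theorem pairSign_insert {m n l : ℕ} (h : l + 1 = m + n) (i : Fin m) (r : ℤ) (e q : Fin l → ℤ) :
    UCocom.pairSign K e q * (-1 : K) ^ (r * ∑ s with Fin.val s < Fin.val i, e s) =
      UCocom.pairSign K (outerDeg h i 0 e) (outerDeg h i r q) *
        UCocom.pairSign K (fun b => e (innerPos h i b)) (fun b => q (innerPos h i b)) := by
  have hne : (-1 : K) ≠ 0 := by simp
  rw [sum_lt_insert h i, Finset.mul_sum, ← prod_neg_one_zpow]
  simp only [UCocom.pairSign]
  rw [prod_insert h i, Fintype.prod_eq_mul_prod_subtype_ne (a := i)]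
  simp only [prod_insert h i]
  conv_rhs =>
    simp only [Fintype.prod_eq_mul_prod_subtype_ne (a := i)]
  simp only [outerPos_lt_outerPos, outerPos_lt_innerPos, innerPos_lt_outerPos,
    innerPos_lt_innerPos, Finset.prod_mul_distrib, lt_self_iff_false, if_false, one_mul]
  have h1 : (∏ k : {j // j ≠ i}, if i < k.1 then
      (-1 : K) ^ (outerDeg h i 0 e i * outerDeg h i r q k.1) else 1) =
      ∏ b, ∏ k : {j // j ≠ i}, if i < k.1 then
        (-1 : K) ^ (e (innerPos h i b) * q (outerPos h i k.1 k.2)) else 1 := by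
    rw [Finset.prod_comm]
    refine Finset.prod_congr rfl fun k _ => ?_
    split_ifs
    · rw [outerDeg_self, outerDeg_ne h i r q k.2, zero_add, Finset.sum_mul, prod_neg_one_zpow]
    · simp
  have h2 : (∏ j : {j // j ≠ i}, if j.1 < i then
      (-1 : K) ^ (outerDeg h i 0 e j.1 * outerDeg h i r q i) else 1) =
      (∏ j : {j // j ≠ i}, ∏ b, if j.1 < i then
        (-1 : K) ^ (e (outerPos h i j.1 j.2) * q (innerPos h i b)) else 1) *
      ∏ j : {j // j ≠ i}, (-1 : K) ^ (r * if j.1 < i then e (outerPos h i j.1 j.2) else 0) := by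
    rw [← Finset.prod_mul_distrib]
    refine Finset.prod_congr rfl fun j _ => ?_
    split_ifs
    · rw [outerDeg_self, outerDeg_ne h i 0 e j.2, prod_neg_one_zpow, ← Finset.mul_sum,
        ← zpow_add₀ hne]
      congr 1
      ring
    · simp
  have h3 : (∏ j : {j // j ≠ i}, ∏ k : {j // j ≠ i}, if j.1 < k.1 then
      (-1 : K) ^ (outerDeg h i 0 e j.1 * outerDeg h i r q k.1) else 1) =
      ∏ j : {j // j ≠ i}, ∏ k : {j // j ≠ i}, if j.1 < k.1 then
        (-1 : K) ^ (e (outerPos h i j.1 j.2) * q (outerPos h i k.1 k.2)) else 1 :=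
    Finset.prod_congr rfl fun j _ => Finset.prod_congr rfl fun k _ => by
      rw [outerDeg_ne h i 0 e j.2, outerDeg_ne h i r q k.2]
  rw [h1, h2, h3]
  ring

namespace UCocom

theorem pairSign_update_left {n : ℕ} (e q : Fin n → ℤ) (i : Fin n) :
    pairSign K (Function.update e i (e i - 1)) q =
      pairSign K e q * (-1 : K) ^ ∑ j with i < j, q j := by
  rw [pairSign_eq, pairSign_eq, Fintype.prod_eq_mul_prod_subtype_ne (a := i),
    Fintype.prod_eq_mul_prod_subtype_ne (a := i), Function.update_self, sub_mul, one_mul,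
    Finset.prod_congr rfl (g := fun j : {j // j ≠ i} => (-1 : K) ^ (e j.1 * ∑ k with j.1 < k, q k))
      fun j _ => by rw [Function.update_of_ne j.2], sub_eq_add_neg, zpow_add₀ (by simp), zpow_neg,
    ← inv_zpow]
  norm_num
  ring

theorem pairSign_update_right {n : ℕ} (e q : Fin n → ℤ) (i : Fin n) :
    pairSign K e (Function.update q i (q i - 1)) =
      pairSign K e q * (-1 : K) ^ ∑ j with j < i, e j := by
  have h : pairSign K e (Function.update q i (q i - 1)) = ∏ j, ∏ k,
      ((if j < k then (-1 : K) ^ (e j * q k) else 1) *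
        if k = i then (if j < i then (-1 : K) ^ e j else 1) else 1) := by
    refine Finset.prod_congr rfl fun j _ => Finset.prod_congr rfl fun k _ => ?_
    by_cases hk : k = i
    · subst hk
      simp only [if_true]
      split_ifs
      · rw [Function.update_self, mul_sub, mul_one, sub_eq_add_neg, zpow_add₀ (by simp), zpow_neg,
          ← inv_zpow]
        norm_num
      · rw [mul_one]
    · simp [hk]
  rw [h, ← prod_neg_one_zpow, Finset.prod_filter]
  simp only [Finset.prod_mul_distrib, pairSign, Finset.prod_ite_eq', Finset.mem_univ, if_true]

end UCocom

/-! ### The convolution algebra -/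

namespace PAlg

variable {P : DGOperad K} (C : UCocom K) (A : PAlg P)

/-- The multilinear map `(u₁, …, uₙ) ↦ ± γ_A(p; f₁ u₁, …, fₙ uₙ)` whose value at the iterated
coproduct is the convolution product of the `fᵢ`. -/
noncomputable def convMulti {n : ℕ} (p : P.obj n) (f : Fin n → (C.X →ₗ[K] A.U)) (q : Fin n → ℤ) :
    MultilinearMap K (fun _ : Fin n => (C.X : Type u)) A.U :=
  (A.act p).compLinearMap (fun i => f i ∘ₗ C.X.koszul (∑ j with i < j, q j))

theorem convAct_eq_pull {n : ℕ} (p : P.obj n) (f : Fin n → (C.X →ₗ[K] A.U)) (q : Fin n → ℤ) :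
    convAct C A p f q = C.pull n (convMulti C A p f q) := C.lift_iterComul _

theorem convMulti_apply {n : ℕ} (p : P.obj n) (f : Fin n → (C.X →ₗ[K] A.U)) (q : Fin n → ℤ)
    {e : Fin n → ℤ} {u : Fin n → C.X} (hu : ∀ i, u i ∈ C.X.gr (e i)) :
    convMulti C A p f q u = UCocom.pairSign K e q • A.act p fun i => f i (u i) := by
  rw [convMulti, MultilinearMap.compLinearMap_apply]
  have : ∀ i, (f i ∘ₗ C.X.koszul (∑ j with i < j, q j)) (u i) =
      ((-1 : K) ^ (e i * ∑ j with i < j, q j)) • f i (u i) := fun i => by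
    rw [LinearMap.comp_apply, C.X.koszul_of_mem _ (hu i), map_smul, mul_comm]
  rw [funext this, MultilinearMap.map_smul_univ, ← UCocom.pairSign_eq]

theorem convAct_mem {n : ℕ} {r : ℤ} {p : P.obj n} {f : Fin n → (C.X →ₗ[K] A.U)} {q : Fin n → ℤ}
    (hp : p ∈ (P.obj n).gr r) (hf : ∀ i, f i ∈ DGMod.homGr C.X A.U (q i)) :
    convAct C A p f q ∈ DGMod.homGr C.X A.U (r + ∑ i, q i) := by
  intro e x hx
  rw [convAct_eq_pull]
  refine C.pull_mem _ _ hx fun d u hu hd => ?_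
  rw [convMulti_apply C A p f q hu]
  refine Submodule.smul_mem _ _ ?_
  have := A.act_mem hp (fun i => hf i _ _ (hu i))
  rwa [Finset.sum_add_distrib, hd, add_left_comm] at this

theorem convAct_d {n : ℕ} {r : ℤ} {p : P.obj n} {f : Fin n → (C.X →ₗ[K] A.U)} {q : Fin n → ℤ}
    (hp : p ∈ (P.obj n).gr r) (hf : ∀ i, f i ∈ DGMod.homGr C.X A.U (q i)) :
    DGMod.homD C.X A.U (convAct C A p f q) = convAct C A ((P.obj n).d p) f q +
      ∑ i, ((-1 : K) ^ (r + ∑ j with j < i, q j)) •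
        convAct C A p (Function.update f i (DGMod.homD C.X A.U (f i)))
          (Function.update q i (q i - 1)) := by
  have hne : (-1 : K) ≠ 0 := by simp
  rw [DGMod.homD_of_mem (convAct_mem C A hp hf)]
  refine DGMod.linearMap_ext _ fun e x hx => ?_
  simp only [convAct_eq_pull]
  have hL : (A.U.d ∘ₗ C.pull n (convMulti C A p f q) - ((-1 : K) ^ (r + ∑ i, q i)) •
      C.pull n (convMulti C A p f q) ∘ₗ C.X.d) x = C.pull n (A.U.d.compMultilinearMap
        (convMulti C A p f q) - ((-1 : K) ^ (r + ∑ i, q i)) •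
          C.dMulti (convMulti C A p f q)) x := by
    rw [map_sub, map_smul, UCocom.pull_compMultilinearMap, LinearMap.sub_apply,
      LinearMap.sub_apply, LinearMap.smul_apply, LinearMap.smul_apply, UCocom.pull_d]
    rfl
  rw [hL]
  simp only [← map_smul, ← map_sum, ← map_add]
  refine C.pull_congr hx fun e u hu _ => ?_
  have hw : ∀ i, f i (u i) ∈ A.U.gr (e i + q i) := fun i => hf i _ _ (hu i)
  rw [_root_.sub_apply, _root_.smul_apply, LinearMap.compMultilinearMap_apply, C.dMulti_apply _ hu,
    convMulti_apply C A p f q hu, map_smul, A.act_d hp hw, _root_.add_apply, _root_.sum_apply,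
    convMulti_apply C A _ f q hu, smul_add, add_sub_assoc]
  congr 1
  rw [Finset.smul_sum, Finset.smul_sum, ← Finset.sum_sub_distrib]
  refine Finset.sum_congr rfl fun i _ => ?_
  have h1 : ∀ j, Function.update u i (C.X.d (u i)) j ∈
      C.X.gr (Function.update e i (e i - 1) j) := fun j => by
    by_cases hj : j = i
    · subst hj; simpa using C.X.d_mem (hu j)
    · simpa [hj] using hu j
  have h2 : (fun j => f j (Function.update u i (C.X.d (u i)) j)) =
      Function.update (fun j => f j (u j)) i (f i (C.X.d (u i))) := funext fun j => by
    by_cases hj : j = i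
    · subst hj; simp
    · simp [hj]
  have h3 : (fun j => Function.update f i (DGMod.homD C.X A.U (f i)) j (u j)) =
      Function.update (fun j => f j (u j)) i
        (A.U.d (f i (u i)) - ((-1 : K) ^ q i) • f i (C.X.d (u i))) := funext fun j => by
    by_cases hj : j = i
    · subst hj; simp [DGMod.homD_of_mem (hf j)]
    · simp [hj]
  have h4 : ∑ j, q j = ∑ j with j < i, q j + q i + ∑ j with i < j, q j := by
    simp only [Finset.sum_filter]
    rw [Fintype.sum_eq_add_sum_subtype_ne (a := i),
      Fintype.sum_eq_add_sum_subtype_ne (fun j => if j < i then q j else 0) i,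
      Fintype.sum_eq_add_sum_subtype_ne (fun j => if i < j then q j else 0) i]
    simp only [lt_self_iff_false, if_false, zero_add]
    rw [add_right_comm, ← Finset.sum_add_distrib, add_comm]
    congr 1
    refine Finset.sum_congr rfl fun j _ => ?_
    rcases lt_or_gt_of_ne j.2 with h | h <;> simp [h, h.not_gt]
  rw [convMulti_apply C A p f q h1, _root_.smul_apply, convMulti_apply C A p _ _ hu, h2, h3,
    MultilinearMap.map_update_sub, MultilinearMap.map_update_smul,
    UCocom.pairSign_update_left, UCocom.pairSign_update_right, h4, Finset.sum_add_distrib]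
  set a := ∑ j with j < i, e j
  set b := ∑ j with j < i, q j
  set g := ∑ j with i < j, q j
  simp only [smul_sub, smul_smul]
  congr 2
  · rw [zpow_add₀ hne, zpow_add₀ hne, zpow_add₀ hne]; ring
  · have hg := DGMod.neg_one_zpow_mul_self (K := K) g
    simp only [zpow_add₀ hne]
    linear_combination ((-1 : K) ^ r * (-1) ^ b * (-1) ^ q i * (-1) ^ a *
      UCocom.pairSign K e q) * hg

theorem convAct_perm {n : ℕ} (σ : Equiv.Perm (Fin n)) (p : P.obj n)
    {f : Fin n → (C.X →ₗ[K] A.U)} {q : Fin n → ℤ}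
    (hf : ∀ i, f i ∈ DGMod.homGr C.X A.U (q i)) :
    convAct C A (P.perm n σ p) f q =
      koszulSign K σ q • convAct C A p (fun i => f (σ i)) (fun i => q (σ i)) := by
  rw [convAct_eq_pull, convAct_eq_pull, ← map_smul]
  refine C.pull_perm σ fun e u hu => ?_
  have hw : ∀ i, f i (u i) ∈ A.U.gr (e i + q i) := fun i => hf i _ _ (hu i)
  rw [convMulti_apply C A _ f q hu, A.act_perm σ p hw, _root_.smul_apply,
    convMulti_apply C A p _ _ (fun i => hu (σ i)), smul_smul, smul_smul, smul_smul, pairSign_perm]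
  congr 1
  ring

theorem convAct_one (f : Fin 1 → (C.X →ₗ[K] A.U)) (q : Fin 1 → ℤ) :
    convAct C A P.one f q = f 0 := by
  rw [convAct_eq_pull]
  refine C.pull_one _ _ fun v => ?_
  rw [convMulti, MultilinearMap.compLinearMap_apply, A.act_one]
  have : C.X.koszul 0 = LinearMap.id := C.X.linearMap_ext fun n x hx => by
    rw [C.X.koszul_of_mem 0 hx]; simp
  rw [Finset.sum_filter, Fin.sum_univ_one, if_neg (lt_irrefl _), this]
  rfl

theorem convAct_circ {m n l : ℕ} (h : l + 1 = m + n) (i : Fin m) (μ : P.obj m) {ν : P.obj n} {r : ℤ}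
    {q : Fin l → ℤ} {f : Fin l → (C.X →ₗ[K] A.U)} (hν : ν ∈ (P.obj n).gr r)
    (hf : ∀ s, f s ∈ DGMod.homGr C.X A.U (q s)) :
    convAct C A (P.circ h i μ ν) f q =
      ((-1 : K) ^ (r * ∑ s with Fin.val s < Fin.val i, q s)) •
        convAct C A μ (fun j => if hj : j = i then
            convAct C A ν (fun b => f (innerPos h i b)) (fun b => q (innerPos h i b))
          else f (outerPos h i j hj)) (outerDeg h i r q) := by
  have hne : (-1 : K) ≠ 0 := by simp
  rw [convAct_eq_pull, convAct_eq_pull _ _ μ, ← map_smul]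
  refine C.pull_insert h i _ _ fun e z hz => ?_
  rw [_root_.smul_apply, convMulti_apply C A μ _ _ hz]
  set g : Fin m → A.U := fun j => if hj : j = i then 0 else f (outerPos h i j hj) (z j)
  have hg : ∀ a, (fun j => if hj : j = i then a else f (outerPos h i j hj) (z j)) =
      Function.update g i a := fun a => funext fun j => by
    by_cases hj : j = i
    · subst hj; simp
    · simp [hj, g]
  have h1 : (fun j => (if hj : j = i then
      convAct C A ν (fun b => f (innerPos h i b)) (fun b => q (innerPos h i b))
        else f (outerPos h i j hj)) (z j)) = Function.update g i (C.pull n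
          (convMulti C A ν (fun b => f (innerPos h i b)) (fun b => q (innerPos h i b))) (z i)) := by
    rw [← hg]
    funext j
    by_cases hj : j = i
    · subst hj; simp [convAct_eq_pull]
    · simp [hj]
  rw [h1, ← MultilinearMap.toLinearMap_apply, ← LinearMap.comp_apply,
    ← UCocom.pull_compMultilinearMap, ← LinearMap.smul_apply, ← LinearMap.smul_apply, ← map_smul,
    ← map_smul]
  refine C.pull_congr (hz i) fun d v hv hd => ?_
  obtain ⟨w, hw, rfl⟩ := exists_insert h i z v
  let ê : Fin l → ℤ := fun s => Sum.elim (fun j => e j.1) d ((insertEquiv h i).symm s)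
  have hê : ∀ j hj, ê (outerPos h i j hj) = e j := fun j hj => by simp [ê]
  have hê' : ∀ b, ê (innerPos h i b) = d b := fun b => by simp [ê]
  have hwe : ∀ s, w s ∈ C.X.gr (ê s) := fun s => by
    obtain ⟨j | b, rfl⟩ := (insertEquiv h i).surjective s
    · rw [insertEquiv_inl, hw, hê]; exact hz _
    · rw [insertEquiv_inr, hê']; exact hv b
  have hoe : outerDeg h i 0 ê = e := funext fun j => by
    by_cases hj : j = i
    · subst hj; rw [outerDeg_self, zero_add, ← hd]; simp only [hê']
    · rw [outerDeg_ne h i 0 ê hj, hê]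
  rw [insertCurry_apply h i _ z w hw, convMulti_apply C A _ f q hwe, _root_.smul_apply,
    _root_.smul_apply, LinearMap.compMultilinearMap_apply, convMulti_apply C A _ _ _ hv, map_smul,
    A.act_circ h i μ hν (fun s => hf s _ _ (hwe s)), MultilinearMap.toLinearMap_apply, ← hg]
  simp only [hw, smul_smul]
  congr 1
  have hs := pairSign_insert (K := K) h i r ê q
  rw [hoe, funext hê'] at hs
  rw [Finset.sum_add_distrib, mul_add, zpow_add₀ hne]
  linear_combination -((-1 : K) ^ (r * ∑ s with Fin.val s < Fin.val i, q s)) * hs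

/-- `convMulti`, as a multilinear function of the `fᵢ`. -/
noncomputable def convMultiL {n : ℕ} (p : P.obj n) (q : Fin n → ℤ) :
    MultilinearMap K (fun _ : Fin n => (DGMod.ihom C.X A.U : Type u))
      (MultilinearMap K (fun _ : Fin n => (C.X : Type u)) A.U) :=
  (LinearMap.applyₗ (A.act p)).compMultilinearMap
    (MultilinearMap.compLinearMapMultilinear.compLinearMap fun i =>
      LinearMap.lcomp K A.U (C.X.koszul (∑ j with i < j, q j)) ∘ₗ DGMod.ihomCoe C.X A.U)

/-- The operations of the convolution algebra, with values in linear maps. -/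
noncomputable def convOp {n : ℕ} (p : P.obj n) :
    MultilinearMap K (fun _ : Fin n => (DGMod.ihom C.X A.U : Type u)) (C.X →ₗ[K] A.U) :=
  (DGMod.ihom C.X A.U).multiElim fun q => (C.pull n).compMultilinearMap (convMultiL C A p q)

theorem convOp_apply {n : ℕ} (p : P.obj n) {f : Fin n → DGMod.ihom C.X A.U} {q : Fin n → ℤ}
    (hf : ∀ i, f i ∈ (DGMod.ihom C.X A.U).gr (q i)) :
    convOp C A p f = convAct C A p (fun i => DGMod.ihomCoe C.X A.U (f i)) q := by
  rw [convOp, DGMod.multiElim_of_mem _ _ hf, convAct_eq_pull]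
  rfl

theorem convAct_add {n : ℕ} (p p' : P.obj n) (f : Fin n → (C.X →ₗ[K] A.U)) (q : Fin n → ℤ) :
    convAct C A (p + p') f q = convAct C A p f q + convAct C A p' f q := by
  simp only [convAct_eq_pull]
  rw [← map_add]
  congr 1
  ext u
  simp [convMulti]

theorem convAct_smul {n : ℕ} (c : K) (p : P.obj n) (f : Fin n → (C.X →ₗ[K] A.U)) (q : Fin n → ℤ) :
    convAct C A (c • p) f q = c • convAct C A p f q := by
  simp only [convAct_eq_pull]
  rw [← map_smul]
  congr 1
  ext u
  simp [convMulti]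

theorem convOp_add {n : ℕ} (p p' : P.obj n) :
    convOp C A (p + p') = convOp C A p + convOp C A p' :=
  DGMod.multilinearMap_ext _ fun q f hf => by
    rw [_root_.add_apply, convOp_apply C A _ hf, convOp_apply C A _ hf, convOp_apply C A _ hf,
      convAct_add]

theorem convOp_smul {n : ℕ} (c : K) (p : P.obj n) : convOp C A (c • p) = c • convOp C A p :=
  DGMod.multilinearMap_ext _ fun q f hf => by
    rw [_root_.smul_apply, convOp_apply C A _ hf, convOp_apply C A _ hf, convAct_smul]

theorem convOp_mem {n : ℕ} (p : P.obj n) (f : Fin n → DGMod.ihom C.X A.U) :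
    convOp C A p f ∈ DGMod.homTotal C.X A.U := by
  refine (P.obj n).homogeneous_induction (p := fun p => convOp C A p f ∈ DGMod.homTotal C.X A.U) p
    ?_ (fun p p' hp hp' => ?_) (fun r p hp => ?_)
  · rw [← zero_smul K (0 : P.obj n), convOp_smul, zero_smul]; exact zero_mem _
  · rw [convOp_add]; exact add_mem hp hp'
  · have : (DGMod.homTotal C.X A.U).mkQ.compMultilinearMap (convOp C A p) = 0 :=
      DGMod.multilinearMap_ext _ fun q f hf => by
        rw [LinearMap.compMultilinearMap_apply, convOp_apply C A p hf]
        exact (Submodule.Quotient.mk_eq_zero _).2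
          (Submodule.mem_iSup_of_mem _ (convAct_mem C A hp hf))
    exact (Submodule.Quotient.mk_eq_zero _).1 (congrArg (fun M => M f) this)

/-- The operations of the convolution algebra. -/
noncomputable def convActL {n : ℕ} : P.obj n →ₗ[K]
    MultilinearMap K (fun _ : Fin n => (DGMod.ihom C.X A.U : Type u)) (DGMod.ihom C.X A.U) where
  toFun p := (convOp C A p).codRestrict (DGMod.homTotal C.X A.U) (convOp_mem C A p)
  map_add' p p' := by
    ext1 f; exact Subtype.ext (congrArg (fun M => M f) (convOp_add C A p p'))
  map_smul' c p := by
    ext1 f; exact Subtype.ext (congrArg (fun M => M f) (convOp_smul C A c p))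

theorem convActL_apply {n : ℕ} (p : P.obj n) {f : Fin n → DGMod.ihom C.X A.U} {q : Fin n → ℤ}
    (hf : ∀ i, f i ∈ (DGMod.ihom C.X A.U).gr (q i)) :
    DGMod.ihomCoe C.X A.U (convActL C A p f) =
      convAct C A p (fun i => DGMod.ihomCoe C.X A.U (f i)) q :=
  convOp_apply C A p hf

/-- The convolution algebra `[C, A]`. -/
noncomputable def conv : PAlg P where
  U := DGMod.ihom C.X A.U
  act := convActL C A
  act_mem {n r p q f} hp hf := by
    change DGMod.ihomCoe C.X A.U _ ∈ DGMod.homGr C.X A.U _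
    rw [convActL_apply C A p hf]
    exact convAct_mem C A hp hf
  act_d {n r p q f} hp hf := by
    refine DGMod.ihomCoe_injective ?_
    rw [DGMod.ihomCoe_d, map_add, map_sum, convActL_apply C A p hf,
      convAct_d C A hp (fun i => DGMod.mem_ihom_gr.1 (hf i))]
    congr 1
    · exact (convActL_apply C A _ hf).symm
    · refine Finset.sum_congr rfl fun i _ => ?_
      rw [map_smul]
      congr 1
      refine Eq.trans ?_ (convActL_apply C A p (q := Function.update q i (q i - 1))
        fun j => ?_).symm
      · congr 1
        funext j
        by_cases hj : j = i
        · subst hj; rw [Function.update_self, Function.update_self]; rfl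
        · rw [Function.update_of_ne hj, Function.update_of_ne hj]
      · by_cases hj : j = i
        · subst hj
          rw [Function.update_self, Function.update_self]
          exact (DGMod.ihom C.X A.U).d_mem (hf j)
        · rw [Function.update_of_ne hj, Function.update_of_ne hj]; exact hf j
  act_one f := by
    have : convActL C A P.one = MultilinearMap.ofSubsingleton K (DGMod.ihom C.X A.U)
        (DGMod.ihom C.X A.U) 0 LinearMap.id :=
      DGMod.multilinearMap_ext _ fun q f hf => DGMod.ihomCoe_injective <|
        (convActL_apply C A P.one hf).trans (convAct_one C A _ _)
    exact congrArg (fun M => M f) this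
  act_perm {n} σ p {q f} hf := by
    refine DGMod.ihomCoe_injective ?_
    refine (convActL_apply C A _ hf).trans
      ((convAct_perm C A σ p (fun i => DGMod.mem_ihom_gr.1 (hf i))).trans ?_)
    rw [map_smul, convActL_apply C A p (fun i => hf (σ i))]
  act_circ {m n l} h i μ ν r q f hν hf := by
    refine DGMod.ihomCoe_injective ?_
    refine (convActL_apply C A _ hf).trans ((convAct_circ C A h i μ hν hf).trans ?_)
    have h1 := convActL_apply C A ν (fun b => hf (innerPos h i b))
    rw [map_smul, convActL_apply C A μ (q := outerDeg h i r q) fun j => ?_]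
    · congr 2
      funext j
      split_ifs
      · exact h1.symm
      · rfl
    · by_cases hj : j = i
      · subst hj
        simp only [dif_pos, outerDeg_self]
        change DGMod.ihomCoe C.X A.U _ ∈ DGMod.homGr C.X A.U _
        rw [h1]
        exact convAct_mem C A hν (fun b => hf (innerPos h j b))
      · rw [dif_neg hj, outerDeg_ne h i r q hj]; exact hf _

/-- An element of the convolution algebra, as a linear map. -/
noncomputable def convCoe : (conv C A).U →ₗ[K] (C.X →ₗ[K] A.U) := DGMod.ihomCoe C.X A.U

variable {C A} in
theorem convCoe_injective : Function.Injective (convCoe C A) := Subtype.val_injective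

variable {C A} in
theorem convCoe_mem {f : (conv C A).U} {n : ℤ} (hf : f ∈ (conv C A).U.gr n) {p : ℤ} {x : C.X}
    (hx : x ∈ C.X.gr p) : convCoe C A f x ∈ A.U.gr (p + n) := hf p x hx

theorem conv_act {n : ℕ} (p : P.obj n) {f : Fin n → (conv C A).U} {q : Fin n → ℤ}
    (hf : ∀ i, f i ∈ (conv C A).U.gr (q i)) :
    convCoe C A ((conv C A).act p f) =
      convAct C A p (fun i => convCoe C A (f i)) q := convActL_apply C A p hf

end PAlg

/-! ### Morphisms of algebras -/

namespace PAlg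

variable {P : DGOperad K}

theorem lin_mem {A B : PAlg P} (f : A ⟶ B) {n : ℤ} {x : A.U} (h : x ∈ A.U.gr n) :
    lin f x ∈ B.U.gr n := DGMod.lin_mem _ h

theorem lin_d {A B : PAlg P} (f : A ⟶ B) (x : A.U) : lin f (A.U.d x) = B.U.d (lin f x) :=
  DGMod.lin_d _ x

theorem lin_act {A B : PAlg P} (f : A ⟶ B) {n : ℕ} (p : P.obj n) (a : Fin n → A.U) :
    lin f (A.act p a) = B.act p fun i => lin f (a i) := Hom.map_act f p a

theorem hom_ext {A B : PAlg P} {f g : A ⟶ B} (h : ∀ x, lin f x = lin g x) : f = g :=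
  Hom.ext (DGMod.hom_ext (LinearMap.ext h))

/-- A morphism of chain complexes that commutes with the operations on homogeneous elements is a
morphism of algebras. -/
def mkHom {A B : PAlg P} (φ : A.U ⟶ B.U)
    (h : ∀ {n : ℕ} (p : P.obj n) (e : Fin n → ℤ) (a : Fin n → A.U), (∀ i, a i ∈ A.U.gr (e i)) →
      DGMod.lin φ (A.act p a) = B.act p fun i => DGMod.lin φ (a i)) : A ⟶ B :=
  show Hom A B from
  { hom := φ
    map_act := fun {n} p a => by
      have : (DGMod.lin φ).compMultilinearMap (A.act p) =
          (B.act p).compLinearMap fun _ => DGMod.lin φ :=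
        DGMod.multilinearMap_ext _ fun e v hv => h p e v hv
      exact congrArg (fun M => M a) this }

/-- An isomorphism of the underlying chain complexes that commutes with the operations on
homogeneous elements is an isomorphism of algebras. -/
def mkIso {A B : PAlg P} (φ : A.U ≅ B.U)
    (h : ∀ {n : ℕ} (p : P.obj n) (e : Fin n → ℤ) (a : Fin n → A.U), (∀ i, a i ∈ A.U.gr (e i)) →
      DGMod.lin φ.hom (A.act p a) = B.act p fun i => DGMod.lin φ.hom (a i)) : A ≅ B where
  hom := mkHom φ.hom h
  inv := mkHom φ.inv fun p e b hb => by
    have h1 : ∀ x, DGMod.lin φ.hom (DGMod.lin φ.inv x) = x := fun x =>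
      LinearMap.congr_fun (congrArg DGMod.lin φ.inv_hom_id) x
    have h2 : ∀ x, DGMod.lin φ.inv (DGMod.lin φ.hom x) = x := fun x =>
      LinearMap.congr_fun (congrArg DGMod.lin φ.hom_inv_id) x
    rw [← h2 (A.act p _), h p e _ (fun i => DGMod.lin_mem φ.inv (hb i))]
    simp only [h1]
  hom_inv_id := Hom.ext φ.hom_inv_id
  inv_hom_id := Hom.ext φ.inv_hom_id

end PAlg

/-! ### Functoriality and currying of internal homs -/

namespace DGMod

theorem ihom_induction {V W : DGMod K} {p : (V →ₗ[K] W) → Prop} (f : ihom V W)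
    (h0 : p 0) (hadd : ∀ f g, p f → p g → p (f + g))
    (hh : ∀ n f, f ∈ homGr V W n → p f) : p (ihomCoe V W f) :=
  Submodule.iSup_induction _ (motive := p) f.2 hh h0 hadd

/-- The map `f ↦ h ∘ f ∘ g` of internal homs, as a linear map. -/
noncomputable def ihomMapLin {V V' W W' : DGMod K} (g : V' ⟶ V) (h : W ⟶ W') :
    ihom V W →ₗ[K] ihom V' W' :=
  LinearMap.codRestrict (homTotal V' W')
    { toFun := fun f => lin h ∘ₗ ihomCoe V W f ∘ₗ lin g
      map_add' := fun f f' => by rw [map_add, LinearMap.add_comp, LinearMap.comp_add]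
      map_smul' := fun c f => by
        rw [map_smul, LinearMap.smul_comp, LinearMap.comp_smul]; rfl } fun f => by
    refine ihom_induction (p := fun f => lin h ∘ₗ f ∘ₗ lin g ∈ homTotal V' W') f ?_
      (fun f f' hf hf' => ?_) fun n f hf => ?_
    · rw [LinearMap.zero_comp, LinearMap.comp_zero]; exact zero_mem _
    · rw [LinearMap.add_comp, LinearMap.comp_add]; exact add_mem hf hf'
    · exact Submodule.mem_iSup_of_mem n fun p x hx => lin_mem h (hf p _ (lin_mem g hx))

/-- The map `f ↦ h ∘ f ∘ g` of internal homs. -/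
noncomputable def ihomMap {V V' W W' : DGMod K} (g : V' ⟶ V) (h : W ⟶ W') :
    ihom V W ⟶ ihom V' W' :=
  show Hom _ _ from
  { lin := ihomMapLin g h
    map_mem := fun {n f} hf p x hx => lin_mem h (hf p _ (lin_mem g hx))
    map_d := fun f => by
      refine LinearMap.congr_fun (f := ihomMapLin g h ∘ₗ (ihom V W).d)
        (g := (ihom V' W').d ∘ₗ ihomMapLin g h)
        (linearMap_ext (ihom V W) fun n f hf => ihomCoe_injective ?_) f
      have hf' : lin h ∘ₗ ihomCoe V W f ∘ₗ lin g ∈ homGr V' W' n :=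
        fun p x hx => lin_mem h (hf p _ (lin_mem g hx))
      change lin h ∘ₗ homD V W (ihomCoe V W f) ∘ₗ lin g =
        homD V' W' (lin h ∘ₗ ihomCoe V W f ∘ₗ lin g)
      rw [homD_of_mem hf', homD_of_mem (mem_ihom_gr.1 hf)]
      ext x
      simp [lin_d] }

/-- Evaluation of an element of `[V, [W, X]]` on a tensor. -/
noncomputable def ihomUncurry (V W X : DGMod K) : ihom V (ihom W X) →ₗ[K] ihom (tensor V W) X :=
  LinearMap.codRestrict (homTotal (tensor V W) X)
    ((TensorProduct.lift.equiv (RingHom.id K) V W X).toLinearMap ∘ₗ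
      (LinearMap.llcomp K V (ihom W X) (W →ₗ[K] X) (ihomCoe W X)) ∘ₗ ihomCoe V (ihom W X))
    fun f => by
      refine ihom_induction (p := fun f =>
        ((TensorProduct.lift.equiv (RingHom.id K) V W X).toLinearMap ∘ₗ
        (LinearMap.llcomp K V (ihom W X) (W →ₗ[K] X) (ihomCoe W X))) f ∈
          homTotal (tensor V W) X) f ?_ (fun f g hf hg => ?_) fun n f hf => ?_
      · rw [map_zero]; exact zero_mem _
      · rw [map_add]; exact add_mem hf hg
      · refine Submodule.mem_iSup_of_mem n fun p x hx => ?_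
        refine tensor_mem _ _ (fun p q v w hv hw hpq => ?_) hx
        have := (mem_ihom_gr.1 (hf p v hv)) q w hw
        rw [show q + (p + n) = p + q + n by ring, hpq] at this
        exact this

theorem curry_mem {V W X : DGMod K} (f : ihom (tensor V W) X) (v : V) :
    TensorProduct.curry (ihomCoe _ _ f) v ∈ homTotal W X := by
  refine ihom_induction (p := fun f => TensorProduct.curry f v ∈ homTotal W X) f ?_
    (fun f g hf hg => ?_) fun n f hf => ?_
  · exact zero_mem _
  · exact add_mem hf hg
  · refine V.homogeneous_induction (p := fun v => TensorProduct.curry f v ∈ homTotal W X) v ?_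
      (fun v v' h h' => ?_) fun m v hv => ?_
    · rw [map_zero]; exact zero_mem _
    · rw [map_add]; exact add_mem h h'
    · refine Submodule.mem_iSup_of_mem (m + n) fun q w hw => ?_
      have := hf (m + q) (v ⊗ₜ[K] w) (tmul_mem hv hw rfl)
      rw [show m + q + n = q + (m + n) by ring] at this
      exact this

/-- The linear map `x ↦ (y ↦ f (x ⊗ y))`. -/
noncomputable def ihomCurryFun (V W X : DGMod K) (f : ihom (tensor V W) X) : V →ₗ[K] ihom W X :=
  LinearMap.codRestrict (homTotal W X) (TensorProduct.curry (ihomCoe _ _ f)) (curry_mem f)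

theorem ihomCurryFun_mem (V W X : DGMod K) {f : ihom (tensor V W) X} {n : ℤ}
    (hf : f ∈ (ihom (tensor V W) X).gr n) : ihomCurryFun V W X f ∈ homGr V (ihom W X) n := by
  intro m v hv q w hw
  have := hf (m + q) (v ⊗ₜ[K] w) (tmul_mem hv hw rfl)
  rw [show m + q + n = q + (m + n) by ring] at this
  exact this

/-- The map `f ↦ (x ↦ (y ↦ f (x ⊗ y)))`. -/
noncomputable def ihomCurry (V W X : DGMod K) : ihom (tensor V W) X →ₗ[K] ihom V (ihom W X) :=
  LinearMap.codRestrict (homTotal V (ihom W X))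
    { toFun := ihomCurryFun V W X
      map_add' f g := rfl
      map_smul' c f := rfl } fun f => by
    refine homogeneous_induction _ (p := fun f => ihomCurryFun V W X f ∈
      homTotal V (ihom W X)) f ?_ (fun f g hf hg => ?_) fun n f hf => ?_
    · exact zero_mem _
    · exact add_mem hf hg
    · exact Submodule.mem_iSup_of_mem n (ihomCurryFun_mem V W X hf)

/-- `[V ⊗ W, X] ≅ [V, [W, X]]`. -/
noncomputable def ihomCurryIso (V W X : DGMod K) : ihom (tensor V W) X ≅ ihom V (ihom W X) :=
  isoOfEquiv (LinearEquiv.ofLinearMap (ihomCurry V W X) (ihomUncurry V W X)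
      (LinearMap.ext fun f => ihomCoe_injective (LinearMap.ext fun v =>
        ihomCoe_injective (LinearMap.ext fun w => rfl)))
      (LinearMap.ext fun f => ihomCoe_injective (TensorProduct.ext' fun v w => rfl)))
    (fun hf => ihomCurryFun_mem V W X hf)
    (fun f => by
      refine LinearMap.congr_fun (f := (ihomCurry V W X) ∘ₗ (ihom (tensor V W) X).d)
        (g := (ihom V (ihom W X)).d ∘ₗ ihomCurry V W X) (linearMap_ext _ fun n f hf =>
          ihomCoe_injective (linearMap_ext _ fun p v hv => ihomCoe_injective
            (linearMap_ext _ fun q w hw => ?_))) f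
      have hc : ihomCoe V (ihom W X) (ihomCurry V W X f) ∈ homGr V (ihom W X) n :=
        ihomCurryFun_mem V W X hf
      have e1 : ihomCoe W X (ihomCoe V (ihom W X)
          (((ihomCurry V W X) ∘ₗ (ihom (tensor V W) X).d) f) v) w =
          homD (tensor V W) X (ihomCoe _ _ f) (v ⊗ₜ[K] w) := rfl
      have e2 : ihomCoe V (ihom W X) (((ihom V (ihom W X)).d ∘ₗ ihomCurry V W X) f) =
        homD V (ihom W X) (ihomCoe _ _ (ihomCurry V W X f)) := rfl
      rw [e1, e2, homD_of_mem hc, homD_of_mem (mem_ihom_gr.1 hf), LinearMap.sub_apply,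
        LinearMap.sub_apply, map_sub, LinearMap.sub_apply]
      have e3 : ihomCoe W X (((ihom W X).d ∘ₗ ihomCoe _ _ (ihomCurry V W X f)) v) =
        homD W X (ihomCoe W X (ihomCoe _ _ (ihomCurry V W X f) v)) := rfl
      rw [e3, homD_of_mem (mem_ihom_gr.1 (hc p v hv))]
      have e4 : tensorD V W (v ⊗ₜ[K] w) = _ := tensorD_tmul V W w hv
      simp only [LinearMap.smul_apply, LinearMap.comp_apply, map_smul, LinearMap.sub_apply]
      rw [e4, map_add, map_smul, zpow_add₀ (by simp), smul_add, smul_smul, sub_sub, add_comm,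
        mul_comm]
      rfl)

/-- `[K, V] ≅ V`. -/
noncomputable def ihomUnitIso (V : DGMod K) : ihom (unit K) V ≅ V :=
  isoOfEquiv (LinearEquiv.ofLinearMap (LinearMap.applyₗ (1 : K) ∘ₗ ihomCoe (unit K) V)
      (LinearMap.codRestrict (homTotal (unit K) V)
        (LinearMap.ringLmapEquivSelf K K V).symm.toLinearMap
        fun v => by
          refine V.homogeneous_induction (p := fun v => (LinearMap.ringLmapEquivSelf K K V).symm v ∈
            homTotal (unit K) V) v ?_ (fun f g hf hg => ?_) fun n v hv => ?_
          · rw [map_zero]; exact zero_mem _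
          · rw [map_add]; exact add_mem hf hg
          · refine Submodule.mem_iSup_of_mem n fun p c hc => ?_
            rcases unit_mem hc with rfl | rfl
            · rw [zero_add]; exact Submodule.smul_mem _ _ hv
            · rw [map_zero]; exact zero_mem _)
      (LinearMap.ext fun v => one_smul K v)
      (LinearMap.ext fun f => ihomCoe_injective (LinearMap.ext_ring (one_smul K _))))
    (fun {n f} hf => by
      have := hf 0 (1 : K) (mem_unit 1)
      rwa [zero_add] at this)
    (fun f => by
      change (V.d (ihomCoe (unit K) V f (1 : K)) - V.koszul 1 (ihomCoe (unit K) V f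
        ((unit K).koszul 1 (0 : K)))) = V.d (ihomCoe (unit K) V f (1 : K))
      rw [map_zero, map_zero, map_zero, sub_zero])

end DGMod

namespace UCocom

theorem lin_mem {C D : UCocom K} (f : C ⟶ D) {n : ℤ} {x : C.X} (h : x ∈ C.X.gr n) :
    lin f x ∈ D.X.gr n := DGMod.lin_mem f.hom.hom h

theorem lin_d {C D : UCocom K} (f : C ⟶ D) (x : C.X) : lin f (C.X.d x) = D.X.d (lin f x) :=
  DGMod.lin_d f.hom.hom x

theorem pairSign_add_left {n : ℕ} (e e' q : Fin n → ℤ) :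
    pairSign K (fun i => e i + e' i) q = pairSign K e q * pairSign K e' q := by
  simp only [pairSign_eq, add_mul, zpow_add₀ (show (-1 : K) ≠ 0 by simp), Finset.prod_mul_distrib]

theorem pairSign_add_right {n : ℕ} (e q q' : Fin n → ℤ) :
    pairSign K e (fun i => q i + q' i) = pairSign K e q * pairSign K e q' := by
  simp only [pairSign_eq, Finset.sum_add_distrib, mul_add, zpow_add₀ (show (-1 : K) ≠ 0 by simp),
    Finset.prod_mul_distrib]

end UCocom

/-! ### The coaction by convolution algebras -/

namespace PAlg

variable {P : DGOperad K}

/-- Functoriality of the convolution algebra. -/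
noncomputable def convMap {C C' : UCocom K} {A A' : PAlg P} (g : C' ⟶ C) (h : A ⟶ A') :
    conv C A ⟶ conv C' A' :=
  mkHom (DGMod.ihomMap g.hom.hom (Hom.hom h)) fun {n} p q f hf => convCoe_injective <| by
    have hf' : ∀ i, DGMod.lin (DGMod.ihomMap g.hom.hom (Hom.hom h)) (f i) ∈
      (conv C' A').U.gr (q i) := fun i => DGMod.lin_mem _ (hf i)
    refine Eq.trans ?_ (conv_act C' A' p hf').symm
    have e1 : convCoe C' A' (DGMod.lin (DGMod.ihomMap g.hom.hom (Hom.hom h)) ((conv C A).act p f)) =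
      lin h ∘ₗ convCoe C A ((conv C A).act p f) ∘ₗ UCocom.lin g := rfl
    refine e1.trans ?_
    rw [conv_act C A p hf, convAct_eq_pull, convAct_eq_pull]
    refine DGMod.linearMap_ext _ fun e x hx => ?_
    rw [LinearMap.comp_apply, LinearMap.comp_apply, UCocom.pull_lin, ← LinearMap.comp_apply,
      ← UCocom.pull_compMultilinearMap]
    refine C'.pull_congr hx fun d u hu _ => ?_
    rw [LinearMap.compMultilinearMap_apply, MultilinearMap.compLinearMap_apply,
      convMulti_apply C' A' _ _ _ hu, convMulti_apply C A p _ q (e := d)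
      (fun i => UCocom.lin_mem g (hu i)), map_smul, lin_act]
    rfl

theorem convCoe_convMap {C C' : UCocom K} {A A' : PAlg P} (g : C' ⟶ C) (h : A ⟶ A')
    (f : (conv C A).U) : convCoe C' A' (lin (convMap g h) f) =
      lin h ∘ₗ convCoe C A f ∘ₗ UCocom.lin g := rfl

/-- `[C ⊗ D, A] ≅ [C, [D, A]]`. -/
noncomputable def convAssocIso (C D : UCocom K) (A : PAlg P) :
    conv (C ⊗ D) A ≅ conv C (conv D A) :=
  mkIso (DGMod.ihomCurryIso C.X D.X A.U) fun {n} p q f hf => convCoe_injective <| by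
    let cf : Fin n → (C.X →ₗ[K] (conv D A).U) := fun i => DGMod.ihomCurryFun C.X D.X A.U (f i)
    have hcf : ∀ i, cf i ∈ DGMod.homGr C.X (conv D A).U (q i) :=
      fun i => DGMod.ihomCurryFun_mem C.X D.X A.U (hf i)
    refine Eq.trans ?_ (conv_act C (conv D A) p (q := q) hcf).symm
    change _ = convAct C (conv D A) p cf q
    refine LinearMap.ext fun x => convCoe_injective (LinearMap.ext fun y => ?_)
    have e1 : convCoe D A (convCoe C (conv D A)
        (DGMod.lin (DGMod.ihomCurryIso C.X D.X A.U).hom ((conv (C ⊗ D) A).act p f)) x) y =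
        convCoe (C ⊗ D) A ((conv (C ⊗ D) A).act p f) (x ⊗ₜ[K] y) := rfl
    refine e1.trans ?_
    rw [conv_act _ _ p hf, convAct_eq_pull, convAct_eq_pull]
    let B : MultilinearMap K (fun _ : Fin n => (C.X : Type u))
        (MultilinearMap K (fun _ : Fin n => (D.X : Type u)) A.U) :=
      C.X.multiElim fun e => UCocom.pairSign K e q •
        (convMultiL D A p fun i => e i + q i).compLinearMap cf
    have hB : ∀ {e : Fin n → ℤ} {u : Fin n → C.X}, (∀ i, u i ∈ C.X.gr (e i)) →
        B u = UCocom.pairSign K e q • convMulti D A p (fun i => convCoe D A (cf i (u i)))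
          (fun i => e i + q i) := fun hu => C.X.multiElim_of_mem _ hu
    rw [UCocom.pull_tensor _ B (fun e d u v hu hv => ?_) x y]
    · have : (D.pull n).compMultilinearMap B =
          (convCoe D A).compMultilinearMap (convMulti C (conv D A) p cf q) :=
        DGMod.multilinearMap_ext _ fun e u hu => by
          rw [LinearMap.compMultilinearMap_apply, LinearMap.compMultilinearMap_apply, hB hu,
            map_smul, ← convAct_eq_pull, convMulti_apply C (conv D A) p cf q hu, map_smul,
            conv_act D A p (fun i => hcf i _ _ (hu i))]
      rw [this, UCocom.pull_compMultilinearMap]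
      rfl
    · rw [hB hu, _root_.smul_apply, convMulti_apply D A _ _ _ hv,
        convMulti_apply (C ⊗ D) A p _ q (e := fun i => e i + d i)
          (fun i => DGMod.tmul_mem (hu i) (hv i) rfl), smul_smul, smul_smul,
        UCocom.pairSign_add_left, UCocom.pairSign_add_right]
      congr 1
      ring

theorem convCoe_convAssocIso (C D : UCocom K) (A : PAlg P) (f : (conv (C ⊗ D) A).U) (x : C.X)
    (y : D.X) : convCoe D A (convCoe C (conv D A) (lin (convAssocIso C D A).hom f) x) y =
      convCoe (C ⊗ D) A f (x ⊗ₜ[K] y) := rfl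

/-- `[K, A] ≅ A`. -/
noncomputable def convUnitIso (A : PAlg P) : conv (𝟙_ (UCocom K)) A ≅ A :=
  mkIso (DGMod.ihomUnitIso A.U) fun {n} p q f hf => by
    have e1 : DGMod.lin (DGMod.ihomUnitIso A.U).hom ((conv (𝟙_ (UCocom K)) A).act p f) =
      convCoe (𝟙_ (UCocom K)) A ((conv (𝟙_ (UCocom K)) A).act p f) (1 : K) := rfl
    refine e1.trans ?_
    rw [conv_act _ A p hf, convAct_eq_pull]
    refine ((𝟙_ (UCocom K)).pull_grouplike (g := (1 : K)) rfl ?_ _).trans ?_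
    · exact TensorProduct.lid_symm_apply (1 : K)
    · refine (convMulti_apply (𝟙_ (UCocom K)) A p _ q (e := fun _ => 0)
        fun i => DGMod.mem_unit 1).trans ?_
      rw [UCocom.pairSign_eq]
      simp only [zero_mul, zpow_zero, Finset.prod_const_one, one_smul]
      rfl

theorem lin_convUnitIso (A : PAlg P) (f : (conv (𝟙_ (UCocom K)) A).U) :
    lin (convUnitIso A).hom f = convCoe (𝟙_ (UCocom K)) A f (1 : K) := rfl

/-- The left coaction of coalgebras on algebras by convolution algebras. -/
noncomputable instance convAction : MonoidalLeftAction (UCocom K)ᵒᵖ (PAlg P) where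
  actionObj C A := conv C.unop A
  actionHomLeft g A := convMap g.unop (𝟙 A)
  actionHomRight C _ _ h := convMap (𝟙 C.unop) h
  actionHom g h := convMap g.unop h
  actionAssocIso C D A := convAssocIso C.unop D.unop A
  actionUnitIso A := convUnitIso A
  actionHom_def _ _ := rfl
  actionHomRight_id _ _ := rfl
  id_actionHomLeft _ _ := rfl
  actionHom_comp _ _ _ _ := rfl
  actionAssocIso_hom_naturality {C₁ C₂ C₃ C₄ A B} f g h := hom_ext fun φ => convCoe_injective <|
    LinearMap.ext fun x => convCoe_injective <| LinearMap.ext fun y => rfl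
  actionUnitIso_hom_naturality _ := rfl
  whiskerLeft_actionHomLeft C D D' f A := by
    rw [← Category.assoc, Iso.eq_comp_inv]; rfl
  whiskerRight_actionHomLeft {C D} E f A := by
    rw [← Category.assoc, Iso.eq_comp_inv]; rfl
  associator_actionHom _ _ _ _ := rfl
  leftUnitor_actionHom C A := hom_ext fun f => convCoe_injective <| LinearMap.ext fun x => rfl
  rightUnitor_actionHom C A := hom_ext fun f => convCoe_injective <| LinearMap.ext fun x => rfl

end PAlg

/-! ### Projections onto homogeneous components -/

namespace DGMod

theorem lin_proj {V W : DGMod K} (f : V ⟶ W) (n : ℤ) (x : V) :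
    lin f (V.proj n x) = W.proj n (lin f x) := by
  refine LinearMap.congr_fun (f := lin f ∘ₗ V.proj n) (g := W.proj n ∘ₗ lin f)
    (V.linearMap_ext fun m x hx => ?_) x
  rw [LinearMap.comp_apply, LinearMap.comp_apply, proj, proj, V.elim_of_mem _ hx,
    W.elim_of_mem _ (lin_mem f hx)]
  split_ifs
  · rfl
  · rw [LinearMap.zero_apply, LinearMap.zero_apply, map_zero]

theorem proj_proj (V : DGMod K) (m n : ℤ) (x : V) :
    V.proj m (V.proj n x) = if m = n then V.proj n x else 0 := by
  rw [proj, V.elim_of_mem _ (V.proj_mem n x)]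
  by_cases h : m = n
  · subst h; simp
  · rw [if_neg h, if_neg fun h' => h h'.symm]; rfl

theorem mem_gr_iff (V : DGMod K) {n : ℤ} {x : V} : x ∈ V.gr n ↔ V.proj n x = x :=
  ⟨V.proj_of_mem, fun h => h ▸ V.proj_mem n x⟩

theorem proj_d (V : DGMod K) (n : ℤ) (x : V) :
    V.proj (n - 1) (V.d (V.proj n x)) = V.d (V.proj n x) :=
  V.proj_of_mem (V.d_mem (V.proj_mem n x))

variable {M : Type u} [AddCommGroup M] [Module K M]

/-- A chain complex given by the projections `pr n` onto its homogeneous components. -/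
def ofProj (d : M →ₗ[K] M) (pr : ℤ → M →ₗ[K] M)
    (hpr : ∀ m n x, pr m (pr n x) = if m = n then pr n x else 0)
    (hsup : ∀ x, x ∈ ⨆ n, LinearMap.range (pr n))
    (hd : ∀ n x, pr (n - 1) (d (pr n x)) = d (pr n x)) (hdd : ∀ x, d (d x) = 0) : DGMod K where
  carrier := M
  gr n := LinearMap.range (pr n)
  isInternal := by
    refine DirectSum.isInternal_submodule_of_iSupIndep_of_iSup_eq_top ?_
      (eq_top_iff.2 fun x _ => hsup x)
    refine iSupIndep_def.2 fun i => Submodule.disjoint_def.2 fun x hx hx' => ?_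
    obtain ⟨y, rfl⟩ := hx
    have h : (⨆ j, ⨆ (_ : j ≠ i), LinearMap.range (pr j)) ≤ LinearMap.ker (pr i) := by
      refine iSup₂_le fun j hj => ?_
      rintro _ ⟨z, rfl⟩
      rw [LinearMap.mem_ker, hpr, if_neg hj.symm]
    have := LinearMap.mem_ker.1 (h hx')
    rwa [hpr, if_pos rfl] at this
  d := d
  d_mem {n x} hx := by
    obtain ⟨y, rfl⟩ := hx
    exact ⟨_, hd n y⟩
  d_d := hdd

theorem ofProj_proj {d : M →ₗ[K] M} {pr : ℤ → M →ₗ[K] M}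
    {hpr : ∀ m n x, pr m (pr n x) = if m = n then pr n x else 0}
    {hsup : ∀ x, x ∈ ⨆ n, LinearMap.range (pr n)}
    {hd : ∀ n x, pr (n - 1) (d (pr n x)) = d (pr n x)} {hdd : ∀ x, d (d x) = 0} (n : ℤ) :
    (ofProj d pr hpr hsup hd hdd).proj n = pr n := by
  refine linearMap_ext _ fun m x hx => ?_
  rw [proj, elim_of_mem _ _ hx]
  obtain ⟨y, rfl⟩ := hx
  refine Eq.trans ?_ (hpr n m y).symm
  by_cases h : m = n
  · subst h; rw [if_pos rfl, if_pos rfl]; rfl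
  · rw [if_neg h, if_neg fun h' => h h'.symm]; rfl

end DGMod

/-! ### Free algebras -/

namespace PAlg

variable (P : DGOperad K) (V : DGMod K)

/-- Expressions in elements of `V`, the operations of `P`, the vector space operations, the
differential and the projections onto homogeneous components. -/
inductive Term : Type u
  | var (v : V.carrier) : Term
  | zero : Term
  | add (s t : Term) : Term
  | smul (c : K) (t : Term) : Term
  | op (n : ℕ) (p : (P.obj n).carrier) (t : Fin n → Term) : Term
  | d (t : Term) : Term
  | proj (n : ℤ) (t : Term) : Term

variable {P V}

/-- The value of an expression in an algebra. -/
noncomputable def Term.eval (B : PAlg P) (g : V ⟶ B.U) : Term P V → B.U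
  | .var v => DGMod.lin g v
  | .zero => 0
  | .add s t => s.eval B g + t.eval B g
  | .smul c t => c • t.eval B g
  | .op _ p t => B.act p fun i => (t i).eval B g
  | .d t => B.U.d (t.eval B g)
  | .proj n t => B.U.proj n (t.eval B g)

variable (P V) in
/-- Expressions are identified when they have the same value in all algebras. -/
def termSetoid : Setoid (Term P V) where
  r s t := ∀ (B : PAlg P) (g : V ⟶ B.U), s.eval B g = t.eval B g
  iseqv := ⟨fun _ _ _ => rfl, fun h B g => (h B g).symm, fun h h' B g => (h B g).trans (h' B g)⟩

variable (P V) in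
/-- The underlying set of the free algebra. -/
def FreeCarrier : Type u := Quotient (termSetoid P V)

namespace FreeCarrier

/-- The class of an expression. -/
def mk (t : Term P V) : FreeCarrier P V := Quotient.mk (termSetoid P V) t

/-- The value of an element of the free algebra. -/
noncomputable def ev (B : PAlg P) (g : V ⟶ B.U) : FreeCarrier P V → B.U :=
  Quotient.lift (Term.eval B g) fun _ _ h => h B g

@[simp] theorem ev_mk (B : PAlg P) (g : V ⟶ B.U) (t : Term P V) : ev B g (mk t) = t.eval B g := rfl

theorem ext {x y : FreeCarrier P V} (h : ∀ (B : PAlg P) (g : V ⟶ B.U), ev B g x = ev B g y) :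
    x = y := by
  induction x using Quotient.ind with | _ s =>
  induction y using Quotient.ind with | _ t =>
  exact Quotient.sound h

noncomputable instance : Zero (FreeCarrier P V) := ⟨mk .zero⟩
noncomputable instance : Add (FreeCarrier P V) := ⟨fun x y => mk (.add x.out y.out)⟩
noncomputable instance : SMul K (FreeCarrier P V) := ⟨fun c x => mk (.smul c x.out)⟩
noncomputable instance : Neg (FreeCarrier P V) := ⟨fun x => (-1 : K) • x⟩

theorem ev_out (B : PAlg P) (g : V ⟶ B.U) (x : FreeCarrier P V) :
    (Quotient.out x).eval B g = ev B g x :=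
  congrArg (ev B g) (Quotient.out_eq x)

@[simp] theorem ev_zero (B : PAlg P) (g : V ⟶ B.U) : ev B g 0 = 0 := rfl

@[simp] theorem ev_add (B : PAlg P) (g : V ⟶ B.U) (x y : FreeCarrier P V) :
    ev B g (x + y) = ev B g x + ev B g y :=
  congrArg₂ (· + ·) (ev_out B g x) (ev_out B g y)

@[simp] theorem ev_smul (B : PAlg P) (g : V ⟶ B.U) (c : K) (x : FreeCarrier P V) :
    ev B g (c • x) = c • ev B g x :=
  congrArg (c • ·) (ev_out B g x)

@[simp] theorem ev_neg (B : PAlg P) (g : V ⟶ B.U) (x : FreeCarrier P V) :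
    ev B g (-x) = -ev B g x :=
  (ev_smul B g (-1) x).trans (by rw [neg_smul, one_smul])

noncomputable instance : AddCommGroup (FreeCarrier P V) where
  add_assoc x y z := ext fun B g => by simp [add_assoc]
  zero_add x := ext fun B g => by simp
  add_zero x := ext fun B g => by simp
  add_comm x y := ext fun B g => by simp [add_comm]
  neg_add_cancel x := ext fun B g => by simp
  nsmul := nsmulRec
  zsmul := zsmulRec

noncomputable instance : Module K (FreeCarrier P V) where
  one_smul x := ext fun B g => by simp
  mul_smul c c' x := ext fun B g => by simp [mul_smul]
  smul_zero c := ext fun B g => by simp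
  smul_add c x y := ext fun B g => by simp
  add_smul c c' x := ext fun B g => by simp [add_smul]
  zero_smul x := ext fun B g => by simp

/-- `FreeCarrier.ev`, as a linear map. -/
noncomputable def evₗ (B : PAlg P) (g : V ⟶ B.U) : FreeCarrier P V →ₗ[K] B.U where
  toFun := ev B g
  map_add' := ev_add B g
  map_smul' := ev_smul B g

/-- The differential of the free algebra. -/
noncomputable def d : FreeCarrier P V →ₗ[K] FreeCarrier P V where
  toFun x := mk (.d x.out)
  map_add' x y := ext fun B g => by simp [Term.eval, ev_out]
  map_smul' c x := ext fun B g => by simp [Term.eval, ev_out]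

@[simp] theorem ev_d (B : PAlg P) (g : V ⟶ B.U) (x : FreeCarrier P V) :
    ev B g (d x) = B.U.d (ev B g x) :=
  congrArg B.U.d (ev_out B g x)

/-- The projections of the free algebra onto its homogeneous components. -/
noncomputable def pr (n : ℤ) : FreeCarrier P V →ₗ[K] FreeCarrier P V where
  toFun x := mk (.proj n x.out)
  map_add' x y := ext fun B g => by simp [Term.eval, ev_out]
  map_smul' c x := ext fun B g => by simp [Term.eval, ev_out]

@[simp] theorem ev_pr (B : PAlg P) (g : V ⟶ B.U) (n : ℤ) (x : FreeCarrier P V) :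
    ev B g (pr n x) = B.U.proj n (ev B g x) :=
  congrArg (B.U.proj n) (ev_out B g x)

/-- The operations of the free algebra. -/
noncomputable def opFun {n : ℕ} (p : P.obj n) (a : Fin n → FreeCarrier P V) : FreeCarrier P V :=
  mk (.op n p fun i => (a i).out)

@[simp] theorem ev_opFun (B : PAlg P) (g : V ⟶ B.U) {n : ℕ} (p : P.obj n)
    (a : Fin n → FreeCarrier P V) : ev B g (opFun p a) = B.act p fun i => ev B g (a i) :=
  congrArg (B.act p) (funext fun i => ev_out B g (a i))

theorem ev_update (B : PAlg P) (g : V ⟶ B.U) {n : ℕ} [DecidableEq (Fin n)]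
    (a : Fin n → FreeCarrier P V) (i : Fin n)
    (x : FreeCarrier P V) : (fun j => ev B g (Function.update a i x j)) =
      Function.update (fun j => ev B g (a j)) i (ev B g x) :=
  funext fun j => Function.apply_update (fun _ => ev B g) a i x j

/-- The operations of the free algebra, as multilinear maps. -/
noncomputable def act {n : ℕ} :
    P.obj n →ₗ[K] MultilinearMap K (fun _ : Fin n => FreeCarrier P V) (FreeCarrier P V) where
  toFun p :=
    { toFun := opFun p
      map_update_add' a i x y := ext fun B g => by simp [ev_update]
      map_update_smul' a i c x := ext fun B g => by simp [ev_update] }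
  map_add' p p' := MultilinearMap.ext fun a => ext fun B g => by
    change ev B g (opFun _ a) = ev B g (opFun _ a + opFun _ a)
    simp
  map_smul' c p := MultilinearMap.ext fun a => ext fun B g => by
    change ev B g (opFun _ a) = ev B g (c • opFun _ a)
    simp

@[simp] theorem ev_act (B : PAlg P) (g : V ⟶ B.U) {n : ℕ} (p : P.obj n)
    (a : Fin n → FreeCarrier P V) : ev B g (act p a) = B.act p fun i => ev B g (a i) :=
  ev_opFun B g p a

theorem ev_mem {x : FreeCarrier P V} {n : ℤ} (hx : x ∈ LinearMap.range (pr (P := P) (V := V) n))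
    (B : PAlg P) (g : V ⟶ B.U) : ev B g x ∈ B.U.gr n := by
  obtain ⟨y, rfl⟩ := hx
  rw [ev_pr]
  exact B.U.proj_mem n _

theorem mem_range {x : FreeCarrier P V} {n : ℤ}
    (h : ∀ (B : PAlg P) (g : V ⟶ B.U), ev B g x ∈ B.U.gr n) :
    x ∈ LinearMap.range (pr (P := P) (V := V) n) :=
  ⟨x, ext fun B g => by rw [ev_pr, B.U.proj_of_mem (h B g)]⟩

/-- Every expression is a sum of homogeneous elements; this uses that operations applied to sums of
homogeneous elements can be expanded. -/
theorem mk_mem (t : Term P V) : mk t ∈ ⨆ n, LinearMap.range (pr (P := P) (V := V) n) := by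
  induction t with
  | var v =>
    refine V.homogeneous_induction
      (p := fun v => mk (.var v) ∈ ⨆ n, LinearMap.range (pr (P := P) (V := V) n)) v ?_ ?_ ?_
    · have : mk (P := P) (V := V) (.var 0) = 0 := ext fun B g => by simp [Term.eval]
      rw [this]; exact zero_mem _
    · intro v w hv hw
      have : mk (P := P) (.var (v + w)) = mk (.var v) + mk (.var w) :=
        ext fun B g => by simp [Term.eval]
      rw [this]; exact add_mem hv hw
    · exact fun n v hv => Submodule.mem_iSup_of_mem n (mem_range fun B g => DGMod.lin_mem g hv)
  | zero => exact zero_mem _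
  | add s t hs ht =>
    have : mk (.add s t) = mk s + mk t := ext fun B g => by simp [Term.eval]
    rw [this]; exact add_mem hs ht
  | smul c t ht =>
    have : mk (.smul c t) = c • mk t := ext fun B g => by simp [Term.eval]
    rw [this]; exact Submodule.smul_mem _ c ht
  | op n p t ht =>
    have : mk (.op n p t) = act p fun i => mk (t i) := ext fun B g => by simp [Term.eval]
    rw [this]
    choose f hf hft using fun i => (Submodule.mem_iSup_iff_exists_finsupp _ _).1 (ht i)
    have hft' : (fun i => mk (t i)) = fun i => ∑ j ∈ (f i).support, f i j :=
      funext fun i => (hft i).symm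
    rw [hft', MultilinearMap.map_sum_finset]
    refine Submodule.sum_mem _ fun r _ => ?_
    refine (P.obj n).homogeneous_induction (p := fun p => act p (fun i => f i (r i)) ∈
      ⨆ n, LinearMap.range (pr (P := P) (V := V) n)) p ?_ ?_ ?_
    · rw [map_zero]; exact zero_mem _
    · intro p p' hp hp'
      rw [map_add]; exact add_mem hp hp'
    · intro q p hp
      refine Submodule.mem_iSup_of_mem (q + ∑ i, r i) (mem_range fun B g => ?_)
      rw [ev_act]
      exact B.act_mem hp fun i => ev_mem (hf i (r i)) B g
  | d t ht =>
    have : mk (.d t) = d (mk t) := ext fun B g => by simp [Term.eval]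
    rw [this]
    refine Submodule.iSup_induction _ (motive := fun x => d x ∈
      ⨆ n, LinearMap.range (pr (P := P) (V := V) n)) ht ?_ ?_ ?_
    · intro n x hx
      exact Submodule.mem_iSup_of_mem (n - 1) (mem_range fun B g => by
        rw [ev_d]; exact B.U.d_mem (ev_mem hx B g))
    · rw [map_zero]; exact zero_mem _
    · intro x y hx hy
      rw [map_add]; exact add_mem hx hy
  | proj n t _ =>
    exact Submodule.mem_iSup_of_mem n (mem_range fun B g => B.U.proj_mem n _)

end FreeCarrier

variable (P V) in
/-- The chain complex underlying the free algebra. -/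
noncomputable def freeU : DGMod K :=
  DGMod.ofProj (M := FreeCarrier P V) FreeCarrier.d FreeCarrier.pr
    (fun m n x => FreeCarrier.ext fun B g => by
      rw [FreeCarrier.ev_pr, FreeCarrier.ev_pr, DGMod.proj_proj]; split_ifs <;> simp)
    (fun x => Quotient.ind (motive := fun x => x ∈ ⨆ n, LinearMap.range (FreeCarrier.pr n))
      FreeCarrier.mk_mem x)
    (fun n x => FreeCarrier.ext fun B g => by simp [DGMod.proj_d])
    (fun x => FreeCarrier.ext fun B g => by simp [DGMod.d_d])

theorem freeU_proj (n : ℤ) : (freeU P V).proj n = FreeCarrier.pr n := by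
  unfold freeU
  exact DGMod.ofProj_proj n

/-- The value of an element of the free algebra, as a linear map. -/
noncomputable def freeEv (B : PAlg P) (g : V ⟶ B.U) : freeU P V →ₗ[K] B.U := FreeCarrier.evₗ B g

variable (P V) in
/-- The operations of the free algebra. -/
noncomputable def freeAct {n : ℕ} :
    P.obj n →ₗ[K] MultilinearMap K (fun _ : Fin n => (freeU P V : Type u)) (freeU P V) :=
  FreeCarrier.act

theorem freeU_ext {x y : freeU P V}
    (h : ∀ (B : PAlg P) (g : V ⟶ B.U), freeEv B g x = freeEv B g y) :
    x = y := FreeCarrier.ext h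

theorem freeEv_act (B : PAlg P) (g : V ⟶ B.U) {n : ℕ} (p : P.obj n) (a : Fin n → freeU P V) :
    freeEv B g (freeAct P V p a) = B.act p fun i => freeEv B g (a i) := FreeCarrier.ev_act B g p a

theorem freeEv_d (B : PAlg P) (g : V ⟶ B.U) (x : freeU P V) :
    freeEv B g ((freeU P V).d x) = B.U.d (freeEv B g x) := FreeCarrier.ev_d B g x

theorem freeEv_mem {x : freeU P V} {n : ℤ} (hx : x ∈ (freeU P V).gr n) (B : PAlg P)
    (g : V ⟶ B.U) : freeEv B g x ∈ B.U.gr n := FreeCarrier.ev_mem hx B g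

theorem mem_freeU {x : freeU P V} {n : ℤ}
    (h : ∀ (B : PAlg P) (g : V ⟶ B.U), freeEv B g x ∈ B.U.gr n) : x ∈ (freeU P V).gr n :=
  FreeCarrier.mem_range h

variable (P V) in
/-- The free algebra on a chain complex. -/
noncomputable def free : PAlg P where
  U := freeU P V
  act := freeAct P V
  act_mem {n q p e a} hp ha := mem_freeU fun B g => by
    rw [freeEv_act]
    exact B.act_mem hp fun i => freeEv_mem (ha i) B g
  act_d {n q p e a} hp ha := freeU_ext fun B g => by
    rw [freeEv_d, freeEv_act, B.act_d hp fun i => freeEv_mem (ha i) B g, map_add, map_sum,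
      freeEv_act]
    congr 1
    refine Finset.sum_congr rfl fun i _ => ?_
    rw [map_smul, freeEv_act]
    congr 2
    funext j
    rw [Function.apply_update (fun _ => freeEv B g) a i _ j, freeEv_d]
  act_one a := freeU_ext fun B g => by rw [freeEv_act, B.act_one]
  act_perm {n} σ p {e a} ha := freeU_ext fun B g => by
    rw [freeEv_act, B.act_perm σ p fun i => freeEv_mem (ha i) B g, map_smul, freeEv_act]
  act_circ {m n l} h i μ ν q e a hν ha := freeU_ext fun B g => by
    rw [freeEv_act, B.act_circ h i μ hν fun i => freeEv_mem (ha i) B g, map_smul, freeEv_act]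
    congr 2
    funext j
    split_ifs
    · rw [freeEv_act]
    · rfl

variable (P V) in
/-- The inclusion of the generators. -/
noncomputable def freeι : V ⟶ (free P V).U :=
  show DGMod.Hom V (freeU P V) from
  { lin :=
      { toFun := fun v => FreeCarrier.mk (.var v)
        map_add' := fun v w => FreeCarrier.ext fun B g => by
          refine Eq.trans ?_ (FreeCarrier.ev_add B g _ _).symm
          exact map_add (DGMod.lin g) v w
        map_smul' := fun c v => FreeCarrier.ext fun B g => by
          refine Eq.trans ?_ (FreeCarrier.ev_smul B g _ _).symm
          exact map_smul (DGMod.lin g) c v }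
    map_mem := fun hv => FreeCarrier.mem_range fun B g => DGMod.lin_mem g hv
    map_d := fun v => FreeCarrier.ext fun B g =>
      (DGMod.lin_d g v).trans (FreeCarrier.ev_d B g (FreeCarrier.mk (.var v))).symm }

/-- The universal property. Uniqueness holds since every element of the free algebra is the value
of an expression in the generators. -/
theorem free_isFreeOn : (free P V).IsFreeOn (freeι P V) := by
  intro B g
  let f : free P V ⟶ B := show Hom (free P V) B from
    { hom := show DGMod.Hom _ _ from
      { lin := FreeCarrier.evₗ B g
        map_mem := fun hx => FreeCarrier.ev_mem hx B g
        map_d := FreeCarrier.ev_d B g }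
      map_act := fun p a => FreeCarrier.ev_act B g p a }
  refine ⟨f, rfl, fun f' hf' => ?_⟩
  have key : ∀ t : Term P V, lin f' (FreeCarrier.mk t) = t.eval B g := by
    intro t
    induction t with
    | var v => exact LinearMap.congr_fun (congrArg DGMod.lin hf') v
    | zero => exact map_zero (lin f')
    | add s t hs ht =>
      have : FreeCarrier.mk (.add s t) = FreeCarrier.mk s + FreeCarrier.mk t :=
        FreeCarrier.ext fun B g => by simp [Term.eval]
      rw [this]
      refine (map_add (lin f') _ _).trans ?_
      rw [hs, ht]; rfl
    | smul c t ht =>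
      have : FreeCarrier.mk (.smul c t) = c • FreeCarrier.mk t :=
        FreeCarrier.ext fun B g => by simp [Term.eval]
      rw [this]
      refine (map_smul (lin f') _ _).trans ?_
      rw [ht]; rfl
    | op n p t ht =>
      have : FreeCarrier.mk (.op n p t) = FreeCarrier.act p fun i => FreeCarrier.mk (t i) :=
        FreeCarrier.ext fun B g => by simp [Term.eval]
      rw [this]
      refine (lin_act f' _ _).trans ?_
      simp only [ht]; rfl
    | d t ht =>
      have : FreeCarrier.mk (.d t) = FreeCarrier.d (FreeCarrier.mk t) :=
        FreeCarrier.ext fun B g => by simp [Term.eval]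
      rw [this]
      refine (lin_d f' _).trans ?_
      rw [ht]; rfl
    | proj n t ht =>
      have : FreeCarrier.mk (.proj n t) = FreeCarrier.pr n (FreeCarrier.mk t) :=
        FreeCarrier.ext fun B g => by simp [Term.eval]
      rw [this]
      have h := DGMod.lin_proj (Hom.hom f') n (FreeCarrier.mk t : FreeCarrier P V)
      refine (congrArg (lin f') (LinearMap.congr_fun (freeU_proj n) _)).symm.trans ?_
      exact h.trans (congrArg (B.U.proj n) ht)
  exact hom_ext fun x => Quotient.ind (motive := fun x => lin f' x = lin f x) key x

end PAlg

namespace DGMod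

/-! ### Quotient complexes -/

section Quotient

variable {V : DGMod K} {I : Submodule K V} (hp : ∀ (n : ℤ) (x : V), x ∈ I → V.proj n x ∈ I)
  (hd : ∀ x : V, x ∈ I → V.d x ∈ I)

variable (V I) in
/-- The quotient of a chain complex by a subcomplex. -/
noncomputable def quot : DGMod K :=
  ofProj (M := V ⧸ I) (I.mapQ I V.d hd) (fun n => I.mapQ I (V.proj n) (hp n))
    (fun m n x => by
      obtain ⟨x, rfl⟩ := I.mkQ_surjective x
      simp only [Submodule.mkQ_apply, Submodule.mapQ_apply, proj_proj]
      split_ifs <;> rfl)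
    (fun x => by
      obtain ⟨x, rfl⟩ := I.mkQ_surjective x
      refine V.homogeneous_induction (p := fun x => I.mkQ x ∈ ⨆ n, LinearMap.range
        (I.mapQ I (V.proj n) (hp n))) x ?_ (fun x y hx hy => ?_) fun n x hx => ?_
      · rw [map_zero]; exact zero_mem _
      · rw [map_add]; exact add_mem hx hy
      · refine Submodule.mem_iSup_of_mem n ⟨I.mkQ x, ?_⟩
        simp only [Submodule.mkQ_apply, Submodule.mapQ_apply, V.proj_of_mem hx])
    (fun n x => by
      obtain ⟨x, rfl⟩ := I.mkQ_surjective x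
      simp only [Submodule.mkQ_apply, Submodule.mapQ_apply, proj_d])
    (fun x => by
      obtain ⟨x, rfl⟩ := I.mkQ_surjective x
      simp only [Submodule.mkQ_apply, Submodule.mapQ_apply, d_d, Submodule.Quotient.mk_zero])

/-- The projection onto a quotient complex. -/
noncomputable def quotMk : V ⟶ quot V I hp hd :=
  show Hom V (quot V I hp hd) from
  { lin := I.mkQ
    map_mem := fun hx => ⟨I.mkQ _, congrArg I.mkQ (V.proj_of_mem hx)⟩
    map_d := fun _ => rfl }

theorem quotMk_surjective : Function.Surjective (lin (quotMk hp hd)) := I.mkQ_surjective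

theorem ker_quotMk : LinearMap.ker (lin (quotMk hp hd)) = I := I.ker_mkQ

theorem exists_quotMk_mem {n : ℤ} {x : quot V I hp hd} (hx : x ∈ (quot V I hp hd).gr n) :
    ∃ y ∈ V.gr n, lin (quotMk hp hd) y = x := by
  obtain ⟨z, rfl⟩ := hx
  obtain ⟨z, rfl⟩ := I.mkQ_surjective z
  exact ⟨V.proj n z, V.proj_mem n z, rfl⟩

/-- A morphism vanishing on a subcomplex factors through the quotient. -/
theorem exists_quot_desc {W : DGMod K} (f : V ⟶ W) (hf : I ≤ LinearMap.ker (lin f)) :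
    ∃ g : quot V I hp hd ⟶ W, quotMk hp hd ≫ g = f := by
  let ℓ : quot V I hp hd →ₗ[K] W := I.liftQ (lin f) hf
  have hℓ : ∀ x, ℓ (lin (quotMk hp hd) x) = lin f x := fun x => I.liftQ_apply (lin f) x
  refine ⟨show Hom (quot V I hp hd) W from
    { lin := ℓ
      map_mem := fun hx => by
        obtain ⟨y, hy, rfl⟩ := exists_quotMk_mem hp hd hx
        rw [hℓ]
        exact lin_mem f hy
      map_d := fun x => by
        obtain ⟨x, rfl⟩ := quotMk_surjective hp hd x
        rw [← lin_d, hℓ, hℓ, lin_d] }, ?_⟩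
  exact hom_ext (LinearMap.ext hℓ)

end Quotient

end DGMod

namespace PAlg

variable {P : DGOperad K}

/-! ### Quotient algebras -/

theorem isIdeal_ker {A B : PAlg P} (f : A ⟶ B) : A.IsIdeal (LinearMap.ker (lin f)) where
  homogeneous n x hx := by
    rw [LinearMap.mem_ker] at hx ⊢
    refine (DGMod.lin_proj (Hom.hom f) n x).trans ?_
    change B.U.proj n (lin f x) = 0
    rw [hx, map_zero]
  d_mem x hx := by
    rw [LinearMap.mem_ker] at hx ⊢
    rw [lin_d, hx, map_zero]
  act_mem p a i hi := by
    rw [LinearMap.mem_ker] at hi ⊢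
    rw [lin_act]
    exact (B.act p).map_coord_zero i hi

theorem isIdeal_idealSpan (A : PAlg P) (R : Set A.U) : A.IsIdeal (A.idealSpan R) where
  homogeneous n x hx := (Submodule.mem_sInf).2 fun I hI =>
    hI.1.homogeneous n x (Submodule.mem_sInf.1 hx I hI)
  d_mem x hx := (Submodule.mem_sInf).2 fun I hI => hI.1.d_mem x (Submodule.mem_sInf.1 hx I hI)
  act_mem p a i hi := (Submodule.mem_sInf).2 fun I hI =>
    hI.1.act_mem p a i (Submodule.mem_sInf.1 hi I hI)

theorem subset_idealSpan (A : PAlg P) (R : Set A.U) : R ⊆ A.idealSpan R :=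
  fun _ hx => Submodule.mem_sInf.2 fun _ hI => hI.2 hx

theorem idealSpan_le {A : PAlg P} {R : Set A.U} {I : Submodule K A.U} (hI : A.IsIdeal I)
    (h : R ⊆ I) : A.idealSpan R ≤ I := sInf_le ⟨hI, h⟩

namespace IsIdeal

variable {A : PAlg P} {I : Submodule K A.U} (hI : A.IsIdeal I)
include hI

/-- The operations are well defined modulo an ideal. -/
theorem act_sub_mem {n : ℕ} (p : P.obj n) {a b : Fin n → A.U} (h : ∀ i, a i - b i ∈ I) :
    A.act p a - A.act p b ∈ I := by
  classical
  have key : ∀ s : Finset (Fin n), A.act p (s.piecewise a b) - A.act p b ∈ I := by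
    intro s
    induction s using Finset.induction_on with
    | empty => simp
    | insert i s hi ih =>
      rw [Finset.piecewise_insert]
      have h1 : A.act p (Function.update (s.piecewise a b) i (a i - b i)) ∈ I :=
        hI.act_mem p _ i (by simpa using h i)
      have h2 : Function.update (s.piecewise a b) i (b i) = s.piecewise a b := by
        rw [Function.update_eq_self_iff]; simp [hi]
      rw [MultilinearMap.map_update_sub, h2] at h1
      have := add_mem h1 ih
      rwa [sub_add_sub_cancel] at this
  have := key Finset.univ
  rwa [Finset.piecewise_univ] at this

/-- The chain complex underlying the quotient algebra. -/
noncomputable def quotU : DGMod K := DGMod.quot A.U I hI.homogeneous hI.d_mem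

/-- The quotient map. -/
noncomputable def mkQ : A.U →ₗ[K] hI.quotU := DGMod.lin (DGMod.quotMk hI.homogeneous hI.d_mem)

theorem mkQ_surjective : Function.Surjective hI.mkQ := DGMod.quotMk_surjective _ _

theorem ker_mkQ : LinearMap.ker hI.mkQ = I := DGMod.ker_quotMk _ _

theorem mkQ_eq {x y : A.U} : hI.mkQ x = hI.mkQ y ↔ x - y ∈ I := Submodule.Quotient.eq I

theorem mkQ_mem {n : ℤ} {x : A.U} (hx : x ∈ A.U.gr n) : hI.mkQ x ∈ hI.quotU.gr n :=
  DGMod.lin_mem _ hx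

theorem exists_mem {n : ℤ} {x : hI.quotU} (hx : x ∈ hI.quotU.gr n) :
    ∃ y ∈ A.U.gr n, hI.mkQ y = x := DGMod.exists_quotMk_mem _ _ hx

theorem mkQ_d (x : A.U) : hI.mkQ (A.U.d x) = hI.quotU.d (hI.mkQ x) := rfl

/-- A lift to `A` of an element of the quotient. -/
noncomputable def lift (x : hI.quotU) : A.U := Function.surjInv hI.mkQ_surjective x

theorem mkQ_lift (x : hI.quotU) : hI.mkQ (hI.lift x) = x := Function.surjInv_eq _ x

/-- The operations of the quotient algebra. -/
noncomputable def quotFun {n : ℕ} (p : P.obj n) (a : Fin n → hI.quotU) : hI.quotU :=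
  hI.mkQ (A.act p fun i => hI.lift (a i))

theorem quotFun_mkQ {n : ℕ} (p : P.obj n) (a : Fin n → A.U) :
    hI.quotFun p (fun i => hI.mkQ (a i)) = hI.mkQ (A.act p a) :=
  hI.mkQ_eq.2 (hI.act_sub_mem p fun _ => hI.mkQ_eq.1 (hI.mkQ_lift _))

theorem exists_lift {n : ℕ} (a : Fin n → hI.quotU) :
    ∃ b : Fin n → A.U, a = fun i => hI.mkQ (b i) :=
  ⟨fun i => hI.lift (a i), funext fun i => (hI.mkQ_lift (a i)).symm⟩

theorem mkQ_update {n : ℕ} [DecidableEq (Fin n)] (a : Fin n → A.U) (i : Fin n) (x : A.U) :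
    Function.update (fun i => hI.mkQ (a i)) i (hI.mkQ x) =
      fun j => hI.mkQ (Function.update a i x j) :=
  funext fun j => (Function.apply_update (fun _ => hI.mkQ) a i x j).symm

/-- The operations of the quotient algebra, as multilinear maps. -/
noncomputable def quotAct {n : ℕ} :
    P.obj n →ₗ[K] MultilinearMap K (fun _ : Fin n => (hI.quotU : Type u)) hI.quotU where
  toFun p :=
    { toFun := hI.quotFun p
      map_update_add' a i x y := by
        obtain ⟨a, rfl⟩ := hI.exists_lift a
        obtain ⟨x, rfl⟩ := hI.mkQ_surjective x
        obtain ⟨y, rfl⟩ := hI.mkQ_surjective y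
        rw [← map_add, mkQ_update, mkQ_update, mkQ_update, quotFun_mkQ, quotFun_mkQ, quotFun_mkQ,
          MultilinearMap.map_update_add, map_add]
      map_update_smul' a i c x := by
        obtain ⟨a, rfl⟩ := hI.exists_lift a
        obtain ⟨x, rfl⟩ := hI.mkQ_surjective x
        rw [← map_smul, mkQ_update, mkQ_update, quotFun_mkQ, quotFun_mkQ,
          MultilinearMap.map_update_smul, map_smul] }
  map_add' p p' := MultilinearMap.ext fun a => by
    obtain ⟨a, rfl⟩ := hI.exists_lift a
    refine (hI.quotFun_mkQ _ a).trans ?_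
    rw [map_add, _root_.add_apply, map_add]
    exact congrArg₂ (· + ·) (hI.quotFun_mkQ _ a).symm (hI.quotFun_mkQ _ a).symm
  map_smul' c p := MultilinearMap.ext fun a => by
    obtain ⟨a, rfl⟩ := hI.exists_lift a
    refine (hI.quotFun_mkQ _ a).trans ?_
    rw [map_smul, _root_.smul_apply, map_smul]
    exact congrArg (c • ·) (hI.quotFun_mkQ _ a).symm

theorem quotAct_mkQ {n : ℕ} (p : P.obj n) (a : Fin n → A.U) :
    hI.quotAct p (fun i => hI.mkQ (a i)) = hI.mkQ (A.act p a) := hI.quotFun_mkQ p a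

theorem exists_lift_mem {n : ℕ} {e : Fin n → ℤ} {a : Fin n → hI.quotU}
    (ha : ∀ i, a i ∈ hI.quotU.gr (e i)) :
    ∃ b : Fin n → A.U, (∀ i, b i ∈ A.U.gr (e i)) ∧ a = fun i => hI.mkQ (b i) := by
  choose b hb hb' using fun i => hI.exists_mem (ha i)
  exact ⟨b, hb, funext fun i => (hb' i).symm⟩

/-- The quotient of an algebra by an ideal. -/
noncomputable def quot : PAlg P where
  U := hI.quotU
  act := hI.quotAct
  act_mem {n q p e a} hp ha := by
    obtain ⟨a, ha', rfl⟩ := hI.exists_lift_mem ha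
    rw [quotAct_mkQ]
    exact hI.mkQ_mem (A.act_mem hp ha')
  act_d {n q p e a} hp ha := by
    obtain ⟨a, ha', rfl⟩ := hI.exists_lift_mem ha
    rw [quotAct_mkQ, quotAct_mkQ, ← mkQ_d, A.act_d hp ha', map_add, map_sum]
    congr 1
    refine Finset.sum_congr rfl fun i _ => ?_
    rw [← mkQ_d, mkQ_update, quotAct_mkQ, map_smul]
  act_one a := by
    obtain ⟨a, rfl⟩ := hI.exists_lift a
    rw [quotAct_mkQ, A.act_one]
  act_perm {n} σ p {e a} ha := by
    obtain ⟨a, ha', rfl⟩ := hI.exists_lift_mem ha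
    rw [quotAct_mkQ, A.act_perm σ p ha', map_smul]
    exact congrArg _ (hI.quotAct_mkQ p fun i => a (σ i)).symm
  act_circ {m n l} h i μ ν q e a hν ha := by
    obtain ⟨a, ha', rfl⟩ := hI.exists_lift_mem ha
    rw [quotAct_mkQ, A.act_circ h i μ hν ha', map_smul, ← quotAct_mkQ]
    congr 2
    funext j
    split_ifs
    · rw [← quotAct_mkQ]
    · rfl

/-- The quotient map, as a morphism of algebras. -/
noncomputable def toQuot : A ⟶ hI.quot :=
  show Hom A hI.quot from
  { hom := show DGMod.Hom A.U hI.quotU from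
    { lin := hI.mkQ
      map_mem := hI.mkQ_mem
      map_d := hI.mkQ_d }
    map_act := fun p a => (hI.quotAct_mkQ p a).symm }

theorem lin_toQuot_surjective : Function.Surjective (lin hI.toQuot) := hI.mkQ_surjective

theorem ker_lin_toQuot : LinearMap.ker (lin hI.toQuot) = I := hI.ker_mkQ

theorem hom_ext {B : PAlg P} {f g : hI.quot ⟶ B} (h : hI.toQuot ≫ f = hI.toQuot ≫ g) : f = g :=
  PAlg.hom_ext fun x => by
    obtain ⟨x, rfl⟩ := hI.lin_toQuot_surjective x
    exact LinearMap.congr_fun (congrArg lin h) x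

/-- A morphism vanishing on the ideal factors through the quotient. -/
theorem exists_desc {B : PAlg P} (f : A ⟶ B) (hf : I ≤ LinearMap.ker (lin f)) :
    ∃ g : hI.quot ⟶ B, hI.toQuot ≫ g = f := by
  obtain ⟨g, hg⟩ := DGMod.exists_quot_desc hI.homogeneous hI.d_mem (Hom.hom f) hf
  have hg' : ∀ x, DGMod.lin g (hI.mkQ x) = lin f x := fun x =>
    LinearMap.congr_fun (congrArg DGMod.lin hg) x
  refine ⟨show Hom hI.quot B from
    { hom := g
      map_act := fun {n} p a => by
        obtain ⟨a, rfl⟩ := hI.exists_lift a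
        refine (congrArg (DGMod.lin g) (hI.quotAct_mkQ p a)).trans
          ((hg' _).trans ((lin_act f p a).trans ?_))
        exact congrArg (B.act p) (funext fun i => (hg' (a i)).symm) }, ?_⟩
  exact PAlg.hom_ext hg'

end IsIdeal

end PAlg

/-! ### Morphisms to internal homs -/

namespace DGMod

/-- The morphism `V ⟶ [W, X]` corresponding to `g : V ⊗ W ⟶ X`. -/
noncomputable def curryHom {V W X : DGMod K} (g : V ⊗ W ⟶ X) : V ⟶ ihom W X :=
  show Hom V (ihom W X) from
  have hm : ∀ {n : ℤ} {v : V}, v ∈ V.gr n → TensorProduct.curry (lin g) v ∈ homGr W X n :=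
    fun {n v} hv q w hw => by
      have := lin_mem g (tmul_mem hv hw rfl)
      rwa [add_comm] at this
  { lin := LinearMap.codRestrict (homTotal W X) (TensorProduct.curry (lin g)) fun v => by
      refine V.homogeneous_induction (p := fun v => TensorProduct.curry (lin g) v ∈ homTotal W X) v
        ?_ (fun v v' h h' => ?_) fun m v hv => ?_
      · rw [map_zero]; exact zero_mem _
      · rw [map_add]; exact add_mem h h'
      · exact Submodule.mem_iSup_of_mem m (hm hv)
    map_mem := fun hv => hm hv
    map_d := fun v => ihomCoe_injective <| by
      refine LinearMap.congr_fun (f := TensorProduct.curry (lin g) ∘ₗ V.d)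
        (g := homD W X ∘ₗ TensorProduct.curry (lin g)) (V.linearMap_ext fun n v hv => ?_) v
      rw [LinearMap.comp_apply, LinearMap.comp_apply, homD_of_mem (hm hv)]
      ext w
      have h1 : lin g (tensorD V W (v ⊗ₜ[K] w)) = X.d (lin g (v ⊗ₜ[K] w)) := lin_d g (v ⊗ₜ[K] w)
      rw [tensorD_tmul V W w hv] at h1
      have h2 := (map_add (lin g) (V.d v ⊗ₜ[K] w) (((-1 : K) ^ n) • (v ⊗ₜ[K] W.d w))).symm.trans h1
      have h3 := map_smul (lin g) ((-1 : K) ^ n) (v ⊗ₜ[K] W.d w)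
      exact eq_sub_of_add_eq ((congrArg (_ + ·) h3.symm).trans h2) }

theorem exists_curryHom {V W X : DGMod K} (φ : V ⟶ ihom W X) : ∃ g : V ⊗ W ⟶ X, curryHom g = φ := by
  let g : V ⊗[K] W →ₗ[K] X := TensorProduct.lift (ihomCoe W X ∘ₗ lin φ)
  refine ⟨show Hom (tensor V W) X from
    { lin := g
      map_mem := fun {n x} hx => tensor_mem _ g (fun p q v w hv hw hpq => ?_) hx
      map_d := fun x => LinearMap.congr_fun (f := g ∘ₗ tensorD V W) (g := X.d ∘ₗ g)
        (tensor_ext fun p q v w hv hw => ?_) x }, ?_⟩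
  · have := mem_ihom_gr.1 (lin_mem φ hv) q w hw
    rwa [add_comm, hpq] at this
  · have h := LinearMap.congr_fun (congrArg (ihomCoe W X) (lin_d φ v)) w
    rw [ihomCoe_d, homD_of_mem (mem_ihom_gr.1 (lin_mem φ hv))] at h
    rw [LinearMap.comp_apply, LinearMap.comp_apply, tensorD_tmul V W w hv, map_add, map_smul]
    exact (congrArg (· + _) h).trans (sub_add_cancel _ _)
  · exact hom_ext rfl

theorem curryHom_injective {V W X : DGMod K} : Function.Injective
    (curryHom : (V ⊗ W ⟶ X) → (V ⟶ ihom W X)) := fun _ _ h =>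
  hom_ext (TensorProduct.ext' fun v w =>
    LinearMap.congr_fun (congrArg (ihomCoe W X) (LinearMap.congr_fun (congrArg lin h) v)) w)

end DGMod

namespace PAlg

variable {P : DGOperad K}

/-! ### The tensor `A ◁ C` -/

theorem lin_convAct {A B : PAlg P} (C : UCocom K) (h : A ⟶ B) {n : ℕ} (p : P.obj n)
    (f : Fin n → (C.X →ₗ[K] A.U)) (q : Fin n → ℤ) (x : C.X) :
    lin h (convAct C A p f q x) = convAct C B p (fun i => lin h ∘ₗ f i) q x := by
  rw [convAct_eq_pull, convAct_eq_pull, ← LinearMap.comp_apply, ← UCocom.pull_compMultilinearMap]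
  congr 2
  ext u
  exact lin_act h p _

variable (A : PAlg P) (C : UCocom K)

/-- The ideal of relations defining `A ◁ C`. -/
theorem tens_isIdeal : (free P (A.U ⊗ C.X)).IsIdeal
    ((free P (A.U ⊗ C.X)).idealSpan (A.tensorRelations C _ (freeι P (A.U ⊗ C.X)))) :=
  isIdeal_idealSpan _ _

/-- The algebra `A ◁ C`. -/
noncomputable def tens : PAlg P := (tens_isIdeal A C).quot

/-- The projection of the free algebra on `A ⊗ C` onto `A ◁ C`. -/
noncomputable def tensMk : free P (A.U ⊗ C.X) ⟶ tens A C := (tens_isIdeal A C).toQuot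

/-- The relations of `A ◁ C` say that a morphism out of `A ◁ C` turns the operations of `A` into the
operations of the convolution algebra. -/
theorem tensMk_relation {n : ℕ} (p : P.obj n) {y : Fin n → A.U} {e : Fin n → ℤ} (x : C.X)
    (hy : ∀ i, y i ∈ A.U.gr (e i)) {B : PAlg P} (f : tens A C ⟶ B) :
    lin (tensMk A C ≫ f) (DGMod.lin (freeι P (A.U ⊗ C.X)) (A.act p y ⊗ₜ[K] x)) =
      convAct C B p (fun i => DGMod.lin (freeι P (A.U ⊗ C.X) ≫ Hom.hom (tensMk A C ≫ f)) ∘ₗ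
        TensorProduct.mk K A.U C.X (y i)) e x := by
  have h1 := subset_idealSpan _ _ (show _ ∈ A.tensorRelations C _ (freeι P (A.U ⊗ C.X)) from
    ⟨n, p, y, e, x, hy, rfl⟩)
  rw [← (tens_isIdeal A C).ker_lin_toQuot, SetLike.mem_coe, LinearMap.mem_ker, map_sub,
    sub_eq_zero] at h1
  refine (congrArg (lin f) h1).trans ?_
  exact lin_convAct C (tensMk A C ≫ f) p _ e x

variable {A C}

/-- The morphism `A ⟶ [C, B]` corresponding to `f : A ◁ C ⟶ B`. -/
noncomputable def tensCurry {B : PAlg P} (f : tens A C ⟶ B) : A ⟶ conv C B :=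
  mkHom (DGMod.curryHom (freeι P (A.U ⊗ C.X) ≫ Hom.hom (tensMk A C ≫ f)))
    fun {n} p e y hy => convCoe_injective <| by
      have h1 := conv_act C B p (q := e) (f := fun i => DGMod.lin (DGMod.curryHom
        (freeι P (A.U ⊗ C.X) ≫ Hom.hom (tensMk A C ≫ f))) (y i)) fun i => DGMod.lin_mem _ (hy i)
      refine Eq.trans ?_ h1.symm
      exact LinearMap.ext fun x => tensMk_relation A C p x hy f

theorem convCoe_tensCurry {B : PAlg P} (f : tens A C ⟶ B) (y : A.U) (x : C.X) :
    convCoe C B (lin (tensCurry f) y) x =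
      lin f (lin (tensMk A C) (DGMod.lin (freeι P (A.U ⊗ C.X)) (y ⊗ₜ[K] x))) := rfl

theorem tensCurry_injective {B : PAlg P} : Function.Injective
    (tensCurry : (tens A C ⟶ B) → (A ⟶ conv C B)) := fun f f' h => by
  refine (tens_isIdeal A C).hom_ext ?_
  refine (free_isFreeOn B (freeι P (A.U ⊗ C.X) ≫ Hom.hom (tensMk A C ≫ f))).unique rfl ?_
  exact DGMod.curryHom_injective (congrArg Hom.hom h).symm

/-- A morphism `A ⟶ [C, B]` gives a chain map `A ⊗ C ⟶ B`, hence a morphism from the free algebra;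
it kills the defining relations of `A ◁ C` because the operations of `[C, B]` are convolutions. -/
theorem tensCurry_surjective {B : PAlg P} : Function.Surjective
    (tensCurry : (tens A C ⟶ B) → (A ⟶ conv C B)) := fun φ => by
  obtain ⟨g, hg⟩ := DGMod.exists_curryHom (X := B.U) (Hom.hom φ)
  obtain ⟨f, hf, -⟩ := free_isFreeOn (P := P) B g
  have hgφ : ∀ y, DGMod.lin g ∘ₗ TensorProduct.mk K A.U C.X y = convCoe C B (lin φ y) := fun y =>
    congrArg (fun ψ => DGMod.ihomCoe C.X B.U (DGMod.lin ψ y)) hg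
  have hfg : ∀ t, lin f (DGMod.lin (freeι P (A.U ⊗ C.X)) t) = DGMod.lin g t := fun t =>
    LinearMap.congr_fun (congrArg DGMod.lin hf) t
  obtain ⟨f', hf'⟩ := (tens_isIdeal A C).exists_desc f (idealSpan_le (isIdeal_ker f) <| by
    rintro _ ⟨n, p, y, e, x, hy, rfl⟩
    rw [SetLike.mem_coe, LinearMap.mem_ker, map_sub, sub_eq_zero, lin_convAct, hfg]
    refine (LinearMap.congr_fun (hgφ _) x).trans ?_
    rw [lin_act, conv_act C B p fun i => lin_mem φ (hy i)]
    congr 2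
    funext i
    rw [← hgφ]
    exact LinearMap.ext fun x => (hfg _).symm)
  refine ⟨f', ?_⟩
  have : freeι P (A.U ⊗ C.X) ≫ Hom.hom (tensMk A C ≫ f') = g :=
    (congrArg (fun h => freeι P (A.U ⊗ C.X) ≫ Hom.hom h) hf').trans hf
  exact Hom.ext ((congrArg DGMod.curryHom this).trans hg)

/-- The adjunction `Hom(A ◁ C, B) ≃ Hom(A, [C, B])`. -/
noncomputable def tensCurryEquiv {B : PAlg P} : (tens A C ⟶ B) ≃ (A ⟶ conv C B) :=
  Equiv.ofBijective tensCurry ⟨tensCurry_injective, tensCurry_surjective⟩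

end PAlg

namespace DGMod

/-! ### Direct sums -/

section DirectSum

variable {ι : Type u} [DecidableEq ι] (V : ι → DGMod K)

/-- A family of linear endomorphisms, on the direct sum. -/
noncomputable def dsumMap (f : ∀ i, V i →ₗ[K] V i) :
    (DirectSum ι fun i => V i) →ₗ[K] DirectSum ι fun i => V i :=
  DirectSum.toModule K ι _ fun i => DirectSum.lof K ι (fun i => V i) i ∘ₗ f i

theorem dsumMap_lof (f : ∀ i, V i →ₗ[K] V i) (i : ι) (x : V i) :
    dsumMap V f (DirectSum.lof K ι (fun i => V i) i x) =
      DirectSum.lof K ι (fun i => V i) i (f i x) :=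
  DirectSum.toModule_lof K _ _

theorem dsum_induction {p : (DirectSum ι fun i => V i) → Prop} (x : DirectSum ι fun i => V i)
    (h0 : p 0) (hadd : ∀ x y, p x → p y → p (x + y))
    (hh : ∀ i x, p (DirectSum.lof K ι (fun i => V i) i x)) : p x :=
  DirectSum.induction_on x h0 hh hadd

/-- The direct sum of a family of chain complexes. -/
noncomputable def dsum : DGMod K :=
  ofProj (M := DirectSum ι fun i => V i) (dsumMap V fun i => (V i).d)
    (fun n => dsumMap V fun i => (V i).proj n)
    (fun m n x => by
      refine dsum_induction V (p := fun x => dsumMap V (fun i => (V i).proj m)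
        (dsumMap V (fun i => (V i).proj n) x) = if m = n then dsumMap V (fun i => (V i).proj n) x
          else 0) x (by simp) (fun x y hx hy => ?_) fun i x => ?_
      · simp only [map_add, hx, hy]; split_ifs <;> simp
      · simp only [dsumMap_lof, proj_proj]; split_ifs <;> simp)
    (fun x => by
      refine dsum_induction V (p := fun x => x ∈ ⨆ n, LinearMap.range
        (dsumMap V fun i => (V i).proj n)) x (zero_mem _) (fun x y hx hy => add_mem hx hy)
        fun i x => ?_
      refine (V i).homogeneous_induction (p := fun x => DirectSum.lof K ι (fun i => V i) i x ∈
        ⨆ n, LinearMap.range (dsumMap V fun i => (V i).proj n)) x ?_ (fun x y hx hy => ?_)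
        fun n x hx => ?_
      · rw [map_zero]; exact zero_mem _
      · rw [map_add]; exact add_mem hx hy
      · refine Submodule.mem_iSup_of_mem n ⟨DirectSum.lof K ι (fun i => V i) i x, ?_⟩
        rw [dsumMap_lof, (V i).proj_of_mem hx])
    (fun n x => by
      refine dsum_induction V (p := fun x => dsumMap V (fun i => (V i).proj (n - 1))
        (dsumMap V (fun i => (V i).d) (dsumMap V (fun i => (V i).proj n) x)) =
          dsumMap V (fun i => (V i).d) (dsumMap V (fun i => (V i).proj n) x)) x (by simp)
        (fun x y hx hy => by simp only [map_add, hx, hy]) fun i x => ?_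
      simp only [dsumMap_lof, proj_d])
    (fun x => by
      refine dsum_induction V (p := fun x => dsumMap V (fun i => (V i).d)
        (dsumMap V (fun i => (V i).d) x) = 0) x (by simp)
        (fun x y hx hy => by simp only [map_add, hx, hy, add_zero]) fun i x => ?_
      simp only [dsumMap_lof, d_d, map_zero])

/-- The inclusion of a summand. -/
noncomputable def dsumι (i : ι) : V i ⟶ dsum V :=
  show Hom (V i) (dsum V) from
  { lin := DirectSum.lof K ι (fun i => V i) i
    map_mem := fun {n x} hx => ⟨DirectSum.lof K ι (fun i => V i) i x, by
      rw [dsumMap_lof, (V i).proj_of_mem hx]; rfl⟩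
    map_d := fun x => (dsumMap_lof V (fun i => (V i).d) i x).symm }

theorem dsum_linearMap_ext {M : Type*} [AddCommGroup M] [Module K M] {f g : dsum V →ₗ[K] M}
    (h : ∀ i x, f (lin (dsumι V i) x) = g (lin (dsumι V i) x)) : f = g :=
  DirectSum.linearMap_ext K fun i => LinearMap.ext (h i)

theorem mem_dsum_gr {n : ℤ} {x : dsum V} (hx : x ∈ (dsum V).gr n) {S : Submodule K (dsum V)}
    (h : ∀ i, ∀ y ∈ (V i).gr n, lin (dsumι V i) y ∈ S) : x ∈ S := by
  obtain ⟨z, rfl⟩ := hx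
  refine dsum_induction V (p := fun z => (show dsum V from dsumMap V (fun i => (V i).proj n) z) ∈ S)
    z ?_ (fun x y hx hy => ?_) fun i x => ?_
  · rw [map_zero]; exact zero_mem S
  · rw [map_add]; exact add_mem hx hy
  · rw [dsumMap_lof]; exact h i _ ((V i).proj_mem n x)

/-- The linear map on a direct sum given by linear maps on the summands. -/
noncomputable def dsumLift {M : Type*} [AddCommGroup M] [Module K M] (f : ∀ i, V i →ₗ[K] M) :
    dsum V →ₗ[K] M := DirectSum.toModule K ι M f

theorem dsumLift_ι {M : Type*} [AddCommGroup M] [Module K M] (f : ∀ i, V i →ₗ[K] M) (i : ι)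
    (x : V i) : dsumLift V f (lin (dsumι V i) x) = f i x := DirectSum.toModule_lof K _ _

/-- The morphism on a direct sum given by morphisms on the summands. -/
noncomputable def dsumDesc {W : DGMod K} (f : ∀ i, V i ⟶ W) : dsum V ⟶ W :=
  show Hom (dsum V) W from
  { lin := dsumLift V fun i => lin (f i)
    map_mem := fun {n x} hx => mem_dsum_gr V hx
      (S := (W.gr n).comap (dsumLift V fun i => lin (f i)))
      fun i y hy => by
        rw [Submodule.mem_comap, dsumLift_ι]
        exact lin_mem (f i) hy
    map_d := fun x => LinearMap.congr_fun (f := dsumLift V (fun i => lin (f i)) ∘ₗ (dsum V).d)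
      (g := W.d ∘ₗ dsumLift V fun i => lin (f i)) (dsum_linearMap_ext V fun i x => by
        rw [LinearMap.comp_apply, LinearMap.comp_apply, ← lin_d, dsumLift_ι, dsumLift_ι, lin_d]) x }

theorem dsumι_desc {W : DGMod K} (f : ∀ i, V i ⟶ W) (i : ι) : dsumι V i ≫ dsumDesc V f = f i :=
  hom_ext (LinearMap.ext fun x => dsumLift_ι V (fun i => lin (f i)) i x)

end DirectSum

end DGMod

namespace UCocom

/-! ### Quotients and direct sums of coalgebras -/

/-- The coalgebra structure on `Y` for which the jointly epimorphic family of maps `g i` consists of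
morphisms of coalgebras. -/
noncomputable def ofJointlyEpi {ι : Type u} (C : ι → UCocom K) (Y : DGMod K)
    (g : ∀ i, (C i).X ⟶ Y)
    (hg : ∀ {Z : DGMod K} (f f' : Y ⟶ Z), (∀ i, g i ≫ f = g i ≫ f') → f = f')
    (δ : Y ⟶ Y ⊗ Y) (ε : Y ⟶ 𝟙_ (DGMod K))
    (hδ : ∀ i, g i ≫ δ = ComonObj.comul (X := (C i).X) ≫ (g i ⊗ₘ g i))
    (hε : ∀ i, g i ≫ ε = ComonObj.counit (X := (C i).X)) : UCocom K :=
  letI : ComonObj Y :=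
    { counit := ε
      comul := δ
      counit_comul := hg _ _ fun i => by
        rw [reassoc_of% hδ i, tensorHom_comp_whiskerRight, hε i, MonoidalCategory.tensorHom_def,
          ComonObj.counit_comul_assoc, leftUnitor_inv_naturality]
      comul_counit := hg _ _ fun i => by
        rw [reassoc_of% hδ i, tensorHom_comp_whiskerLeft, hε i, MonoidalCategory.tensorHom_def',
          ComonObj.comul_counit_assoc, rightUnitor_inv_naturality]
      comul_assoc := hg _ _ fun i => by
        rw [reassoc_of% hδ i, reassoc_of% hδ i, tensorHom_comp_whiskerLeft,
          tensorHom_comp_whiskerRight_assoc, hδ i, ← whiskerLeft_comp_tensorHom,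
          ← whiskerRight_comp_tensorHom_assoc, associator_naturality, ComonObj.comul_assoc_assoc] }
  { X := Y
    comm := ⟨hg _ _ fun i => by
      have h := IsCommComonObj.comul_comm (C i).X
      change g i ≫ δ ≫ _ = g i ≫ δ
      rw [reassoc_of% hδ i, BraidedCategory.braiding_naturality, reassoc_of% h, hδ i]⟩ }

/-- A morphism of chain complexes compatible with the coproducts and the counits is a morphism of
coalgebras. -/
noncomputable def mkHom {C D : UCocom K} (f : C.X ⟶ D.X)
    (hδ : f ≫ ComonObj.comul (X := D.X) = ComonObj.comul (X := C.X) ≫ (f ⊗ₘ f))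
    (hε : f ≫ ComonObj.counit (X := D.X) = ComonObj.counit (X := C.X)) : C ⟶ D :=
  InducedCategory.homMk (Comon.Hom.mk' (M := C.toComon) (N := D.toComon) f hε hδ)

theorem hom_ext {C D : UCocom K} {f g : C ⟶ D} (h : ∀ x, lin f x = lin g x) : f = g :=
  InducedCategory.hom_ext (Comon.Hom.ext (DGMod.hom_ext (LinearMap.ext h)))

/-- The direct sum of a family of coalgebras. -/
theorem exists_dsum {ι : Type u} (C : ι → UCocom K) : ∃ (W : UCocom K) (g : ∀ i, C i ⟶ W),
    (∀ (M : Type u) [AddCommGroup M] [Module K M] (f : ∀ i, (C i).X →ₗ[K] M),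
      ∃ h : W.X →ₗ[K] M, ∀ i x, h (lin (g i) x) = f i x) ∧
    ∀ n, ∀ x ∈ W.X.gr n, ∀ S : Submodule K W.X,
      (∀ i, ∀ y ∈ (C i).X.gr n, lin (g i) y ∈ S) → x ∈ S := by
  classical
  let V : ι → DGMod K := fun i => (C i).X
  let δ : DGMod.dsum V ⟶ DGMod.dsum V ⊗ DGMod.dsum V := DGMod.dsumDesc V fun i =>
    ComonObj.comul (X := (C i).X) ≫ (DGMod.dsumι V i ⊗ₘ DGMod.dsumι V i)
  let ε : DGMod.dsum V ⟶ 𝟙_ (DGMod K) := DGMod.dsumDesc V fun i => ComonObj.counit (X := (C i).X)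
  have hδ : ∀ i, DGMod.dsumι V i ≫ δ = _ := DGMod.dsumι_desc V _
  have hε : ∀ i, DGMod.dsumι V i ≫ ε = _ := DGMod.dsumι_desc V _
  let W : UCocom K := ofJointlyEpi C (DGMod.dsum V) (DGMod.dsumι V)
    (fun f f' h => DGMod.hom_ext (DGMod.dsum_linearMap_ext V fun i x =>
      LinearMap.congr_fun (congrArg DGMod.lin (h i)) x)) δ ε hδ hε
  refine ⟨W, fun i => mkHom (D := W) (DGMod.dsumι V i) (hδ i) (hε i), fun M _ _ f =>
    ⟨DGMod.dsumLift V f, DGMod.dsumLift_ι V f⟩, fun n x hx S hS => DGMod.mem_dsum_gr V hx hS⟩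

/-- The quotient of a coalgebra by a coideal. -/
theorem exists_quot (C : UCocom K) (J : Submodule K C.X)
    (hp : ∀ (n : ℤ) (x : C.X), x ∈ J → C.X.proj n x ∈ J) (hd : ∀ x : C.X, x ∈ J → C.X.d x ∈ J)
    (hε : ∀ x ∈ J, C.counit x = 0)
    (hδ : ∀ x ∈ J, TensorProduct.map J.mkQ J.mkQ (C.comul x) = 0) :
    ∃ (Q : UCocom K) (π : C ⟶ Q), Function.Surjective (lin π) ∧ LinearMap.ker (lin π) = J ∧
      ∀ n, ∀ x ∈ Q.X.gr n, ∃ y ∈ C.X.gr n, lin π y = x := by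
  let q := DGMod.quotMk hp hd
  obtain ⟨δ, hδ'⟩ := DGMod.exists_quot_desc hp hd (ComonObj.comul (X := C.X) ≫ (q ⊗ₘ q)) hδ
  obtain ⟨ε, hε'⟩ := DGMod.exists_quot_desc hp hd (ComonObj.counit (X := C.X)) hε
  let Q : UCocom K := ofJointlyEpi (fun _ : PUnit => C) (DGMod.quot C.X J hp hd) (fun _ => q)
    (fun f f' h => DGMod.hom_ext (LinearMap.ext fun x => by
      obtain ⟨x, rfl⟩ := DGMod.quotMk_surjective hp hd x
      exact LinearMap.congr_fun (congrArg DGMod.lin (h PUnit.unit)) x)) δ ε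
    (fun _ => hδ') fun _ => hε'
  exact ⟨Q, mkHom (D := Q) q hδ' hε', DGMod.quotMk_surjective hp hd, DGMod.ker_quotMk hp hd,
    fun n x hx => DGMod.exists_quotMk_mem hp hd hx⟩

end UCocom

namespace PAlg

variable {P : DGOperad K}

/-- A linear family of maps on `W` defines a morphism to the convolution algebra as soon as it
restricts to such morphisms along maps of coalgebras that cover `W` degreewise. -/
theorem exists_conv_lift {ι : Type u} {C : ι → UCocom K} {W : UCocom K} (g : ∀ i, C i ⟶ W)
    (hg : ∀ n, ∀ x ∈ W.X.gr n, ∀ S : Submodule K W.X,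
      (∀ i, ∀ y ∈ (C i).X.gr n, UCocom.lin (g i) y ∈ S) → x ∈ S)
    {A B : PAlg P} (φ : ∀ i, A ⟶ conv (C i) B) (ψ : A.U →ₗ[K] (W.X →ₗ[K] B.U))
    (hψ : ∀ y i x, ψ y (UCocom.lin (g i) x) = convCoe (C i) B (lin (φ i) y) x) :
    ∃ Ψ : A ⟶ conv W B, ∀ y, convCoe W B (lin Ψ y) = ψ y := by
  have hmem : ∀ n, ∀ y ∈ A.U.gr n, ψ y ∈ DGMod.homGr W.X B.U n := fun n y hy p x hx =>
    hg p x hx ((B.U.gr (p + n)).comap (ψ y)) fun i z hz => by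
      rw [Submodule.mem_comap, hψ]
      exact convCoe_mem (lin_mem (φ i) hy) hz
  have htot : ∀ y, ψ y ∈ DGMod.homTotal W.X B.U := fun y =>
    A.U.homogeneous_induction (p := fun y => ψ y ∈ DGMod.homTotal W.X B.U) y
      (by rw [map_zero]; exact zero_mem _) (fun x y hx hy => by rw [map_add]; exact add_mem hx hy)
      fun n y hy => Submodule.mem_iSup_of_mem n (hmem n y hy)
  let ℓ : A.U →ₗ[K] (conv W B).U := LinearMap.codRestrict (DGMod.homTotal W.X B.U) ψ htot
  have hinj : ∀ f f' : (conv W B).U,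
      (∀ i, lin (convMap (g i) (𝟙 B)) f = lin (convMap (g i) (𝟙 B)) f') → f = f' := fun f f' h =>
    convCoe_injective <| W.X.linearMap_ext fun n x hx =>
      hg n x hx (LinearMap.eqLocus (convCoe W B f) (convCoe W B f')) fun i z hz =>
        LinearMap.congr_fun (congrArg (convCoe (C i) B) (h i)) z
  have hℓ : ∀ i y, lin (convMap (g i) (𝟙 B)) (ℓ y) = lin (φ i) y := fun i y =>
    convCoe_injective <| LinearMap.ext fun x => hψ y i x
  refine ⟨mkHom (show DGMod.Hom A.U (conv W B).U from
    { lin := ℓ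
      map_mem := fun hx => hmem _ _ hx
      map_d := fun x => hinj _ _ fun i => by
        rw [hℓ, lin_d, lin_d, hℓ] }) fun p e a _ => hinj _ _ fun i => ?_, fun y => rfl⟩
  refine (hℓ i _).trans ?_
  rw [lin_act, lin_act]
  exact congrArg _ (funext fun j => (hℓ i (a j)).symm)

end PAlg

/-! ### The coalgebra of maps between two algebras -/

/-- Linear forms that separate the points of `V` give products that separate the points of
`V ⊗ V`. -/
theorem TensorProduct.eq_zero_of_separating {V T : Type*} [AddCommGroup V] [Module K V]
    (F : T → V →ₗ[K] K) (hF : ∀ v, (∀ t, F t v = 0) → v = 0) (z : V ⊗[K] V)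
    (hz : ∀ s t, LinearMap.mul' K K (TensorProduct.map (F s) (F t) z) = 0) : z = 0 := by
  -- first contract `z` on the right with the given forms, then on the left with all forms
  have h1 : ∀ t, TensorProduct.rid K V (TensorProduct.map LinearMap.id (F t) z) = 0 := fun t =>
    hF _ fun s => by
      rw [← hz s t]
      have : F s ∘ₗ (TensorProduct.rid K V).toLinearMap ∘ₗ TensorProduct.map LinearMap.id (F t) =
          LinearMap.mul' K K ∘ₗ TensorProduct.map (F s) (F t) :=
        TensorProduct.ext' fun v w => by simp [mul_comm]
      exact LinearMap.congr_fun this z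
  have h2 : ∀ ν : V →ₗ[K] K,
      TensorProduct.lid K V (TensorProduct.map ν LinearMap.id z) = 0 := fun ν =>
    hF _ fun t => by
      have : F t ∘ₗ (TensorProduct.lid K V).toLinearMap ∘ₗ TensorProduct.map ν LinearMap.id =
          ν ∘ₗ (TensorProduct.rid K V).toLinearMap ∘ₗ TensorProduct.map LinearMap.id (F t) :=
        TensorProduct.ext' fun v w => by simp [mul_comm]
      refine (LinearMap.congr_fun this z).trans ?_
      exact (congrArg ν (h1 t)).trans (map_zero ν)
  classical
  let b := Module.Basis.ofVectorSpace K V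
  apply (TensorProduct.equivFinsuppOfBasisLeft b).injective
  rw [map_zero]
  ext i : 1
  rw [Finsupp.zero_apply, ← h2 (b.coord i)]
  have : Finsupp.lapply i ∘ₗ (TensorProduct.equivFinsuppOfBasisLeft (N := V) b).toLinearMap =
      (TensorProduct.lid K V).toLinearMap ∘ₗ TensorProduct.map (b.coord i) LinearMap.id :=
    TensorProduct.ext' fun v w => by simp
  exact LinearMap.congr_fun this z

namespace PAlg

variable {P : DGOperad K}

/-- Formal expressions for linear forms on a coalgebra `C` equipped with a morphism
`A ⟶ [C, A']`: the counit, the composites of the values of that morphism with linear forms on `A'`,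
convolution products, and composites with the differential and the projections of `C`. -/
inductive DualTerm (A A' : PAlg P) : Type u
  | one : DualTerm A A'
  | gen (y : A.U) (l : A'.U →ₗ[K] K) : DualTerm A A'
  | mul (s t : DualTerm A A') : DualTerm A A'
  | d (s : DualTerm A A') : DualTerm A A'
  | proj (n : ℤ) (s : DualTerm A A') : DualTerm A A'

variable {A A' : PAlg P}

/-- The linear form on `C` denoted by an expression. -/
noncomputable def DualTerm.val {C : UCocom K} (φ : A ⟶ conv C A') : DualTerm A A' → (C.X →ₗ[K] K)
  | one => C.counit
  | gen y l => l ∘ₗ convCoe C A' (lin φ y)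
  | mul s t => LinearMap.mul' K K ∘ₗ TensorProduct.map (val φ s) (val φ t) ∘ₗ C.comul
  | d s => val φ s ∘ₗ C.X.d
  | proj n s => val φ s ∘ₗ C.X.proj n

namespace DualTerm

/-- The values of expressions do not change along a morphism of coalgebras compatible with the
morphisms to the convolution algebras. -/
theorem val_lin {C D : UCocom K} (g : C ⟶ D) {φ : A ⟶ conv C A'} {ψ : A ⟶ conv D A'}
    (h : ∀ y x, convCoe C A' (lin φ y) x = convCoe D A' (lin ψ y) (UCocom.lin g x))
    (t : DualTerm A A') (x : C.X) : val ψ t (UCocom.lin g x) = val φ t x := by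
  induction t generalizing x with
  | one => exact UCocom.lin_counit g x
  | gen y l => exact congrArg l (h y x).symm
  | mul s t hs ht =>
    change LinearMap.mul' K K (TensorProduct.map (val ψ s) (val ψ t) (D.comul (UCocom.lin g x))) =
      LinearMap.mul' K K (TensorProduct.map (val φ s) (val φ t) (C.comul x))
    rw [UCocom.lin_comul, ← LinearMap.comp_apply (TensorProduct.map _ _), ← TensorProduct.map_comp,
      show val ψ s ∘ₗ UCocom.lin g = val φ s from LinearMap.ext hs,
      show val ψ t ∘ₗ UCocom.lin g = val φ t from LinearMap.ext ht]
  | d s hs =>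
    refine Eq.trans ?_ (hs (C.X.d x))
    exact congrArg (val ψ s) (UCocom.lin_d g x).symm
  | proj n s hs =>
    refine Eq.trans ?_ (hs (C.X.proj n x))
    exact congrArg (val ψ s) (DGMod.lin_proj g.hom.hom n x).symm

/-- The expressions determine all the structure of `D`, provided that they separate its points: a
linear map compatible with their values is a morphism of coalgebras, compatible with the morphisms
to the convolution algebras. -/
theorem exists_hom_of_val {C D : UCocom K} (φ : A ⟶ conv C A') (ψ : A ⟶ conv D A')
    (hψ : ∀ x : D.X, (∀ t, val ψ t x = 0) → x = 0) (f : C.X →ₗ[K] D.X)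
    (hf : ∀ t x, val ψ t (f x) = val φ t x) :
    ∃ g : C ⟶ D, ∀ y x, convCoe C A' (lin φ y) x = convCoe D A' (lin ψ y) (UCocom.lin g x) := by
  have hext : ∀ x x' : D.X, (∀ t, val ψ t x = val ψ t x') → x = x' := fun x x' h =>
    sub_eq_zero.1 (hψ _ fun t => by rw [map_sub, h t, sub_self])
  let f' : C.X ⟶ D.X := show DGMod.Hom C.X D.X from
    { lin := f
      map_mem := fun {n x} hx => D.X.mem_gr_iff.2 (hext _ _ fun t =>
        ((hf (proj n t) x).trans (congrArg (val φ t) (C.X.proj_of_mem hx))).trans (hf t x).symm)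
      map_d := fun x => hext _ _ fun t => (hf t _).trans (hf (d t) x).symm }
  refine ⟨UCocom.mkHom f' (DGMod.hom_ext (LinearMap.ext fun x => sub_eq_zero.1 ?_))
    (DGMod.hom_ext (LinearMap.ext fun x => hf one x)), fun y x => ?_⟩
  · refine TensorProduct.eq_zero_of_separating (val ψ) hψ _ fun s t => ?_
    change LinearMap.mul' K K (TensorProduct.map (val ψ s) (val ψ t)
      (D.comul (f x) - TensorProduct.map f f (C.comul x))) = 0
    rw [map_sub, map_sub, TensorProduct.map_map,
      show val ψ s ∘ₗ f = val φ s from LinearMap.ext (hf s),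
      show val ψ t ∘ₗ f = val φ t from LinearMap.ext (hf t)]
    exact sub_eq_zero.2 (hf (mul s t) x)
  · refine sub_eq_zero.1 ((Module.forall_dual_apply_eq_zero_iff K _).1 fun l => ?_)
    rw [map_sub]
    exact sub_eq_zero.2 (hf (gen y l) x).symm

/-- The common kernel of the linear forms given by the expressions is a coideal; dividing it out,
the morphism to the convolution algebra descends. -/
theorem exists_separating_quot {W : UCocom K} (φ : A ⟶ conv W A') :
    ∃ (Q : UCocom K) (π : W ⟶ Q) (ψ : A ⟶ conv Q A'),
      (∀ y x, convCoe W A' (lin φ y) x = convCoe Q A' (lin ψ y) (UCocom.lin π x)) ∧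
      ∀ x : Q.X, (∀ t, val ψ t x = 0) → x = 0 := by
  let J : Submodule K W.X := ⨅ t, LinearMap.ker (val φ t)
  have hJ : ∀ {x}, x ∈ J ↔ ∀ t, val φ t x = 0 := by simp [J, Submodule.mem_iInf]
  obtain ⟨Q, π, hs, hk, hlift⟩ := W.exists_quot J
    (fun n x hx => hJ.2 fun t => hJ.1 hx (proj n t)) (fun x hx => hJ.2 fun t => hJ.1 hx (d t))
    (fun x hx => hJ.1 hx one) fun x hx => by
      refine TensorProduct.eq_zero_of_separating (fun t => J.liftQ (val φ t) (iInf_le _ t))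
        (fun v hv => ?_) _ fun s t => ?_
      · obtain ⟨v, rfl⟩ := J.mkQ_surjective v
        exact (Submodule.Quotient.mk_eq_zero J).2
          (hJ.2 fun t => (J.liftQ_apply _ v).symm.trans (hv t))
      · rw [← LinearMap.comp_apply (TensorProduct.map _ _), ← TensorProduct.map_comp,
          Submodule.liftQ_mkQ, Submodule.liftQ_mkQ]
        exact hJ.1 hx (mul s t)
  -- a linear section of `π`, through which `φ` is transported to `Q`
  obtain ⟨s, hs'⟩ := LinearMap.exists_rightInverse_of_surjective (UCocom.lin π)
    (LinearMap.range_eq_top.2 hs)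
  have hφ : ∀ y, ∀ x ∈ J, convCoe W A' (lin φ y) x = 0 := fun y x hx =>
    (Module.forall_dual_apply_eq_zero_iff K _).1 fun l => hJ.1 hx (gen y l)
  have hsφ : ∀ y x, convCoe W A' (lin φ y) (s (UCocom.lin π x)) = convCoe W A' (lin φ y) x :=
    fun y x => by
      have h : s (UCocom.lin π x) - x ∈ J := by
        rw [← hk, LinearMap.mem_ker, map_sub, sub_eq_zero]
        exact LinearMap.congr_fun hs' _
      have := hφ y _ h
      rwa [map_sub, sub_eq_zero] at this
  obtain ⟨ψ, hψ⟩ := exists_conv_lift (fun _ : PUnit => π)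
    (fun n x hx S hS => by
      obtain ⟨y, hy, rfl⟩ := hlift n x hx
      exact hS PUnit.unit y hy)
    (fun _ => φ) (LinearMap.lcomp K A'.U s ∘ₗ convCoe W A' ∘ₗ lin φ) fun y _ x => hsφ y x
  have hcomp : ∀ y x, convCoe W A' (lin φ y) x = convCoe Q A' (lin ψ y) (UCocom.lin π x) :=
    fun y x => by
      rw [hψ]
      exact (hsφ y x).symm
  refine ⟨Q, π, ψ, hcomp, fun x hx => ?_⟩
  obtain ⟨x, rfl⟩ := hs x
  rw [← LinearMap.mem_ker, hk]
  exact hJ.2 fun t => by rw [← val_lin π hcomp, hx]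

end DualTerm

open DualTerm

/-- There is a coalgebra with a morphism to its convolution algebra whose points are separated by
the expressions, and on which the expressions take all the values that they take anywhere. The
possible families of values form a set, so that such a coalgebra is obtained from the direct sum of
coalgebras realising each of them. -/
theorem exists_hom_object (A A' : PAlg P) : ∃ (Q : UCocom K) (ψ : A ⟶ conv Q A'),
    (∀ x : Q.X, (∀ t, val ψ t x = 0) → x = 0) ∧
    ∀ (C : UCocom K) (φ : A ⟶ conv C A') (x : C.X), ∃ z : Q.X, ∀ t, val ψ t z = val φ t x := by
  -- one pair `(C, φ)` and one element `x` for each family of values that occurs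
  let ι : Type u := {τ : DualTerm A A' → K // ∃ (C : UCocom K) (φ : A ⟶ conv C A') (x : C.X),
    ∀ t, val φ t x = τ t}
  choose C φ x hx using fun i : ι => i.2
  obtain ⟨W, g, hdesc, hcov⟩ := UCocom.exists_dsum C
  obtain ⟨h, hh⟩ := hdesc (A.U →ₗ[K] A'.U) fun i => (convCoe (C i) A' ∘ₗ lin (φ i)).flip
  obtain ⟨Φ, hΦ⟩ := exists_conv_lift g hcov φ h.flip fun y i x =>
    LinearMap.congr_fun (hh i x) y
  obtain ⟨Q, π, ψ, hπ, hsep⟩ := exists_separating_quot Φ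
  refine ⟨Q, ψ, hsep, fun D θ y => ?_⟩
  let i : ι := ⟨fun t => val θ t y, D, θ, y, fun _ => rfl⟩
  refine ⟨UCocom.lin π (UCocom.lin (g i) (x i)), fun t => ?_⟩
  rw [val_lin π hπ, val_lin (g i) (φ := φ i) (fun y x => ?_)]
  · exact hx i t
  · rw [hΦ]
    exact (LinearMap.congr_fun (hh i x) y).symm

/-- The coalgebra `{A, A'}` of maps between two algebras. -/
noncomputable def homObj (A A' : PAlg P) : UCocom K := (exists_hom_object A A').choose

/-- The universal morphism `A ⟶ [{A, A'}, A']`. -/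
noncomputable def homCoev (A A' : PAlg P) : A ⟶ conv (homObj A A') A' :=
  (exists_hom_object A A').choose_spec.choose

theorem eq_zero_of_val_homCoev (A A' : PAlg P) {x : (homObj A A').X}
    (h : ∀ t, val (homCoev A A') t x = 0) : x = 0 :=
  (exists_hom_object A A').choose_spec.choose_spec.1 x h

theorem homObj_separating (A A' : PAlg P) {x x' : (homObj A A').X}
    (h : ∀ t, val (homCoev A A') t x = val (homCoev A A') t x') : x = x' :=
  sub_eq_zero.1 (eq_zero_of_val_homCoev A A' fun t => by rw [map_sub, h t, sub_self])

theorem exists_homObj_val {C : UCocom K} (φ : A ⟶ conv C A') (x : C.X) :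
    ∃ z : (homObj A A').X, ∀ t, val (homCoev A A') t z = val φ t x :=
  (exists_hom_object A A').choose_spec.choose_spec.2 C φ x

/-- Morphisms `A ⟶ [C, A']` are the pullbacks of the universal one. -/
noncomputable def homObjEquiv (C : UCocom K) (A A' : PAlg P) :
    (C ⟶ homObj A A') ≃ (A ⟶ conv C A') :=
  Equiv.ofBijective (fun g => homCoev A A' ≫ convMap g (𝟙 A')) <| by
    refine ⟨fun g g' h => UCocom.hom_ext fun x => homObj_separating A A' fun t => ?_, fun φ => ?_⟩
    · rw [val_lin g (φ := homCoev A A' ≫ convMap g (𝟙 A')) (fun y x => rfl),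
        val_lin g' (φ := homCoev A A' ≫ convMap g' (𝟙 A')) (fun y x => rfl)]
      exact congrArg (fun φ => val φ t x) h
    · choose f hf using exists_homObj_val (A := A) (A' := A') φ
      obtain ⟨g, hg⟩ := exists_hom_of_val φ (homCoev A A')
        (fun x h => eq_zero_of_val_homCoev A A' h)
        { toFun := f
          map_add' := fun x y => homObj_separating A A' fun t => by
            simp only [map_add, hf]
          map_smul' := fun c x => homObj_separating A A' fun t => by
            simp only [map_smul, hf, RingHom.id_apply] }
        fun t x => hf x t
      exact ⟨g, hom_ext fun y => convCoe_injective (LinearMap.ext fun x => (hg y x).symm)⟩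

end PAlg

/-! ### Atoms -/

namespace DGMod

theorem proj_of_mem_of_ne (V : DGMod K) {m n : ℤ} {x : V} (hx : x ∈ V.gr m) (h : m ≠ n) :
    V.proj n x = 0 := by
  rw [proj, V.elim_of_mem _ hx, if_neg h]; rfl

theorem exists_sum_proj (V : DGMod K) (x : V) :
    ∃ s : Finset ℤ, ∀ t, s ⊆ t → ∑ n ∈ t, V.proj n x = x := by
  classical
  refine V.homogeneous_induction (p := fun x => ∃ s : Finset ℤ, ∀ t, s ⊆ t →
    ∑ n ∈ t, V.proj n x = x) x ⟨∅, fun t _ => by simp⟩ ?_ fun n x hx => ⟨{n}, fun t ht => ?_⟩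
  · rintro x y ⟨s, hs⟩ ⟨s', hs'⟩
    refine ⟨s ∪ s', fun t ht => ?_⟩
    simp only [map_add, Finset.sum_add_distrib]
    rw [hs t (Finset.union_subset_left ht), hs' t (Finset.union_subset_right ht)]
  · rw [Finset.sum_eq_single n (fun m _ hm => V.proj_of_mem_of_ne hx hm.symm)
      (fun h => absurd (ht (Finset.mem_singleton_self n)) h), V.proj_of_mem hx]

theorem finite_proj_ne_zero (V : DGMod K) (x : V) : {n | V.proj n x ≠ 0}.Finite := by
  classical
  obtain ⟨s, hs⟩ := V.exists_sum_proj x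
  refine s.finite_toSet.subset fun n hn => by_contra fun hns => hn ?_
  have := hs (insert n s) (Finset.subset_insert n s)
  rwa [Finset.sum_insert hns, hs s subset_rfl, add_eq_right] at this

end DGMod

namespace UCocom

variable {C : UCocom K}

theorem map_proj_comul (i j : ℤ) (x : C.X) :
    TensorProduct.map (C.X.proj i) (C.X.proj j) (C.comul x) =
      TensorProduct.map (C.X.proj i) (C.X.proj j) (C.comul (C.X.proj (i + j) x)) := by
  refine C.X.homogeneous_induction (p := fun x =>
    TensorProduct.map (C.X.proj i) (C.X.proj j) (C.comul x) =
      TensorProduct.map (C.X.proj i) (C.X.proj j) (C.comul (C.X.proj (i + j) x))) x (by simp)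
    (fun x y hx hy => by simp only [map_add, hx, hy]) fun n x hx => ?_
  by_cases h : n = i + j
  · subst h; rw [C.X.proj_of_mem hx]
  · rw [C.X.proj_of_mem_of_ne hx h, map_zero, map_zero, ← Submodule.mem_bot K]
    refine DGMod.tensor_mem ⊥ (TensorProduct.map (C.X.proj i) (C.X.proj j))
      (fun p q v w hv hw hpq => ?_) (C.comul_mem hx)
    rw [Submodule.mem_bot, TensorProduct.map_tmul]
    by_cases hp : p = i
    · rw [C.X.proj_of_mem_of_ne hw (by omega), TensorProduct.tmul_zero]
    · rw [C.X.proj_of_mem_of_ne hv hp, TensorProduct.zero_tmul]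

namespace IsDGAtom

variable {a : C.X} (ha : C.IsDGAtom a)
include ha

theorem counit_eq_one : C.counit a = 1 := by
  have h := congrArg (TensorProduct.lid K C.X) (C.counit_tmul_comul a)
  rw [ha.comul_eq, TensorProduct.map_tmul, TensorProduct.lid_tmul, TensorProduct.lid_tmul,
    LinearMap.id_apply] at h
  exact smul_left_injective K ha.ne_zero h

theorem proj_add_ne_zero {i : ℤ} (h : C.X.proj i a ≠ 0) : C.X.proj (i + i) a ≠ 0 := by
  intro h0
  have h1 := map_proj_comul i i a
  rw [h0, map_zero, map_zero, ha.comul_eq, TensorProduct.map_tmul] at h1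
  refine h ((Module.forall_dual_apply_eq_zero_iff K _).1 fun l => ?_)
  have h2 := congrArg (LinearMap.mul' K K) (congrArg (TensorProduct.map l l) h1)
  rw [TensorProduct.map_tmul, LinearMap.mul'_apply, map_zero, map_zero] at h2
  exact mul_self_eq_zero.1 h2

/-- A dg atom has degree `0`: a component of degree `i ≠ 0` would entail components of all the
degrees `2 ^ k * i`. -/
theorem mem : a ∈ C.X.gr 0 := by
  have h0 : ∀ i, i ≠ 0 → C.X.proj i a = 0 := fun i hi => by_contra fun h => by
    have hk : ∀ k : ℕ, C.X.proj (2 ^ k * i) a ≠ 0 := fun k => by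
      induction k with
      | zero => simpa using h
      | succ k ih =>
        have := ha.proj_add_ne_zero ih
        rwa [show (2 : ℤ) ^ (k + 1) * i = 2 ^ k * i + 2 ^ k * i by ring]
    refine Set.infinite_of_injective_forall_mem (f := fun k : ℕ => (2 : ℤ) ^ k * i)
      (fun k l hkl => ?_) hk (C.X.finite_proj_ne_zero a)
    exact Int.pow_right_injective (le_refl 2) (mul_right_cancel₀ hi hkl)
  obtain ⟨s, hs⟩ := C.X.exists_sum_proj a
  rw [← hs s subset_rfl]
  refine sum_mem fun i _ => ?_
  by_cases hi : i = 0
  · subst hi; exact C.X.proj_mem 0 a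
  · rw [h0 i hi]; exact zero_mem _

end IsDGAtom

/-- The morphism from the unit coalgebra given by a dg atom. -/
noncomputable def ofAtom {a : C.X} (ha : C.IsDGAtom a) : 𝟙_ (UCocom K) ⟶ C :=
  mkHom (C := 𝟙_ (UCocom K)) (show DGMod.Hom (DGMod.unit K) C.X from
    { lin := LinearMap.toSpanSingleton K C.X a
      map_mem := fun {n c} hc => by
        rcases DGMod.unit_mem hc with rfl | rfl
        · exact Submodule.smul_mem _ c ha.mem
        · rw [map_zero]; exact zero_mem _
      map_d := fun c => by
        refine (zero_smul K a).trans ?_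
        rw [LinearMap.toSpanSingleton_apply, map_smul, ha.d_eq, smul_zero] })
    (DGMod.hom_ext (LinearMap.ext_ring (by
      change C.comul ((1 : K) • a) = TensorProduct.map (LinearMap.toSpanSingleton K C.X a)
        (LinearMap.toSpanSingleton K C.X a) ((TensorProduct.lid K K).symm 1)
      rw [one_smul, ha.comul_eq, TensorProduct.lid_symm_apply, TensorProduct.map_tmul,
        LinearMap.toSpanSingleton_apply, one_smul])))
    (DGMod.hom_ext (LinearMap.ext_ring (by
      change C.counit ((1 : K) • a) = 1
      rw [one_smul, ha.counit_eq_one])))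

theorem lin_ofAtom {a : C.X} (ha : C.IsDGAtom a) : lin (ofAtom ha) (1 : K) = a := one_smul K a

theorem isDGAtom_lin_one (g : 𝟙_ (UCocom K) ⟶ C) : C.IsDGAtom (lin g (1 : K)) where
  ne_zero h := by
    have := lin_counit g (1 : K)
    rw [h, map_zero] at this
    exact zero_ne_one (α := K) this
  comul_eq := by
    refine (lin_comul g (1 : K)).trans ?_
    change TensorProduct.map (lin g) (lin g) ((TensorProduct.lid K K).symm 1) = _
    rw [TensorProduct.lid_symm_apply]
    rfl
  d_eq := by
    refine (lin_d g (1 : K)).symm.trans ?_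
    exact map_zero (lin g)

variable (C) in
/-- Dg atoms are the morphisms from the unit coalgebra. -/
noncomputable def atomEquiv : {a : C.X // C.IsDGAtom a} ≃ (𝟙_ (UCocom K) ⟶ C) where
  toFun a := ofAtom a.2
  invFun g := ⟨lin g (1 : K), isDGAtom_lin_one g⟩
  left_inv a := Subtype.ext (lin_ofAtom a.2)
  right_inv g := by
    have : lin (ofAtom (isDGAtom_lin_one g)) = lin g := LinearMap.ext_ring (lin_ofAtom _)
    exact hom_ext fun x => LinearMap.congr_fun this x

end UCocom

namespace PAlg

variable {P : DGOperad K}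

variable (P) in
/-- The functors `[C, -]` have the left adjoints `- ◁ C`, and the functors `[-, A']` are represented
by the coalgebras `{A, A'}`. -/
noncomputable def convRepresentable : RepresentableCoaction (UCocom K) (PAlg P) where
  tens A C := tens A C
  tensEquiv := tensCurryEquiv
  tensEquiv_comp _ _ := rfl
  hom A A' := homObj A A'
  homEquiv := homObjEquiv _ _ _
  homEquiv_comp _ _ := rfl

/-- Dg atoms of `{A, A'}` are the morphisms from `A` to `A'`. -/
noncomputable def homObjAtomEquiv (A A' : PAlg P) :
    {a : (homObj A A').X // (homObj A A').IsDGAtom a} ≃ (A ⟶ A') :=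
  (homObj A A').atomEquiv.trans <|
    (homObjEquiv _ A A').trans (Iso.homCongr (Iso.refl A) (convUnitIso A'))

theorem lin_homObjAtomEquiv (A A' : PAlg P)
    (a : {a : (homObj A A').X // (homObj A A').IsDGAtom a}) (x : A.U) :
    lin (homObjAtomEquiv A A' a) x = convCoe _ A' (lin (homCoev A A') x) a := by
  refine Eq.trans ?_ (congrArg (convCoe _ A' (lin (homCoev A A') x)) (UCocom.lin_ofAtom a.2))
  rfl

end PAlg

end

theorem mainTheorem6 {K : Type u} [Field K] (P : DGOperad K) :
    ∃ (S : TensoredCotensoredEnriched (UCocom K) (PAlg P))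
      (ev : ∀ (C : UCocom K) (A : PAlg P),
        (S.cotensor.actionObj (op C) A).U ≅ DGMod.ihom C.X A.U)
      (G : Enrichment S.enr),
      S.IsConvolution ev ∧
      (∀ (A : PAlg P) (C : UCocom K), S.IsTensorQuotient ev A C) ∧
      S.IsInduced G ∧
      ∀ A A' : PAlg P,
        ∃ Φ : {a : ((S.enr.obj (op A)).obj A').X // UCocom.IsDGAtom _ a} ≃ (A ⟶ A'),
          ∀ a x, PAlg.lin (Φ a) x = S.toLinearMap ev _ A' (PAlg.lin (S.coeval A A') x) a := by
  let R := PAlg.convRepresentable P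
  refine ⟨R.toTensoredCotensoredEnriched, fun C A => Iso.refl _, R.enrichment,
    ⟨PAlg.convCoe_convMap, fun C A _ p f q hf => PAlg.conv_act C A p hf,
      PAlg.convCoe_convAssocIso, PAlg.lin_convUnitIso⟩, fun A C => ?_, R.isInduced,
    fun A A' => ⟨PAlg.homObjAtomEquiv A A', fun a x => ?_⟩⟩
  · refine ⟨PAlg.free P (A.U ⊗ C.X), PAlg.freeι P (A.U ⊗ C.X), PAlg.tensMk A C,
      PAlg.free_isFreeOn, (PAlg.tens_isIdeal A C).lin_toQuot_surjective,
      (PAlg.tens_isIdeal A C).ker_lin_toQuot, fun y x => ?_⟩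
    have h : R.toTensoredCotensoredEnriched.adjUnit A C = PAlg.tensCurry (𝟙 _) :=
      R.homEquiv.apply_symm_apply _
    rw [h]
    exact PAlg.convCoe_tensCurry (𝟙 _) y x
  · have h : R.toTensoredCotensoredEnriched.coeval A A' = PAlg.homCoev A A' :=
      PAlg.hom_ext fun y => PAlg.convCoe_injective rfl
    refine (PAlg.lin_homObjAtomEquiv A A' a x).trans ?_
    rw [h]
    rfl
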